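/- Setting. Let $H$ be a hypothesis class of measurable functions $X\to\{0,1\}$ of finite VC-dimension $d\ge 1$, let $k\ge 2$ players have distributions $D_1,\dots,D_k$ on $X$, let all labels be given by a target $h^*\in H$, and let $0<\varepsilon<1$, $0<\delta<1$. All communication is written on a blackboard that the center and all players can read. The algorithms use a (measurable) rule that selects, for every sample labelled by some hypothesis of $H$, a hypothesis of $H$ consistent with it. Let $\delta'=\delta/(2\lceil\log_2 k\rceil)$, and let $m_{\varepsilon,\delta}$ be the least sample size for which every such rule satisfies $\Pr[\mathrm{err}\ge\varepsilon]\le\delta$ for all distributions on $X$ and all targets in $H$. *Personalized Learning* starts with $N_1=\{1,\dots,k\}$. In round $j=1,\dots,\lceil\log_2 k\rceil$ (stopping when $N_j=\emptyset$) the players in $N_j$ transmit $m_{\varepsilon/4,\delta'}$ samples from the uniform mixture of the $D_i$, $i\in N_j$ (the numbers requested from the players being multinomial and announced by the center), and a hypothesis $h_j$ consistent with them is selected. Each $i\in N_j$ tests $h_j$ on $O(\ln(|N_j|/(\varepsilon\delta'))/\varepsilon)$ fresh private samples from $D_i$ and broadcasts one bit telling whether the empirical error is at most $3\varepsilon/4$.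 If so, player $i$ keeps $h_j$ as its classifier and leaves; the others form $N_{j+1}$. *Personalized Learning using Boosting* is the same algorithm with $h_j$ computed by Distributed Boosting: the players in $N_j$ draw private reservoirs whose sizes are multinomial with total $O((d_{\mathrm{boost}}\log(2/\varepsilon)+\log(1/\delta'))/\varepsilon)$, $d_{\mathrm{boost}}=d\,T\log(T+1)$, and are announced by the center; then for $T=O(\log(2/\varepsilon))$ rounds of AdaBoost (with a constant weight factor) each player reports the total weight of its reservoir up to a factor $2$, the center announces a multinomial split of $O(d+\log((T+1)/\delta'))$ requests according to these reports, the players transmit that many points resampled from their reservoirs according to the boosting weights, and everybody computes locally the same weak hypothesis consistent with the transmitted points; $h_j$ is the majority vote of the $T$ weak hypotheses. Theorem. The absolute constants in these $O(\cdot)$'s can be chosen such that, for absolute constants $C,a$ and with $\tilde O(f)$ standing for a quantity at most $C f\,(\log(2+f))^{a}\log(2/\delta)$: 1. with probability at least $1-\delta$, Personalized Learning using Boosting provides every player $i$ with a classifier whose generalization error on $D_i$ is less than $\varepsilon$; 2. in every run it communicates at most $\tilde O\big(\log(k)\,d\,\log(2/\varepsilon)\big)$ samples plus $\tilde O\big(k\log(d+1)\log(2/\varepsilon)\big)$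 additional bits; 3. this is exponentially better in $1/\varepsilon$ than Personalized Learning: if $d\ge 2$, Personalized Learning communicates in every run a number $P\ge d/(C\varepsilon)$ of samples, and the number of samples communicated in every run of Personalized Learning using Boosting is at most $\tilde O\big(\log(k)\,d\,\log(2+P)\big)$. -/

import Mathlib

open MeasureTheory

universe u

namespace CollabPAC

noncomputable section

section

variable {X : Type u}

/-! ### Hypothesis classes, consistent learners, sample complexity -/

/-- `H` realizes every labelling of the finite set `A`. -/
def Shatters (H : Set (X → Bool)) (A : Finset X) : Prop :=
  ∀ f : X → Bool, ∃ h ∈ H, ∀ x ∈ A, h x = f x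

/-- The VC-dimension of `H` is (finite and equal to) `d`. -/
def HasVCDim (H : Set (X → Bool)) (d : ℕ) : Prop :=
  IsGreatest {n : ℕ | ∃ A : Finset X, A.card = n ∧ Shatters H A} d

/-- The generalization error of the classifier `h` on the distribution `D`, for the
target `hstar`. -/
def err [MeasurableSpace X] (D : Measure X) (hstar h : X → Bool) : ℝ :=
  D.real {x | h x ≠ hstar x}

/-- A rule that selects, for every labelled sample that some hypothesis of `H` fits, a
hypothesis of `H` consistent with the sample. The rule is (jointly) measurable, so that the
error of the selected hypothesis is a random variable. -/
structure IsConsistentLearner [MeasurableSpace X] (H : Set (X → Bool))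
    (A : List (X × Bool) → X → Bool) : Prop where
  mem : ∀ S : List (X × Bool), (∃ h ∈ H, ∀ z ∈ S, h z.1 = z.2) → A S ∈ H
  consistent : ∀ S : List (X × Bool), (∃ h ∈ H, ∀ z ∈ S, h z.1 = z.2) → ∀ z ∈ S, A S z.1 = z.2
  measurable : ∀ n : ℕ, Measurable fun p : (Fin n → X × Bool) × X => A (List.ofFn p.1) p.2

/-- `m` samples suffice for every consistent learner of `H` to satisfy the realizable PAC
criterion with parameters `ε`, `δ`, for all distributions and all targets in `H`. -/
def IsPACSize [MeasurableSpace X] (H : Set (X → Bool)) (ε δ : ℝ) (m : ℕ) : Prop :=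
  ∀ A : List (X × Bool) → X → Bool, IsConsistentLearner H A → ∀ hstar ∈ H,
    ∀ (D : Measure X) [IsProbabilityMeasure D],
      (Measure.pi fun _ : Fin m => D)
        {x | ε ≤ err D hstar (A (List.ofFn fun r => (x r, hstar (x r))))} ≤ ENNReal.ofReal δ

/-- The realizable PAC sample complexity `m_{ε,δ}` of `H`. -/
def sampleComplexity [MeasurableSpace X] (H : Set (X → Bool)) (ε δ : ℝ) : ℕ :=
  sInf {m : ℕ | IsPACSize H ε δ m}

/-! ### Communication: the shared blackboard -/

/-- An item written on the shared blackboard: a labelled sample or a string of bits. -/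
inductive Message (X : Type u) : Type u
  | sample (z : X × Bool) : Message X
  | bits (b : List Bool) : Message X

def Message.samples : Message X → ℕ
  | .sample _ => 1
  | .bits _ => 0

def Message.bitLength : Message X → ℕ
  | .sample _ => 0
  | .bits b => b.length

/-- Number of samples transmitted. -/
def samplesSent (tr : List (Message X)) : ℕ := (tr.map Message.samples).sum

/-- Number of additional bits transmitted. -/
def bitsSent (tr : List (Message X)) : ℕ := (tr.map Message.bitLength).sum

/-- A self-delimiting binary code for natural numbers (`2 * Nat.size v + 1` bits). -/
def encodeNat (v : ℕ) : List Bool := List.replicate (Nat.size v) true ++ false :: Nat.bits v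

/-! ### Randomness -/

/-- Names of the examples that player `i` may draw from its distribution in round `j`:
for its reservoir and for `TEST`. -/
inductive Draw (k : ℕ)
  | reservoir (j : ℕ) (i : Fin k) (r : ℕ)
  | test (j : ℕ) (i : Fin k) (r : ℕ)

def Draw.player {k : ℕ} : Draw k → Fin k
  | .reservoir _ i _ => i
  | .test _ i _ => i

/-- Names of the internal random numbers (uniform in `[0,1]`): the center's, for reservoir
sizes (`slot`) and for the sizes requested in a boosting round `t` (`request`), and player `i`'s,
for resampling from its reservoir (`pick`). -/
inductive Coin (k : ℕ)
  | slot (j l : ℕ)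
  | request (j t l : ℕ)
  | pick (j t : ℕ) (i : Fin k) (r : ℕ)

abbrev Randomness (X : Type u) (k : ℕ) : Type u := (Draw k → X) × (Coin k → unitInterval)

/-- All examples and all internal random numbers are independent; an example of player `i` has
law `D i`. -/
def law [MeasurableSpace X] {k : ℕ} (D : Fin k → Measure X) [∀ i, IsProbabilityMeasure (D i)] :
    Measure (Randomness X k) :=
  (Measure.infinitePi fun q : Draw k => D q.player).prod
    (Measure.infinitePi fun _ : Coin k => (volume : Measure unitInterval))

/-- Walk through a weighted list until the threshold `v` is used up. -/
def pickFrom {α : Type*} : List (α × ℕ) → ℝ → Option α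
  | [], _ => none
  | [(a, _)], _ => some a
  | (a, w) :: b :: L, v => if v < w then some a else pickFrom (b :: L) (v - w)

/-- For uniform `u`, a random element of a list, drawn with probability proportional to the
weights (provided that these are not all zero). -/
def weightedPick {α : Type*} (L : List (α × ℕ)) (u : ℝ) : Option α :=
  pickFrom L (u * ((L.map Prod.snd).sum : ℕ))

/-- The multinomial distribution: `n` independent weighted draws of an `i`, counted. -/
def multinomial {k : ℕ} (L : List (Fin k × ℕ)) (n : ℕ) (coin : ℕ → unitInterval) (i : Fin k) : ℕ :=
  ((List.range n).filter fun l => weightedPick L (coin l) = some i).length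

/-- The players in `N`, in increasing order. -/
def players {k : ℕ} (N : Finset (Fin k)) : List (Fin k) := (List.finRange k).filter (· ∈ N)

/-! ### Personalized Learning -/

/-- Numbers of examples that the players draw in the first step of round `j`, for a total of `m`
examples from the uniform mixture of the players in `N`. -/
def mixtureSizes {k : ℕ} (m j : ℕ) (N : Finset (Fin k)) (ω : Randomness X k) : Fin k → ℕ :=
  multinomial ((players N).map fun i => (i, 1)) m fun l => ω.2 (.slot j l)

/-- The labelled sample that player `i` draws in the first step of round `j`. -/
def reservoir {k : ℕ} (hstar : X → Bool) (m j : ℕ) (N : Finset (Fin k)) (ω : Randomness X k)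
    (i : Fin k) : List (X × Bool) :=
  (List.range (mixtureSizes m j N ω i)).map fun r =>
    (ω.1 (.reservoir j i r), hstar (ω.1 (.reservoir j i r)))

/-- The center tells the players in `N` the numbers `s i`. -/
def announce {k : ℕ} (N : Finset (Fin k)) (s : Fin k → ℕ) : List (Message X) :=
  (players N).map fun i => .bits (encodeNat (s i))

/-- First step of Personalized Learning: the players transmit `m` samples from the mixture, and
a consistent hypothesis is selected. Returns the hypothesis and the communication. -/
def plainStep {k : ℕ} (A : List (X × Bool) → X → Bool) (hstar : X → Bool) (m : ℕ)
    (ω : Randomness X k) (j : ℕ) (N : Finset (Fin k)) : (X → Bool) × List (Message X) :=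
  let S := (players N).flatMap (reservoir hstar m j N ω)
  (A S, announce N (mixtureSizes m j N ω) ++ S.map Message.sample)

/-- Size `O(ln(n / (ε δ)) / ε)` of the test sample of a player, if there are `n` players. -/
def testSize (c ε δ : ℝ) (n : ℕ) : ℕ := ⌈c * Real.log (n / (ε * δ)) / ε⌉₊

/-- `TEST` of player `i` in round `j`: its empirical error on `T` fresh examples is at most
`3 ε / 4`. -/
def PassesTest {k : ℕ} (hstar : X → Bool) (ε : ℝ) (T : ℕ) (ω : Randomness X k) (j : ℕ)
    (h : X → Bool) (i : Fin k) : Prop :=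
  (((List.range T).countP fun r =>
    h (ω.1 (.test j i r)) ≠ hstar (ω.1 (.test j i r)) : ℕ) : ℝ) / T ≤ 3 * ε / 4

structure State (X : Type u) (k : ℕ) where
  /-- The players `N_j` that have no classifier yet. -/
  active : Finset (Fin k)
  /-- The classifiers assigned so far. -/
  output : Fin k → Option (X → Bool)
  /-- The contents of the blackboard. -/
  transcript : List (Message X)

open Classical in
/-- The loop of Personalized Learning, with an arbitrary first step `learn`. In each round all
remaining players test the hypothesis locally and broadcast one bit, telling whether it passed;
those for which it passed keep it and leave. The loop stops when no player remains. -/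
def loop {k : ℕ} (learn : ℕ → Finset (Fin k) → (X → Bool) × List (Message X))
    (hstar : X → Bool) (cTest ε δ' : ℝ) (ω : Randomness X k) : ℕ → State X k
  | 0 => ⟨Finset.univ, fun _ => none, []⟩
  | j + 1 =>
    let s := loop learn hstar cTest ε δ' ω j
    if s.active = ∅ then s else
      let h := (learn j s.active).1
      let G := s.active.filter
        (PassesTest hstar ε (testSize cTest ε δ' s.active.card) ω j h)
      { active := s.active \ G
        output := fun i => if i ∈ G then some h else s.output i
        transcript := s.transcript ++ (learn j s.active).2 ++
          (players s.active).map fun i => .bits [decide (i ∈ G)] }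

/-- Number `⌈log₂ k⌉` of rounds. -/
def rounds (k : ℕ) : ℕ := Nat.clog 2 k

/-- The confidence parameter `δ' = δ / (2 ⌈log₂ k⌉)` of a single step. -/
def stepConfidence (k : ℕ) (δ : ℝ) : ℝ := δ / (2 * rounds k)

/-- Personalized Learning: in every round `m_{ε/4,δ'}` samples from the mixture of the remaining
players are transmitted. -/
def personalizedLearning [MeasurableSpace X] {k : ℕ} (cTest : ℝ) (H : Set (X → Bool))
    (A : List (X × Bool) → X → Bool) (hstar : X → Bool) (ε δ : ℝ) (ω : Randomness X k) :
    State X k :=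
  loop (plainStep A hstar (sampleComplexity H (ε / 4) (stepConfidence k δ)) ω) hstar cTest ε
    (stepConfidence k δ) ω (rounds k)

/-! ### Distributed Boosting -/

/-- The boosting weight of a labelled example: it doubles whenever a weak hypothesis errs on the
example (AdaBoost with the constant weight factor for a weak learner of constant error). -/
def boostWeight (hs : List (X → Bool)) (z : X × Bool) : ℕ :=
  2 ^ hs.countP fun h => h z.1 ≠ z.2

/-- Unweighted majority vote (for constant weight factors all votes of AdaBoost are equal). -/
def majority (hs : List (X → Bool)) (x : X) : Bool :=
  decide (hs.length < 2 * hs.countP fun h => h x)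

/-- What a player reports about the total weight `W` of its reservoir: `0` for `W = 0`, otherwise
the exponent `e` with `2 ^ (e - 1) ≤ W < 2 ^ e`. -/
def report (hs : List (X → Bool)) (S : List (X × Bool)) : ℕ :=
  Nat.size (S.map (boostWeight hs)).sum

/-- The center's approximation, within a factor two, of a total weight reported as `e`. -/
def approxWeight (e : ℕ) : ℕ := if e = 0 then 0 else 2 ^ e

/-- Round `t` of Distributed Boosting on the reservoirs `S i`, `i ∈ N`, after the weak hypotheses
`hs`. The players report their total weights; the center draws the numbers of examples requested
from the players, `n` in total, from the multinomial distribution of these weights; the players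
transmit that many examples, drawn from their reservoirs proportionally to the boosting weights;
everybody sees the examples and computes the same weak hypothesis. -/
def boostRound {k : ℕ} (A : List (X × Bool) → X → Bool) (n j : ℕ) (N : Finset (Fin k))
    (S : Fin k → List (X × Bool)) (ω : Randomness X k) (t : ℕ) (hs : List (X → Bool)) :
    (X → Bool) × List (Message X) :=
  let reports := fun i => report hs (S i)
  let requests := multinomial ((players N).map fun i => (i, approxWeight (reports i))) n
    fun l => ω.2 (.request j t l)
  let sent := (players N).flatMap fun i => (List.range (requests i)).filterMap fun r =>
    weightedPick ((S i).map fun z => (z, boostWeight hs z)) (ω.2 (.pick j t i r))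
  (A sent, announce N reports ++ announce N requests ++ sent.map Message.sample)

/-- The weak hypotheses of the first `t` boosting rounds, and the communication. -/
def boost {k : ℕ} (A : List (X × Bool) → X → Bool) (n j : ℕ) (N : Finset (Fin k))
    (S : Fin k → List (X × Bool)) (ω : Randomness X k) : ℕ → List (X → Bool) × List (Message X)
  | 0 => ([], [])
  | t + 1 =>
    let p := boost A n j N S ω t
    let q := boostRound A n j N S ω t p.1
    (q.1 :: p.1, p.2 ++ q.2)

/-- Distributed Boosting with reservoirs of total size `m`, `T` rounds and `n` examples per round.
The reservoir sizes are drawn and announced in a preprocessing step. -/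
def boostStep {k : ℕ} (A : List (X × Bool) → X → Bool) (hstar : X → Bool) (m T n : ℕ)
    (ω : Randomness X k) (j : ℕ) (N : Finset (Fin k)) : (X → Bool) × List (Message X) :=
  let p := boost A n j N (reservoir hstar m j N ω) ω T
  (majority p.1, announce N (mixtureSizes m j N ω) ++ p.2)

/-- The absolute constants in the `O`-bounds for the parameters of the algorithm. -/
structure Constants where
  rounds : ℝ
  weak : ℝ
  reservoir : ℝ
  test : ℝ

/-- `O(log(1/ε))` boosting rounds. -/
def boostRounds (c ε : ℝ) : ℕ := ⌈c * Real.log (2 / ε)⌉₊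

/-- `O(d + log(T/δ'))` examples for each of the `T` runs of the weak learner. -/
def weakSize (c : ℝ) (d T : ℕ) (δ' : ℝ) : ℕ := ⌈c * (d + Real.log ((T + 1) / δ'))⌉₊

/-- `O((d_boost log(1/ε) + log(1/δ')) / ε)` examples in all reservoirs, where
`d_boost = d T log T`. -/
def reservoirSize (c : ℝ) (d T : ℕ) (ε δ' : ℝ) : ℕ :=
  ⌈c * (d * T * Real.log (T + 1) * Real.log (2 / ε) + Real.log (1 / δ')) / ε⌉₊

/-- Personalized Learning using Boosting: Personalized Learning with Distributed Boosting as its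
first step, for a class of VC-dimension `d`. -/
def personalizedBoosting {k : ℕ} (c : Constants) (d : ℕ) (A : List (X × Bool) → X → Bool)
    (hstar : X → Bool) (ε δ : ℝ) (ω : Randomness X k) : State X k :=
  let δ' := stepConfidence k δ
  let T := boostRounds c.rounds ε
  loop (boostStep A hstar (reservoirSize c.reservoir d T ε δ') T (weakSize c.weak d T δ') ω) hstar
    c.test ε δ' ω (rounds k)

/-- The algorithm has completed correctly: every player holds a classifier of generalization
error less than `ε` on its own distribution. -/
def Completed [MeasurableSpace X] {k : ℕ} (D : Fin k → Measure X) (hstar : X → Bool) (ε : ℝ)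
    (s : State X k) : Prop :=
  ∀ i, ∃ h, s.output i = some h ∧ err (D i) hstar h < ε

end

/-- `f` times the `a`-th power of `log f`, the shape of a soft-`O` bound. -/
def softO (a : ℕ) (f : ℝ) : ℝ := f * Real.log (2 + f) ^ a

end

end CollabPAC

/-! A round succeeds as soon as its hypothesis has error below `ε / 4` on the uniform mixture of the
remaining players and all tests are right. By Markov's inequality fewer than half of these players
then have error at least `ε / 2` (`card_failing_lt`), and a test with threshold `3 ε / 4` separates
errors below `ε / 2` from errors at least `ε` (`law_test_le`). So every successful round more than
halves the set of players, and `⌈log₂ k⌉` rounds suffice (`completed_of_not_roundFails`). Each round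
can fail in two ways, each of probability at most `δ'`, which adds up to `δ`.

That boosting learns the mixture rests on one symmetrization bound, `relative_deviation`, for rules
with few patterns on a double sample, the patterns being counted by Sauer-Shelah. It is used twice:
for the points resampled by boosting weight, where a hypothesis consistent with them rarely errs on
an eighth of the total weight (`law_weak_error_le`), and for the reservoirs, where a majority of `T`
hypotheses has at most the `T`-th power of the Sauer bound as its number of patterns
(`law_unrepresentative_le`). Both samples are independent draws from a mixture because multinomial
counts followed by that many draws per player have this law (`map_names_values`). If no weak
hypothesis errs on an eighth of the weight, the total weight grows by a factor of at most `9/8` per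
round, while an example on which the majority errs weighs at least `2^(T/2)`. Since `81 < 128`, with
`T ≥ 30 log (2/ε)` at most a fraction `ε/32` of the reservoirs is misclassified
(`misclassified_boost_le`).

Adaptivity is treated by resampling instead of conditional probabilities: two independent copies of
the randomness, spliced along a set of coordinates, have the original law (`law_le_of_splice`).

The communication bounds are deterministic. The reservoirs stay private, so a round of the loop
sends at most `T n` samples, and a weight is reported by its exponent, whose code has doubly
logarithmic length. For the comparison, a shattered set with one heavy point and a learner that
prefers bad hypotheses show that Personalized Learning needs `P ≥ d / (4 ε)` samples
(`IsPACSize.div_le`); hence `log (2/ε)` is `O(log (2 + P))`. -/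

namespace CollabPAC

noncomputable section

/-! ### Measurability of functions of random lists -/

section ListMeasurability

variable {α β γ δ : Type*} [MeasurableSpace α] [MeasurableSpace β] [MeasurableSpace γ]
  [MeasurableSpace δ]

/-- Lists over a measurable space, as the disjoint union of the finite powers. -/
instance listMeasurableSpace : MeasurableSpace (List α) :=
  MeasurableSpace.map (fun p : Σ n, Fin n → α => List.ofFn p.2) inferInstance

theorem measurable_of_ofFn {f : List α → β}
    (h : ∀ n, Measurable fun v : Fin n → α => f (List.ofFn v)) : Measurable f := by
  intro s hs
  change MeasurableSet ((fun p : Σ n, Fin n → α => List.ofFn p.2) ⁻¹' (f ⁻¹' s))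
  refine MeasurableSpace.measurableSet_iInf.2 fun n => ?_
  exact h n hs

theorem measurable_ofFn (n : ℕ) : Measurable (List.ofFn : (Fin n → α) → List α) := by
  intro s hs
  have h1 : MeasurableSet ((fun p : Σ n, Fin n → α => List.ofFn p.2) ⁻¹' s) := hs
  exact MeasurableSpace.measurableSet_iInf.1 h1 n

theorem measurable_list_length : Measurable (List.length : List α → ℕ) :=
  measurable_of_ofFn fun n => by simp

theorem measurable_list_getD (i : ℕ) (x : α) : Measurable fun L : List α => L.getD i x := by
  refine measurable_of_ofFn fun n => ?_
  by_cases h : i < n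
  · simpa [List.getD_eq_getElem?_getD, List.getElem?_ofFn, h] using
      measurable_pi_apply (X := fun _ : Fin n => α) ⟨i, h⟩
  · simp [List.getD_eq_getElem?_getD, h]

/-- A function of a list and a parameter is measurable if its restrictions to lists of fixed length
are. -/
theorem measurable_list_prod {f : List α × γ → β}
    (h : ∀ n, Measurable fun p : (Fin n → α) × γ => f (List.ofFn p.1, p.2)) : Measurable f := by
  -- On lists of a fixed length the entries are recovered by `getD`, which needs a default element;
  -- over an empty type only the empty list exists.
  rcases isEmpty_or_nonempty α with hα | ⟨⟨x⟩⟩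
  · have h0 := (h 0).comp (f := fun p : List α × γ => ((fun i => i.elim0 : Fin 0 → α), p.2))
      (by fun_prop)
    have h2 : f = (fun p : (Fin 0 → α) × γ => f (List.ofFn p.1, p.2)) ∘
        fun p : List α × γ => ((fun i => i.elim0 : Fin 0 → α), p.2) := by
      ext1 ⟨L, c⟩
      cases L with
      | nil => simp
      | cons a _ => exact (hα.false a).elim
    rwa [h2]
  · intro s hs
    have key : f ⁻¹' s = ⋃ n : ℕ, {p : List α × γ | p.1.length = n} ∩
        (fun p : List α × γ => ((fun i : Fin n => p.1.getD i x), p.2)) ⁻¹'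
          ((fun p : (Fin n → α) × γ => f (List.ofFn p.1, p.2)) ⁻¹' s) := by
      ext ⟨L, c⟩
      have hL : List.ofFn (fun i : Fin L.length => L.getD i x) = L := by
        conv_rhs => rw [← List.ofFn_get L]
        congr 1
        ext i
        simp
      simp only [Set.mem_preimage, Set.mem_iUnion, Set.mem_inter_iff, Set.mem_ofPred_eq]
      constructor
      · intro hm
        exact ⟨L.length, rfl, by rw [hL]; exact hm⟩
      · rintro ⟨n, rfl, hm⟩
        rwa [hL] at hm
    rw [key]
    refine MeasurableSet.iUnion fun n => MeasurableSet.inter ?_ ?_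
    · exact (measurable_list_length.comp measurable_fst) (measurableSet_singleton n)
    · refine MeasurableSet.preimage ((h n) hs) ?_
      refine Measurable.prodMk ?_ measurable_snd
      exact measurable_pi_lambda _ fun i => (measurable_list_getD _ x).comp measurable_fst

theorem measurable_list_cons : Measurable fun p : List α × α => p.2 :: p.1 := by
  refine measurable_list_prod fun n => ?_
  have : (fun p : (Fin n → α) × α => p.2 :: List.ofFn p.1) =
      fun p => List.ofFn (Fin.cons p.2 p.1 : Fin (n + 1) → α) := by
    ext1 p; simp [List.ofFn_succ]
  simp only [this]
  refine (measurable_ofFn _).comp (measurable_pi_lambda _ fun i => ?_)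
  refine Fin.cases ?_ (fun i => ?_) i
  · simpa using measurable_snd
  · simp only [Fin.cons_succ]
    fun_prop

theorem _root_.Measurable.listCons {f : γ → α} {g : γ → List α} (hf : Measurable f) (hg : Measurable g) :
    Measurable fun x => f x :: g x :=
  measurable_list_cons.comp (hg.prodMk hf)

/-- Measurability of functions defined by recursion on a list with a measurable step. -/
theorem measurable_list_rec {f : List α × γ → β}
    (h0 : Measurable fun c => f ([], c))
    (h1 : ∀ n, Measurable (fun p : (Fin n → α) × γ => f (List.ofFn p.1, p.2)) →
      Measurable (fun p : (Fin (n + 1) → α) × γ =>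
        f (p.1 0 :: List.ofFn (fun i : Fin n => p.1 i.succ), p.2))) : Measurable f := by
  refine measurable_list_prod fun n => ?_
  induction n with
  | zero => simpa [Function.comp_def] using h0.comp measurable_snd
  | succ n ih => simpa [List.ofFn_succ] using h1 n ih

theorem measurable_list_append : Measurable fun p : List α × List α => p.1 ++ p.2 := by
  refine measurable_list_rec (by simpa using measurable_id') fun n ih => ?_
  simp only [List.cons_append]
  refine Measurable.listCons (by fun_prop) ?_
  exact ih.comp (f := fun p : (Fin (n + 1) → α) × List α => ((fun i : Fin n => p.1 i.succ), p.2))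
    (by fun_prop)

theorem _root_.Measurable.listAppend {f g : γ → List α} (hf : Measurable f) (hg : Measurable g) :
    Measurable fun x => f x ++ g x :=
  measurable_list_append.comp (hf.prodMk hg)

theorem _root_.Measurable.listFlatMap_const {ι : Type*} (L : List ι) {f : γ → ι → List α}
    (hf : ∀ i ∈ L, Measurable fun x => f x i) : Measurable fun x => L.flatMap (f x) := by
  induction L with
  | nil => simp
  | cons a L ih =>
    simp only [List.flatMap_cons]
    exact (hf a (by simp)).listAppend (ih fun i hi => hf i (by simp [hi]))

theorem _root_.Measurable.listMap_const {ι : Type*} (L : List ι) {f : γ → ι → α}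
    (hf : ∀ i ∈ L, Measurable fun x => f x i) : Measurable fun x => L.map (f x) := by
  induction L with
  | nil => simp
  | cons a L ih =>
    simp only [List.map_cons]
    exact Measurable.listCons (hf a (by simp)) (ih fun i hi => hf i (by simp [hi]))

theorem _root_.Measurable.listMap {L : γ → List α} {f : γ → α → β} (hL : Measurable L)
    (hf : Measurable fun p : γ × α => f p.1 p.2) : Measurable fun x => (L x).map (f x) := by
  have : Measurable fun p : List α × γ => p.1.map (f p.2) := by
    refine measurable_list_rec (by simp) fun n ih => ?_
    simp only [List.map_cons]
    refine Measurable.listCons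
      (hf.comp (f := fun p : (Fin (n + 1) → α) × γ => (p.2, p.1 0)) (by fun_prop)) ?_
    exact ih.comp (f := fun p : (Fin (n + 1) → α) × γ => ((fun i : Fin n => p.1 i.succ), p.2))
      (by fun_prop)
  exact this.comp (hL.prodMk measurable_id)

theorem _root_.Measurable.listSum {L : γ → List ℕ} (hL : Measurable L) : Measurable fun x => (L x).sum := by
  refine Measurable.comp (g := fun L : List ℕ => L.sum) (measurable_of_ofFn fun n => ?_) hL
  simp only [List.sum_ofFn]
  fun_prop

/-- A random index in `ℕ` splits the space into countably many measurable pieces. This reduces lists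
of random length to lists of constant length. -/
theorem _root_.Measurable.of_nat {f : ℕ → γ → β} {n : γ → ℕ} (hn : Measurable n)
    (hf : ∀ m, Measurable (f m)) : Measurable fun x => f (n x) x :=
  (measurable_from_prod_countable_right (f := fun p : ℕ × γ => f p.1 p.2) hf).comp
    (hn.prodMk measurable_id)

theorem _root_.Measurable.listRangeMap {n : γ → ℕ} {f : γ → ℕ → α} (hn : Measurable n)
    (hf : ∀ r, Measurable fun x => f x r) : Measurable fun x => (List.range (n x)).map (f x) :=
  hn.of_nat (f := fun m x => (List.range m).map (f x)) fun m =>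
    Measurable.listMap_const (List.range m) fun r _ => hf r

theorem _root_.Measurable.listRangeFlatMap {n : γ → ℕ} {f : γ → ℕ → List α} (hn : Measurable n)
    (hf : ∀ r, Measurable fun x => f x r) :
    Measurable fun x => (List.range (n x)).flatMap (f x) :=
  hn.of_nat (f := fun m x => (List.range m).flatMap (f x)) fun m =>
    Measurable.listFlatMap_const (List.range m) fun r _ => hf r

theorem _root_.Measurable.countP_const {ι : Type*} (L : List ι) {P : γ → ι → Bool}
    (hP : ∀ i ∈ L, Measurable fun x => P x i) : Measurable fun x => L.countP (P x) := by
  induction L with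
  | nil => simp
  | cons a L ih =>
    simp only [List.countP_cons]
    refine (ih fun i hi => hP i (by simp [hi])).add ?_
    exact Measurable.ite ((hP a (by simp)) (measurableSet_singleton true)) measurable_const
      measurable_const

/-- The outcome of a walk through a weighted list, fed into a measurable function. -/
theorem measurable_pickFrom {f : γ × α → β} {g : γ → β} (hf : Measurable f) (hg : Measurable g) :
    Measurable fun p : List (α × ℕ) × (γ × ℝ) =>
      (pickFrom p.1 p.2.2).elim (g p.2.1) fun a => f (p.2.1, a) := by
  refine measurable_list_prod fun n => ?_
  induction n with
  | zero => simpa [pickFrom] using by fun_prop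
  | succ n ih =>
    cases n with
    | zero =>
      simp only [List.ofFn_succ, List.ofFn_zero, pickFrom, Option.elim]
      fun_prop
    | succ n =>
      have h2 := ih.comp (f := fun p : (Fin (n + 1 + 1) → α × ℕ) × (γ × ℝ) =>
        ((fun i : Fin (n + 1) => p.1 i.succ), (p.2.1, p.2.2 - ((p.1 0).2 : ℝ)))) (by fun_prop)
      have h3 : Measurable fun p : (Fin (n + 1 + 1) → α × ℕ) × (γ × ℝ) => f (p.2.1, (p.1 0).1) := by
        fun_prop
      have hs : MeasurableSet {p : (Fin (n + 1 + 1) → α × ℕ) × (γ × ℝ) | p.2.2 < ((p.1 0).2 : ℝ)} :=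
        measurableSet_lt (by fun_prop) (by fun_prop)
      have h4 := @Measurable.ite _ _ _ _ _ _ _ (Classical.decPred _) hs h3 h2
      convert h4 using 2 with p
      simp only [List.ofFn_succ, pickFrom, Function.comp]
      split_ifs <;> simp_all

/-- The outcome is passed on to `f`, or replaced by `g` when there is none, so that no σ-algebra on
`Option α` is needed. -/
theorem _root_.Measurable.weightedPick_elim {L : γ → List (α × ℕ)} {v : γ → ℝ} {f : γ × α → β} {g : γ → β}
    (hL : Measurable L) (hv : Measurable v) (hf : Measurable f) (hg : Measurable g) :
    Measurable fun x => (weightedPick (L x) (v x)).elim (g x) fun a => f (x, a) := by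
  have hW : Measurable fun x => ((L x).map Prod.snd).sum :=
    (hL.listMap (f := fun _ => Prod.snd) (by fun_prop)).listSum
  have := (measurable_pickFrom hf hg).comp
    (hL.prodMk (measurable_id.prodMk (hv.mul ((measurable_from_nat (f := fun n : ℕ => (n : ℝ))).comp hW))))
  exact this

theorem measurableSet_weightedPick {L : γ → List (α × ℕ)} {v : γ → ℝ} [MeasurableSingletonClass α]
    (hL : Measurable L) (hv : Measurable v) (a : α) :
    MeasurableSet {x | weightedPick (L x) (v x) = some a} := by
  have hs : MeasurableSet {p : γ × α | p.2 = a} :=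
    measurable_snd (measurableSet_singleton a)
  have := Measurable.weightedPick_elim hL hv (f := fun p : γ × α => (p.2 = a : Prop))
    (g := fun _ => False) (measurableSet_setOfPred.1 hs) measurable_const
  convert measurableSet_setOfPred.2 this using 2
  ext x
  cases weightedPick (L x) (v x) <;> simp

theorem _root_.Measurable.length_filter_range {n : ℕ} {P : γ → ℕ → Prop} [∀ x l, Decidable (P x l)]
    (hP : ∀ l, MeasurableSet {x | P x l}) :
    Measurable fun x => ((List.range n).filter fun l => P x l).length := by
  simp only [← List.countP_eq_length_filter]
  refine Measurable.countP_const _ fun l _ => measurable_to_bool ?_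
  convert hP l using 1
  ext x; simp

end ListMeasurability

/-! ### Conditioning by resampling coordinates -/

section Splicing

open Classical in
/-- Replace the coordinates in `J` of `x` by those of `y`. -/
def spliceFun {ι : Type*} {Ω : ι → Type*} (J : Set ι) (x y : ∀ i, Ω i) : ∀ i, Ω i :=
  fun i => if i ∈ J then y i else x i

/-- Boxes determine the product measure. The preimage of a box is a product of two boxes, and each
coordinate is constrained in exactly one of them. -/
theorem measurePreserving_spliceFun {ι : Type*} {Ω : ι → Type*} [∀ i, MeasurableSpace (Ω i)]
    (μ : ∀ i, Measure (Ω i)) [∀ i, IsProbabilityMeasure (μ i)] (J : Set ι) :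
    MeasurePreserving (fun p : (∀ i, Ω i) × (∀ i, Ω i) => spliceFun J p.1 p.2)
      ((Measure.infinitePi μ).prod (Measure.infinitePi μ)) (Measure.infinitePi μ) := by
  classical
  have hm : Measurable (fun p : (∀ i, Ω i) × (∀ i, Ω i) => spliceFun J p.1 p.2) := by
    refine measurable_pi_lambda _ fun i => ?_
    by_cases h : i ∈ J
    · simp only [spliceFun, h, if_true]; fun_prop
    · simp only [spliceFun, h, if_false]; fun_prop
  refine ⟨hm, Measure.eq_infinitePi _ fun s t ht => ?_⟩
  rw [Measure.map_apply hm (MeasurableSet.pi s.countable_toSet fun i _ => ht i)]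
  have hpre : (fun p : (∀ i, Ω i) × (∀ i, Ω i) => spliceFun J p.1 p.2) ⁻¹' (Set.pi s t) =
      (Set.pi s fun i => if i ∈ J then Set.univ else t i) ×ˢ
        (Set.pi s fun i => if i ∈ J then t i else Set.univ) := by
    ext ⟨x, y⟩
    simp only [Set.mem_preimage, Set.mem_pi, Set.mem_prod, spliceFun]
    constructor
    · intro h
      refine ⟨fun i hi => ?_, fun i hi => ?_⟩
      · have := h i hi
        split_ifs with hJ <;> simp_all
      · have := h i hi
        split_ifs with hJ <;> simp_all
    · rintro ⟨h1, h2⟩ i hi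
      have a := h1 i hi
      have b := h2 i hi
      split_ifs with hJ <;> simp_all
  rw [hpre, Measure.prod_prod, Measure.infinitePi_pi, Measure.infinitePi_pi, ← Finset.prod_mul_distrib]
  · refine Finset.prod_congr rfl fun i _ => ?_
    split_ifs <;> simp
  · intro i _; split_ifs <;> simp [ht i]
  · intro i _; split_ifs <;> simp [ht i]

variable {X : Type u} [MeasurableSpace X] {k : ℕ} (D : Fin k → Measure X)
  [∀ i, IsProbabilityMeasure (D i)]

instance : IsProbabilityMeasure (law D) := by unfold law; infer_instance

/-- Resample the draws in `J` and the coins in `K`. -/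
def splice (J : Set (Draw k)) (K : Set (Coin k)) (x y : Randomness X k) : Randomness X k :=
  (spliceFun (Ω := fun _ => X) J x.1 y.1, spliceFun (Ω := fun _ => unitInterval) K x.2 y.2)

theorem measurePreserving_prodComm_middle {A B : Type*} [MeasurableSpace A] [MeasurableSpace B]
    (μ : Measure A) (ν : Measure B) [SFinite μ] [SFinite ν] :
    MeasurePreserving (fun p : (A × B) × (A × B) => ((p.1.1, p.2.1), (p.1.2, p.2.2)))
      ((μ.prod ν).prod (μ.prod ν)) ((μ.prod μ).prod (ν.prod ν)) := by
  have h1 := measurePreserving_prodAssoc μ ν (μ.prod ν)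
  have h2 := (MeasurePreserving.id μ).prod ((measurePreserving_prodAssoc ν μ ν).symm)
  have h3 := (MeasurePreserving.id μ).prod
    ((Measure.measurePreserving_swap (μ := ν) (ν := μ)).prod (MeasurePreserving.id ν))
  have h4 := (MeasurePreserving.id μ).prod (measurePreserving_prodAssoc μ ν ν)
  have h5 := (measurePreserving_prodAssoc μ μ (ν.prod ν)).symm
  exact h5.comp (h4.comp (h3.comp (h2.comp h1)))

theorem measurePreserving_splice (J : Set (Draw k)) (K : Set (Coin k)) :
    MeasurePreserving (fun p : Randomness X k × Randomness X k => splice J K p.1 p.2)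
      ((law D).prod (law D)) (law D) :=
  ((measurePreserving_spliceFun (fun q : Draw k => D q.player) J).prod
    (measurePreserving_spliceFun (fun _ : Coin k => (volume : Measure unitInterval)) K)).comp
      (measurePreserving_prodComm_middle _ _)

/-- Conditioning on everything but the draws in `J` and the coins in `K`. -/
theorem law_le_of_splice (J : Set (Draw k)) (K : Set (Coin k)) {E : Set (Randomness X k)}
    (hE : MeasurableSet E) {c : ENNReal} (h : ∀ x, law D {y | splice J K x y ∈ E} ≤ c) :
    law D E ≤ c := by
  -- Fubini for the two copies: the outer variable `x` is the condition, and the inner integral is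
  -- at most `c` for each value of it.
  rw [← (measurePreserving_splice D J K).measure_preimage hE.nullMeasurableSet,
    Measure.prod_apply ((measurePreserving_splice D J K).measurable hE)]
  calc _ ≤ ∫⁻ _, c ∂(law D) := lintegral_mono fun x => h x
    _ = c := by simp

end Splicing

/-! ### Chernoff bounds -/

section Chernoff

variable {Z : Type*}

/-- Number of sample points in the set with indicator `g`. -/
def hits {m : ℕ} (g : Z → Bool) (z : Fin m → Z) : ℕ := (Finset.univ.filter fun l => g (z l)).card

theorem pow_hits {m : ℕ} (g : Z → Bool) (z : Fin m → Z) (a : ℝ) :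
    a ^ hits g z = ∏ l, (if g (z l) then a else 1) := by
  rw [hits, Finset.prod_ite]
  simp

theorem measurable_hits {m : ℕ} {γ : Type*} [MeasurableSpace γ] {g : γ → Z → Bool}
    {z : γ → Fin m → Z} (hg : ∀ l, Measurable fun x => g x (z x l)) :
    Measurable fun x => hits (g x) (z x) := by
  have : (fun x => hits (g x) (z x)) = fun x => ∑ l, (if g x (z x l) then 1 else 0) := by
    ext x; simp [hits]
  rw [this]
  refine Finset.measurable_sum _ fun l _ => ?_
  exact Measurable.ite ((hg l) (measurableSet_singleton true)) measurable_const measurable_const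

variable [MeasurableSpace Z]

theorem integral_ite_bool (ν : Measure Z) [IsProbabilityMeasure ν] {g : Z → Bool}
    (hg : Measurable g) (a : ℝ) :
    ∫ x, (if g x then a else 1) ∂ν = 1 + (a - 1) * ν.real {x | g x = true} := by
  have hs : MeasurableSet {x | g x = true} := hg (measurableSet_singleton true)
  have : (fun x => if g x then a else 1) =
      fun x => 1 + ({x | g x = true}.indicator (fun _ => a - 1) x) := by
    ext x
    by_cases h : g x = true <;> simp [h]
  rw [this, integral_add (integrable_const _) ((integrable_const _).indicator hs),
    integral_indicator hs]
  simp [mul_comm]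

/-- Chernoff's bound for the number of hits of an independent sample, for both tails. -/
theorem chernoff (ν : Measure Z) [IsProbabilityMeasure ν] {g : Z → Bool}
    (hg : Measurable g) (m : ℕ) (θ c : ℝ) :
    (Measure.pi fun _ : Fin m => ν) {z | θ * c ≤ θ * hits g z} ≤
      ENNReal.ofReal (Real.exp ((Real.exp θ - 1) * (ν.real {x | g x = true} * m) - θ * c)) := by
  set p := ν.real {x | g x = true} with hp
  set P := (Measure.pi fun _ : Fin m => ν)
  have hmeas : Measurable fun z : Fin m → Z => hits g z :=
    measurable_hits (g := fun _ => g) fun l => hg.comp (measurable_pi_apply l)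
  -- For positive `θ` the event is the upper tail, for negative `θ` the lower one. The exponential
  -- moment factorizes over the sample in both cases, and Markov's inequality applies.
  have hexp : ∀ z : Fin m → Z, Real.exp (θ * hits g z) = ∏ l, (if g (z l) then Real.exp θ else 1) := by
    intro z
    rw [← pow_hits, mul_comm, Real.exp_nat_mul]
  have hint : ∫ z, Real.exp (θ * hits g z) ∂P = (1 + (Real.exp θ - 1) * p) ^ m := by
    simp_rw [hexp]
    rw [integral_fintype_prod_eq_pow (f := fun x => if g x then Real.exp θ else 1),
      integral_ite_bool ν hg, Fintype.card_fin]
  have hbd : ∀ z : Fin m → Z, Real.exp (θ * hits g z) ≤ Real.exp (|θ| * m) := by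
    intro z
    have h1 : (hits g z : ℝ) ≤ m := by
      have := Finset.card_le_univ (Finset.univ.filter fun l => (g (z l) : Prop))
      rw [Fintype.card_fin] at this
      exact_mod_cast this
    have h2 : θ * hits g z ≤ |θ| * hits g z :=
      mul_le_mul_of_nonneg_right (le_abs_self _) (Nat.cast_nonneg _)
    exact Real.exp_le_exp.2 (h2.trans (mul_le_mul_of_nonneg_left h1 (abs_nonneg _)))
  have hint2 : Integrable (fun z => Real.exp (θ * hits g z)) P := by
    refine Integrable.of_bound ?_ (Real.exp (|θ| * m)) (Filter.Eventually.of_forall fun z => ?_)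
    · exact (Real.measurable_exp.comp
        ((measurable_from_nat (f := fun n : ℕ => θ * n)).comp hmeas)).aestronglyMeasurable
    · rw [Real.norm_eq_abs, abs_of_pos (Real.exp_pos _)]
      exact hbd z
  have hmk := mul_meas_ge_le_integral_of_nonneg (μ := P)
    (Filter.Eventually.of_forall fun z => (Real.exp_pos (θ * hits g z)).le) hint2 (Real.exp (θ * c))
  rw [hint] at hmk
  have hset : {z | Real.exp (θ * c) ≤ Real.exp (θ * hits g z)} =
      {z : Fin m → Z | θ * c ≤ θ * hits g z} := by
    ext z; simp
  rw [hset] at hmk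
  have hp0 : 0 ≤ p := measureReal_nonneg
  have hp1 : p ≤ 1 := measureReal_le_one
  have hpos : 0 ≤ 1 + (Real.exp θ - 1) * p := by
    nlinarith [Real.exp_pos θ]
  have hle : (1 + (Real.exp θ - 1) * p) ^ m ≤ Real.exp ((Real.exp θ - 1) * (p * m)) := by
    have := Real.add_one_le_exp ((Real.exp θ - 1) * p)
    calc _ ≤ Real.exp ((Real.exp θ - 1) * p) ^ m := pow_le_pow_left₀ hpos (by linarith) m
      _ = _ := by rw [← Real.exp_nat_mul]; ring_nf
  rw [← ENNReal.ofReal_toReal (measure_ne_top P _)]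
  refine ENNReal.ofReal_le_ofReal ?_
  change P.real _ ≤ _
  rw [Real.exp_sub, le_div_iff₀ (Real.exp_pos _), mul_comm]
  exact hmk.trans hle

end Chernoff

/-! ### Symmetrization: a relative deviation bound -/

section RelativeDeviation

/-- `(3/2)^7` exceeds `2^4`, and `4 log 2 / 7 > 0.39`. -/
theorem log_three_halves_ge : 0.39 ≤ Real.log (3 / 2) := by
  have h1 : Real.log ((2 : ℝ) ^ 4) ≤ Real.log ((3 / 2 : ℝ) ^ 7) :=
    Real.log_le_log (by norm_num) (by norm_num)
  rw [Real.log_pow, Real.log_pow] at h1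
  have := Real.log_two_gt_d9
  norm_num at h1 ⊢
  linarith

/-- If at each position one of the two members of a pair is put, at random, into the first half,
it is unlikely that few of the marked points end up in the first half and many in the second. -/
theorem card_swaps_le {m : ℕ} (q : Fin m → Bool × Bool) {p₀ : ℝ} (hp₀ : 0 ≤ p₀) :
    ((Finset.univ.filter fun σ : Fin m → Bool =>
      ((Finset.univ.filter fun l => if σ l then (q l).2 else (q l).1).card : ℝ) ≤ p₀ * m / 8 ∧
      p₀ * m / 2 ≤ ((Finset.univ.filter fun l => if σ l then (q l).1 else (q l).2).card : ℝ)).card : ℝ)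
      ≤ 2 ^ m * Real.exp (-(p₀ * m / 10)) := by
  -- Exponential moment with weight `3/2` for each marked point in the second half and `1/2` for
  -- each in the first. A pair with one marked point contributes `3/2 + 1/2 = 2` over its two
  -- positions, a pair with two contributes `2 · 3/4`, one with none `2`; so the sum over all `σ` is
  -- at most `2^m`. On the event the weight is at least `exp ((0.39/2 - 0.7/8) p₀ m)`.
  set x : ℝ := 3 / 2
  set y : ℝ := 1 / 2
  let φ : Fin m → Bool → ℝ := fun l b =>
    (if (if b then (q l).1 else (q l).2) then x else 1) *
      (if (if b then (q l).2 else (q l).1) then y else 1)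
  have hφ0 : ∀ l b, 0 ≤ φ l b := by
    intro l b
    refine mul_nonneg ?_ ?_ <;> split_ifs <;> norm_num [x, y]
  have hsum : ∑ σ : Fin m → Bool, ∏ l, φ l (σ l) ≤ 2 ^ m := by
    have h1 := Finset.prod_univ_sum (fun _ : Fin m => (Finset.univ : Finset Bool)) φ
    rw [Fintype.piFinset_univ] at h1
    rw [← h1]
    calc ∏ l, ∑ b, φ l b ≤ ∏ _l : Fin m, (2 : ℝ) := by
          refine Finset.prod_le_prod (fun l _ => Finset.sum_nonneg fun b _ => hφ0 l b) fun l _ => ?_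
          simp only [φ, Fintype.sum_bool]
          rcases q l with ⟨a, b⟩
          cases a <;> cases b <;> norm_num [x, y]
      _ = 2 ^ m := by simp
  have hprod : ∀ σ : Fin m → Bool, ∏ l, φ l (σ l) =
      x ^ (Finset.univ.filter fun l => if σ l then (q l).1 else (q l).2).card *
      y ^ (Finset.univ.filter fun l => if σ l then (q l).2 else (q l).1).card := by
    intro σ
    simp only [φ]
    rw [Finset.prod_mul_distrib, Finset.prod_ite, Finset.prod_ite]
    simp
  have hE : ∀ σ ∈ (Finset.univ.filter fun σ : Fin m → Bool =>
      ((Finset.univ.filter fun l => if σ l then (q l).2 else (q l).1).card : ℝ) ≤ p₀ * m / 8 ∧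
      p₀ * m / 2 ≤ ((Finset.univ.filter fun l => if σ l then (q l).1 else (q l).2).card : ℝ)),
      Real.exp (p₀ * m / 10) ≤ ∏ l, φ l (σ l) := by
    intro σ hσ
    rw [Finset.mem_filter] at hσ
    obtain ⟨-, h1, h2⟩ := hσ
    rw [hprod]
    set a := (Finset.univ.filter fun l => if σ l then (q l).1 else (q l).2).card
    set b := (Finset.univ.filter fun l => if σ l then (q l).2 else (q l).1).card
    have hx : x ^ a = Real.exp (a * Real.log x) := by
      rw [Real.exp_nat_mul, Real.exp_log (by norm_num [x])]
    have hy : y ^ b = Real.exp (-(b * Real.log 2)) := by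
      rw [← mul_neg, Real.exp_nat_mul, Real.exp_neg, Real.exp_log (by norm_num)]
      norm_num [y]
    rw [hx, hy, ← Real.exp_add]
    refine Real.exp_le_exp.2 ?_
    have l1 := log_three_halves_ge
    have l2 := Real.log_two_lt_d9
    have l2' := Real.log_two_gt_d9
    have hm : 0 ≤ p₀ * m := by positivity
    have e1 : p₀ * m / 2 * 0.39 ≤ a * Real.log x :=
      mul_le_mul h2 l1 (by norm_num) (by positivity)
    have e2 : b * Real.log 2 ≤ p₀ * m / 8 * 0.7 :=
      mul_le_mul h1 (by linarith) (by linarith) (by positivity)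
    linarith
  have hcard := Finset.card_nsmul_le_sum _ _ _ hE
  have hle := hcard.trans ((Finset.sum_le_sum_of_subset_of_nonneg (Finset.subset_univ _)
    fun σ _ _ => Finset.prod_nonneg fun l _ => hφ0 l (σ l)).trans hsum)
  rw [nsmul_eq_mul] at hle
  rw [Real.exp_neg, ← div_eq_mul_inv, le_div_iff₀ (Real.exp_pos _)]
  exact hle

variable {Z : Type*} [MeasurableSpace Z]

/-- A rule that turns samples into classifiers with few patterns on any sample of twice the size
rarely selects one that has few hits on the sample but large probability. -/
theorem relative_deviation (ν : Measure Z) [IsProbabilityMeasure ν] {m : ℕ}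
    {G : (Fin m → Z) → Z → Bool} (hG : Measurable fun p : (Fin m → Z) × Z => G p.1 p.2) {Γ : ℝ}
    (hΓ : ∀ w : Fin m → Z × Z, ∃ P : Finset (Fin m → Bool × Bool),
      (∀ z, (fun l => (G z (w l).1, G z (w l).2)) ∈ P) ∧ (P.card : ℝ) ≤ Γ)
    {p₀ : ℝ} (hp₀ : 0 < p₀) :
    (Measure.pi fun _ : Fin m => ν)
      {z | p₀ ≤ ν.real {x | G z x = true} ∧ (hits (G z) z : ℝ) ≤ p₀ * m / 8} ≤
        ENNReal.ofReal (2 * Γ * Real.exp (-(p₀ * m / 10))) := by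
  classical
  set μ := Measure.pi fun _ : Fin m => ν
  have hGz : ∀ z, Measurable (G z) := fun z => hG.comp measurable_prodMk_left
  -- For `p₀ m < 5` the claimed bound exceeds `1`, because `Γ ≥ 1` and `2 (1 - 1/2) = 1`.
  by_cases hsmall : p₀ * m < 5
  · refine prob_le_one.trans ?_
    rw [← ENNReal.ofReal_one]
    refine ENNReal.ofReal_le_ofReal ?_
    have hne : Nonempty Z := nonempty_of_isProbabilityMeasure ν
    obtain ⟨x⟩ := hne
    obtain ⟨P, hP, hPΓ⟩ := hΓ fun _ => (x, x)
    have h1 : 1 ≤ P.card := Finset.card_pos.2 ⟨_, hP fun _ => x⟩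
    have h2 : (1 : ℝ) ≤ Γ := le_trans (by exact_mod_cast h1) hPΓ
    have h3 : (1 : ℝ) - p₀ * m / 10 ≤ Real.exp (-(p₀ * m / 10)) := by
      linarith [Real.add_one_le_exp (-(p₀ * m / 10))]
    nlinarith
  push Not at hsmall
  have hmh1 : Measurable fun q : (Fin m → Z) × (Fin m → Z) => hits (G q.1) q.1 :=
    measurable_hits fun l => hG.comp
      (f := fun q : (Fin m → Z) × (Fin m → Z) => (q.1, q.1 l)) (by fun_prop)
  have hmh2 : Measurable fun q : (Fin m → Z) × (Fin m → Z) => hits (G q.1) q.2 :=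
    measurable_hits fun l => hG.comp
      (f := fun q : (Fin m → Z) × (Fin m → Z) => (q.1, q.2 l)) (by fun_prop)
  have hcast : Measurable fun n : ℕ => (n : ℝ) := measurable_from_nat
  set B : Set ((Fin m → Z) × (Fin m → Z)) :=
    {q | (hits (G q.1) q.1 : ℝ) ≤ p₀ * m / 8 ∧ p₀ * m / 2 ≤ (hits (G q.1) q.2 : ℝ)} with hBdef
  have hB : MeasurableSet B :=
    (measurableSet_le (hcast.comp hmh1) measurable_const).inter
      (measurableSet_le measurable_const (hcast.comp hmh2))
  -- the ghost sample
  have hghost : μ {z | p₀ ≤ ν.real {x | G z x = true} ∧ (hits (G z) z : ℝ) ≤ p₀ * m / 8} ≤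
      2 * (μ.prod μ) B := by
    set bad := {z | p₀ ≤ ν.real {x | G z x = true} ∧ (hits (G z) z : ℝ) ≤ p₀ * m / 8} with hbad
    have hbadm : MeasurableSet bad := by
      refine MeasurableSet.inter ?_ ?_
      · have hs : MeasurableSet {p : (Fin m → Z) × Z | G p.1 p.2 = true} :=
          hG (measurableSet_singleton true)
        have := measurable_measure_prodMk_left (ν := ν) hs
        exact measurableSet_le measurable_const this.ennreal_toReal
      · exact measurableSet_le (hcast.comp (hmh1.comp (measurable_id.prodMk measurable_id)))
          measurable_const
    have hhalf : ∀ z ∈ bad, (1 : ENNReal) / 2 ≤ μ (Prod.mk z ⁻¹' B) := by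
      intro z hz
      -- Lower tail with `exp θ = 1/2`: the exponent is at most `-(1/2 - log 2 / 2) p₀ m`, which is
      -- below `-log 2` once `p₀ m ≥ 5`. So with probability at least `1/2` the ghost sample has `p₀
      -- m / 2` hits.
      have hch := chernoff ν (hGz z) m (-Real.log 2) (p₀ * m / 2)
      set p := ν.real {x | G z x = true}
      have hpp : p₀ ≤ p := hz.1
      have hexp : Real.exp ((Real.exp (-Real.log 2) - 1) * (p * m) - -Real.log 2 * (p₀ * m / 2)) ≤
          1 / 2 := by
        rw [Real.exp_neg, Real.exp_log (by norm_num)]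
        have h2 : (1 : ℝ) / 2 = Real.exp (-Real.log 2) := by
          rw [Real.exp_neg, Real.exp_log (by norm_num)]; norm_num
        rw [h2]
        refine Real.exp_le_exp.2 ?_
        have l2 := Real.log_two_lt_d9
        have hpm : p₀ * m ≤ p * m := mul_le_mul_of_nonneg_right hpp (Nat.cast_nonneg _)
        have : (Real.log 2) * (p₀ * m) ≤ 0.6931471808 * (p₀ * m) :=
          mul_le_mul_of_nonneg_right l2.le (by positivity)
        linarith
      have hsub : (Prod.mk z ⁻¹' B)ᶜ ⊆
          {z' : Fin m → Z | -Real.log 2 * (p₀ * m / 2) ≤ -Real.log 2 * hits (G z) z'} := by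
        intro z' hz'
        simp only [Set.mem_compl_iff, Set.mem_preimage, hBdef, Set.mem_ofPred_eq, not_and,
          not_le] at hz' ⊢
        have := hz' hz.2
        have l2' := Real.log_two_gt_d9
        nlinarith
      have hc : μ (Prod.mk z ⁻¹' B)ᶜ ≤ 1 / 2 := by
        refine (measure_mono hsub).trans (hch.trans ?_)
        refine (ENNReal.ofReal_le_ofReal hexp).trans ?_
        rw [ENNReal.ofReal_div_of_pos (by norm_num)]; simp
      have hmeas : MeasurableSet (Prod.mk z ⁻¹' B) := measurable_prodMk_left hB
      rw [prob_compl_eq_one_sub hmeas] at hc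
      have h1 : (1 : ENNReal) ≤ 1 / 2 + μ (Prod.mk z ⁻¹' B) := tsub_le_iff_right.1 hc
      have h3 : (1 : ENNReal) / 2 + 1 / 2 ≤ 1 / 2 + μ (Prod.mk z ⁻¹' B) := by
        rwa [ENNReal.add_halves]
      exact (ENNReal.add_le_add_iff_left (by simp)).1 h3
    rw [Measure.prod_apply hB]
    have h4 : ∫⁻ _ in bad, (1 : ENNReal) / 2 ∂μ ≤ ∫⁻ z, μ (Prod.mk z ⁻¹' B) ∂μ :=
      (setLIntegral_mono' hbadm hhalf).trans (setLIntegral_le_lintegral _ _)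
    rw [setLIntegral_const] at h4
    calc μ bad = 2 * (1 / 2 * μ bad) := by
          rw [← mul_assoc, one_div, ENNReal.mul_inv_cancel (by simp) (by simp), one_mul]
      _ ≤ _ := by gcongr
  -- random swaps
  set ρ := Measure.pi fun _ : Fin m => ν.prod ν
  have he := measurePreserving_arrowProdEquivProdArrow Z Z (Fin m) (fun _ => ν) (fun _ => ν)
  set e := MeasurableEquiv.arrowProdEquivProdArrow Z Z (Fin m)
  let sw : (Fin m → Bool) → (Fin m → Z × Z) → Fin m → Z × Z :=
    fun σ w l => (if σ l then Prod.swap else id) (w l)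
  have hsw : ∀ σ, MeasurePreserving (sw σ) ρ ρ := by
    intro σ
    refine measurePreserving_pi (fun _ : Fin m => ν.prod ν) (fun _ : Fin m => ν.prod ν)
      (f := fun l => if σ l then Prod.swap else id) fun l => ?_
    by_cases h : σ l = true
    · simp only [h, if_true]
      exact Measure.measurePreserving_swap
    · simp only [h]
      exact MeasurePreserving.id _
  -- Swapping does not change the law, so `2^m` times the probability of `B` is the expected number
  -- of swaps that lead into `B`.
  have hQB : ∀ σ, (μ.prod μ) B = ρ (sw σ ⁻¹' (e ⁻¹' B)) := by
    intro σ
    rw [(hsw σ).measure_preimage (he.measurable hB).nullMeasurableSet,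
      he.measure_preimage hB.nullMeasurableSet]
  have hpoint : ∀ w, ∑ σ, (sw σ ⁻¹' (e ⁻¹' B)).indicator (fun _ => (1 : ENNReal)) w ≤
      ENNReal.ofReal (Γ * (2 ^ m * Real.exp (-(p₀ * m / 10)))) := by
    intro w
    obtain ⟨P, hP, hPΓ⟩ := hΓ w
    simp only [Set.indicator_apply, Finset.sum_boole]
    rw [← ENNReal.ofReal_natCast]
    refine ENNReal.ofReal_le_ofReal ?_
    let S : (Fin m → Bool × Bool) → Finset (Fin m → Bool) := fun q =>
      Finset.univ.filter fun σ : Fin m → Bool =>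
      ((Finset.univ.filter fun l => if σ l then (q l).2 else (q l).1).card : ℝ) ≤ p₀ * m / 8 ∧
      p₀ * m / 2 ≤ ((Finset.univ.filter fun l => if σ l then (q l).1 else (q l).2).card : ℝ)
    -- The selected classifier varies with `σ`, because it is computed from the swapped first half.
    -- Its pattern on the unswapped pairs always belongs to `P`, though, so a union bound over `P`
    -- covers all cases.
    have hsub : (Finset.univ.filter fun σ => w ∈ sw σ ⁻¹' (e ⁻¹' B)) ⊆ P.biUnion S := by
      intro σ hσ
      rw [Finset.mem_filter] at hσ
      have hσB := hσ.2
      set z : Fin m → Z := fun l => (sw σ w l).1 with hz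
      have h1 : (hits (G z) z : ℝ) ≤ p₀ * m / 8 := hσB.1
      have h2 : p₀ * m / 2 ≤ (hits (G z) fun l => (sw σ w l).2 : ℝ) := hσB.2
      rw [Finset.mem_biUnion]
      refine ⟨_, hP z, ?_⟩
      simp only [S, Finset.mem_filter, Finset.mem_univ, true_and]
      have e1 : ∀ l, G z (z l) = if σ l then G z (w l).2 else G z (w l).1 := by
        intro l
        by_cases h : σ l = true <;> simp [hz, sw, h]
      have e2 : ∀ l, G z (sw σ w l).2 = if σ l then G z (w l).1 else G z (w l).2 := by
        intro l
        by_cases h : σ l = true <;> simp [sw, h]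
      simp only [hits, e1, e2] at h1 h2
      exact ⟨h1, h2⟩
    have hc : ((Finset.univ.filter fun σ => w ∈ sw σ ⁻¹' (e ⁻¹' B)).card : ℝ) ≤
        ∑ q ∈ P, ((S q).card : ℝ) := by
      exact_mod_cast (Finset.card_le_card hsub).trans Finset.card_biUnion_le
    refine hc.trans ((Finset.sum_le_sum fun q _ => card_swaps_le q hp₀.le).trans ?_)
    rw [Finset.sum_const, nsmul_eq_mul]
    gcongr
  have hswap : (2 : ENNReal) ^ m * (μ.prod μ) B ≤
      ENNReal.ofReal (Γ * (2 ^ m * Real.exp (-(p₀ * m / 10)))) := by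
    have h1 : (2 : ENNReal) ^ m * (μ.prod μ) B = ∑ σ : Fin m → Bool, ρ (sw σ ⁻¹' (e ⁻¹' B)) := by
      rw [← Finset.sum_congr rfl fun σ _ => hQB σ]
      simp
    have hmeas : ∀ σ, MeasurableSet (sw σ ⁻¹' (e ⁻¹' B)) := fun σ =>
      (hsw σ).measurable (he.measurable hB)
    rw [h1]
    calc ∑ σ, ρ (sw σ ⁻¹' (e ⁻¹' B))
        = ∑ σ, ∫⁻ w, (sw σ ⁻¹' (e ⁻¹' B)).indicator (fun _ => (1 : ENNReal)) w ∂ρ :=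
          Finset.sum_congr rfl fun σ _ => by rw [lintegral_indicator (hmeas σ)]; simp
      _ = ∫⁻ w, ∑ σ, (sw σ ⁻¹' (e ⁻¹' B)).indicator (fun _ => (1 : ENNReal)) w ∂ρ := by
          rw [lintegral_finsetSum]
          exact fun σ _ => measurable_const.indicator (hmeas σ)
      _ ≤ ∫⁻ _, ENNReal.ofReal (Γ * (2 ^ m * Real.exp (-(p₀ * m / 10)))) ∂ρ :=
          lintegral_mono hpoint
      _ = _ := by simp
  have hfin : (μ.prod μ) B ≤ ENNReal.ofReal (Γ * Real.exp (-(p₀ * m / 10))) := by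
    have h5 : ENNReal.ofReal (Γ * (2 ^ m * Real.exp (-(p₀ * m / 10)))) =
        2 ^ m * ENNReal.ofReal (Γ * Real.exp (-(p₀ * m / 10))) := by
      rw [mul_left_comm, ENNReal.ofReal_mul (by positivity), ENNReal.ofReal_pow (by norm_num)]
      simp
    rw [h5] at hswap
    exact (ENNReal.mul_le_mul_iff_right (by simp) (by simp)).1 hswap
  refine hghost.trans ((mul_le_mul_right hfin 2).trans ?_)
  rw [mul_assoc 2 Γ, ENNReal.ofReal_mul (p := 2) (by norm_num)]
  simp

end RelativeDeviation

/-! ### Counting patterns by Sauer-Shelah -/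

section Sauer

/-- For `i ≤ d` one has `r^d ≤ r^i`, so `r^d` times the sum is at most `(1 + r)^N`. The free
parameter `r` lets the factor `exp (r N)` be absorbed later by half of the exponent in
`relative_deviation`. -/
theorem sum_choose_le {d N : ℕ} {r : ℝ} (hr : 0 < r) (hr1 : r ≤ 1) :
    (∑ i ∈ Finset.Iic d, (N.choose i : ℝ)) ≤ (1 / r) ^ d * Real.exp (r * N) := by
  have h1 : (1 + r) ^ N ≤ Real.exp (r * N) := by
    rw [mul_comm, Real.exp_nat_mul]
    exact pow_le_pow_left₀ (by linarith) (by linarith [Real.add_one_le_exp r]) N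
  have h2 : r ^ d * (∑ i ∈ Finset.Iic d, (N.choose i : ℝ)) ≤ (1 + r) ^ N := by
    have h3 : (1 + r) ^ N = ∑ i ∈ Finset.range (N + 1), r ^ i * (N.choose i : ℝ) := by
      rw [add_comm, add_pow]; simp
    rw [h3, Finset.mul_sum]
    calc ∑ i ∈ Finset.Iic d, r ^ d * (N.choose i : ℝ)
        ≤ ∑ i ∈ Finset.Iic d, r ^ i * (N.choose i : ℝ) := by
          refine Finset.sum_le_sum fun i hi => ?_
          exact mul_le_mul_of_nonneg_right
            (pow_le_pow_of_le_one hr.le hr1 (Finset.mem_Iic.1 hi)) (Nat.cast_nonneg _)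
      _ ≤ ∑ i ∈ Finset.range (N + 1), r ^ i * (N.choose i : ℝ) := by
          -- `d` may exceed `N`; the binomial coefficients beyond `N` vanish.
          rw [Finset.sum_subset (s₁ := Finset.range (N + 1)) (s₂ := Finset.Iic d ∪ Finset.range (N + 1))
            Finset.subset_union_right fun i _ hi => ?_]
          · exact Finset.sum_le_sum_of_subset_of_nonneg Finset.subset_union_left
              fun i _ _ => by positivity
          · rw [Finset.mem_range] at hi
            rw [Nat.choose_eq_zero_of_lt (by omega)]
            simp
  rw [one_div, inv_pow, ← div_eq_inv_mul, le_div_iff₀ (by positivity), mul_comm]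
  exact h2.trans h1

variable {X : Type u}

/-- The Sauer-Shelah lemma: a class of VC-dimension `d` has few patterns on finitely many points. -/
theorem exists_patterns {H : Set (X → Bool)} {d : ℕ} (hH : HasVCDim H d) {τ : Type*} [Fintype τ]
    (w : τ → X) {r : ℝ} (hr : 0 < r) (hr1 : r ≤ 1) :
    ∃ P : Finset (τ → Bool), (∀ h ∈ H, (fun s => h (w s)) ∈ P) ∧
      (P.card : ℝ) ≤ (1 / r) ^ d * Real.exp (r * Fintype.card τ) := by
  classical
  let P : Finset (τ → Bool) := Finset.univ.filter fun q => ∃ h ∈ H, (fun s => h (w s)) = q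
  refine ⟨P, fun h hh => by simp only [P, Finset.mem_filter, Finset.mem_univ, true_and]; exact ⟨h, hh, rfl⟩, ?_⟩
  let Φ : (τ → Bool) → Finset τ := fun q => Finset.univ.filter fun s => q s = true
  have hΦ : Function.Injective Φ := by
    intro q q' h
    ext s
    have := congrArg (s ∈ ·) h
    simp only [Φ, Finset.mem_filter, Finset.mem_univ, true_and, eq_iff_iff] at this
    exact Bool.eq_iff_iff.2 this
  set F := P.image Φ with hF
  have hcard : P.card = F.card := (Finset.card_image_of_injective P hΦ).symm
  have hmem : ∀ u ∈ F, ∃ h ∈ H, ∀ s, s ∈ u ↔ h (w s) = true := by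
    intro u hu
    simp only [hF, P, Finset.mem_image, Finset.mem_filter, Finset.mem_univ, true_and] at hu
    obtain ⟨q, ⟨h, hh, rfl⟩, rfl⟩ := hu
    exact ⟨h, hh, fun s => by simp [Φ]⟩
  have hvc : F.vcDim ≤ d := by
    refine Finset.sup_le fun B hB => ?_
    rw [Finset.mem_shatterer] at hB
    -- Every pattern factors through `w`, so two indices with the same point are never separated and
    -- cannot both lie in a shattered set. Hence the points of a shattered index set are distinct
    -- and shattered by `H`.
    have hinj : Set.InjOn w B := by
      intro b hb b' hb' hbb
      by_contra hne
      obtain ⟨u, hu, huB⟩ := hB (Finset.singleton_subset_iff.2 hb)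
      obtain ⟨h, -, hs⟩ := hmem u hu
      have h1 : b ∈ u := by
        have : b ∈ B ∩ u := by rw [huB]; simp
        exact (Finset.mem_inter.1 this).2
      have h2 : b' ∉ u := by
        intro hin
        have : b' ∈ B ∩ u := Finset.mem_inter.2 ⟨hb', hin⟩
        rw [huB, Finset.mem_singleton] at this
        exact hne this.symm
      rw [hs] at h1 h2
      rw [← hbb] at h2
      exact h2 h1
    refine hH.2 ⟨B.image w, Finset.card_image_of_injOn hinj, fun f => ?_⟩
    obtain ⟨u, hu, huB⟩ := hB (Finset.filter_subset (fun s => f (w s) = true) B)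
    obtain ⟨h, hh, hs⟩ := hmem u hu
    refine ⟨h, hh, fun x hx => ?_⟩
    obtain ⟨s, hsB, rfl⟩ := Finset.mem_image.1 hx
    have h1 : s ∈ u ↔ f (w s) = true := by
      have := congrArg (s ∈ ·) huB
      simp only [Finset.mem_inter, Finset.mem_filter, eq_iff_iff] at this
      tauto
    exact Bool.eq_iff_iff.2 ((hs s).symm.trans h1)
  have h1 : F.card ≤ ∑ i ∈ Finset.Iic d, (Fintype.card τ).choose i :=
    (Finset.card_le_card_shatterer F).trans (Finset.card_shatterer_le_sum_vcDim.trans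
      (Finset.sum_le_sum_of_subset (Finset.Iic_subset_Iic.2 hvc)))
  rw [hcard]
  refine le_trans ?_ (sum_choose_le (d := d) (N := Fintype.card τ) hr hr1)
  exact_mod_cast h1

/-- Patterns of the error indicators of hypotheses of `H` on (possibly undefined) labelled
examples. -/
theorem exists_error_patterns {H : Set (X → Bool)} {d : ℕ} (hH : HasVCDim H d) {τ : Type*}
    [Fintype τ] [Nonempty X] (w : τ → Option (X × Bool)) {r : ℝ} (hr : 0 < r) (hr1 : r ≤ 1) :
    ∃ P : Finset (τ → Bool),
      (∀ h ∈ H, (fun s => (w s).elim false fun z => decide (h z.1 ≠ z.2)) ∈ P) ∧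
      (P.card : ℝ) ≤ (1 / r) ^ d * Real.exp (r * Fintype.card τ) := by
  classical
  obtain ⟨x₀⟩ := ‹Nonempty X›
  obtain ⟨P, hP, hc⟩ := exists_patterns hH (fun s => (w s).elim x₀ Prod.fst) hr hr1
  refine ⟨P.image fun q s => (w s).elim false fun z => decide (q s ≠ z.2), fun h hh => ?_, ?_⟩
  · refine Finset.mem_image.2 ⟨_, hP h hh, ?_⟩
    ext s
    cases w s with
    | none => simp
    | some z => by_cases hz : h z.1 = z.2 <;> simp [hz]
  · exact le_trans (by exact_mod_cast Finset.card_image_le) hc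

/-- Patterns of the error indicators of majority votes of `T` hypotheses of `H`. -/
theorem exists_majority_patterns {H : Set (X → Bool)} {d : ℕ} (hH : HasVCDim H d) {τ : Type*}
    [Fintype τ] (w : τ → X) (hstar : X → Bool) (T : ℕ) {r : ℝ} (hr : 0 < r) (hr1 : r ≤ 1) :
    ∃ P : Finset (τ → Bool),
      (∀ hs : List (X → Bool), hs.length = T → (∀ h ∈ hs, h ∈ H) →
        (fun s => decide (majority hs (w s) ≠ hstar (w s))) ∈ P) ∧
      (P.card : ℝ) ≤ ((1 / r) ^ d * Real.exp (r * Fintype.card τ)) ^ T := by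
  classical
  obtain ⟨P, hP, hc⟩ := exists_patterns hH w hr hr1
  -- The vote at the given points depends only on the `T` patterns of the voters, which leaves at
  -- most `P.card ^ T` possibilities.
  let Φ : (Fin T → τ → Bool) → τ → Bool := fun q s =>
    decide (decide (T < 2 * (List.ofFn q).countP fun g => g s) ≠ hstar (w s))
  refine ⟨(Fintype.piFinset fun _ : Fin T => P).image Φ, fun hs hT hmem => ?_, ?_⟩
  · subst hT
    refine Finset.mem_image.2 ⟨fun i s => hs.get i (w s), ?_, ?_⟩
    · exact Fintype.mem_piFinset.2 fun i => hP _ (hmem _ (List.get_mem _ _))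
    · ext s
      have : (List.ofFn fun (i : Fin hs.length) s => hs.get i (w s)) =
          hs.map fun h s => h (w s) := by
        conv_rhs => rw [← List.ofFn_get hs, List.map_ofFn]
        rfl
      simp only [Φ, this, List.countP_map, majority]
      rfl
  · have h1 : ((Fintype.piFinset fun _ : Fin T => P).image Φ).card ≤ P.card ^ T := by
      refine Finset.card_image_le.trans ?_
      rw [Fintype.card_piFinset_const]
    calc _ ≤ ((P.card : ℝ)) ^ T := by exact_mod_cast h1
      _ ≤ _ := pow_le_pow_left₀ (Nat.cast_nonneg _) hc T

/-- Turn patterns on the two halves of a sample of pairs into patterns on pairs. -/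
theorem exists_pair_patterns {Z : Type*} {m : ℕ} (w : Fin m → Z × Z) {𝒢 : Set (Z → Bool)} {Γ : ℝ}
    (h : ∀ v : Fin m × Bool → Z, ∃ P : Finset (Fin m × Bool → Bool),
      (∀ g ∈ 𝒢, (fun s => g (v s)) ∈ P) ∧ (P.card : ℝ) ≤ Γ) :
    ∃ P : Finset (Fin m → Bool × Bool),
      (∀ g ∈ 𝒢, (fun l => (g (w l).1, g (w l).2)) ∈ P) ∧ (P.card : ℝ) ≤ Γ := by
  classical
  obtain ⟨P, hP, hc⟩ := h fun s => if s.2 then (w s.1).2 else (w s.1).1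
  refine ⟨P.image fun q l => (q (l, false), q (l, true)), fun g hg => ?_, ?_⟩
  · exact Finset.mem_image.2 ⟨_, hP g hg, by ext l <;> simp⟩
  · exact le_trans (by exact_mod_cast Finset.card_image_le) hc

end Sauer

/-! ### The law of a weighted pick -/

section WeightedPick

variable {α : Type*}

theorem pickFrom_isSome {L : List (α × ℕ)} (hL : L ≠ []) (v : ℝ) :
    ∃ a ∈ L.map Prod.fst, pickFrom L v = some a := by
  induction L generalizing v with
  | nil => exact absurd rfl hL
  | cons b L ih =>
    cases L with
    | nil => exact ⟨b.1, by simp, rfl⟩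
    | cons c L =>
      simp only [pickFrom]
      split_ifs with h
      · exact ⟨b.1, by simp, rfl⟩
      · obtain ⟨a, ha, h2⟩ := ih (by simp) (v - b.2)
        exact ⟨a, List.mem_cons_of_mem _ ha, h2⟩

theorem weightedPick_mem {L : List (α × ℕ)} {u : ℝ} {a : α} (h : weightedPick L u = some a) :
    a ∈ L.map Prod.fst := by
  unfold weightedPick at h
  by_cases hL : L = []
  · subst hL; simp [pickFrom] at h
  · obtain ⟨b, hb, h2⟩ := pickFrom_isSome hL (u * ((L.map Prod.snd).sum : ℕ))
    rw [h2] at h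
    exact (Option.some.inj h) ▸ hb

theorem weightedPick_isSome {L : List (α × ℕ)} (hL : L ≠ []) (u : ℝ) :
    ∃ a ∈ L.map Prod.fst, weightedPick L u = some a := pickFrom_isSome hL _

theorem measurableSet_pickFrom (L : List (α × ℕ)) (P : α → Prop) :
    MeasurableSet {v : ℝ | ∃ a, pickFrom L v = some a ∧ P a} := by
  let _ : MeasurableSpace α := ⊤
  have hP : Measurable fun p : Unit × α => P p.2 :=
    (measurable_from_top (f := P)).comp measurable_snd
  have := (measurable_pickFrom hP (g := fun _ => False) measurable_const).comp
    (f := fun v : ℝ => (L, ((), v))) (by fun_prop)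
  convert measurableSet_setOfPred.2 this using 2
  ext v
  cases h : pickFrom L v <;> simp [h]

/-- The walk lays the weights end to end as intervals, so each entry is selected on an interval of
the length of its weight. The last entry also catches every larger threshold, whence the restriction
to thresholds below the total. -/
theorem volume_pickFrom (L : List (α × ℕ)) (P : α → Prop) [DecidablePred P] :
    volume {v : ℝ | (0 ≤ v ∧ v < ((L.map Prod.snd).sum : ℕ)) ∧ ∃ a, pickFrom L v = some a ∧ P a} =
      (((L.filter fun z => P z.1).map Prod.snd).sum : ℕ) := by
  induction L with
  | nil => simp [pickFrom]
  | cons b L ih =>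
    obtain ⟨b, w⟩ := b
    cases L with
    | nil =>
      by_cases hb : P b
      · have : {v : ℝ | (0 ≤ v ∧ v < (((List.map Prod.snd [(b, w)]).sum : ℕ) : ℝ)) ∧
            ∃ a, pickFrom [(b, w)] v = some a ∧ P a} = Set.Ico 0 (w : ℝ) := by
          ext v; simp [pickFrom, hb]
        rw [this]
        simp [hb]
      · simp [pickFrom, hb]
    | cons c L =>
      set M := c :: L with hM
      set W := (M.map Prod.snd).sum with hW
      set E := {v : ℝ | (0 ≤ v ∧ v < (W : ℝ)) ∧ ∃ a, pickFrom M v = some a ∧ P a} with hE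
      have hEm : MeasurableSet E :=
        ((measurableSet_Ici (a := (0 : ℝ))).inter measurableSet_Iio).inter
          (measurableSet_pickFrom M P)
      have hset : {v : ℝ | (0 ≤ v ∧ v < (((List.map Prod.snd ((b, w) :: M)).sum : ℕ) : ℝ)) ∧
          ∃ a, pickFrom ((b, w) :: M) v = some a ∧ P a} =
          (if P b then Set.Ico 0 (w : ℝ) else ∅) ∪ (fun v => v - (w : ℝ)) ⁻¹' E := by
        ext v
        have hpick : pickFrom ((b, w) :: M) v = if v < w then some b else pickFrom M (v - w) := by
          rw [hM]; simp only [pickFrom]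
        have hsum : (((List.map Prod.snd ((b, w) :: M)).sum : ℕ) : ℝ) = w + W := by
          simp [hW]
        simp only [hpick, Set.mem_union, hE, Set.mem_preimage, Set.mem_ofPred_eq]
        rw [hsum]
        have hW0 : (0 : ℝ) ≤ W := Nat.cast_nonneg _
        by_cases hv : v < w
        · have h2 : ¬ 0 ≤ v - w := by linarith
          by_cases hb : P b
          · simp only [hv, if_true, Option.some.injEq, exists_eq_left', hb, Set.mem_Ico, h2]
            constructor
            · rintro ⟨⟨h, -⟩, -⟩; exact Or.inl ⟨h, trivial⟩
            · rintro (⟨h, -⟩ | h)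
              · exact ⟨⟨h, by linarith⟩, trivial⟩
              · exact absurd h.1.1 id
          · simp [hv, hb, h2]
        · have h2 : v ∉ (if P b then Set.Ico 0 (w : ℝ) else ∅) := by
            split_ifs <;> simp
            intro _; linarith
          simp only [hv, if_false, h2, false_or]
          have h3 : (0 : ℝ) ≤ w := Nat.cast_nonneg _
          constructor
          · rintro ⟨⟨h, h'⟩, h''⟩; exact ⟨⟨by linarith, by linarith⟩, h''⟩
          · rintro ⟨⟨h, h'⟩, h''⟩; exact ⟨⟨by linarith, by linarith⟩, h''⟩
      have hEm' : MeasurableSet ((fun v : ℝ => v - (w : ℝ)) ⁻¹' E) :=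
        (measurable_id.sub_const (w : ℝ)) hEm
      rw [hset, measure_union _ hEm',
        (measurePreserving_sub_right volume (w : ℝ)).measure_preimage hEm.nullMeasurableSet, ih]
      · by_cases hb : P b <;> simp [hb]
      · rw [Set.disjoint_left]
        intro v hv hv2
        have h1 : 0 ≤ v - (w : ℝ) := hv2.1.1
        split_ifs at hv
        · exact absurd hv.2 (by linarith)
        · exact hv

/-- The law of a weighted pick. -/
theorem volume_weightedPick (L : List (α × ℕ)) (P : α → Prop) [DecidablePred P]
    (hW : 0 < (L.map Prod.snd).sum) :
    volume {u : unitInterval | ∃ a, weightedPick L u = some a ∧ P a} =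
      ENNReal.ofReal ((((L.filter fun z => P z.1).map Prod.snd).sum : ℕ) /
        ((L.map Prod.snd).sum : ℕ)) := by
  set W := (L.map Prod.snd).sum
  set E := {v : ℝ | (0 ≤ v ∧ v < (W : ℝ)) ∧ ∃ a, pickFrom L v = some a ∧ P a} with hE
  have hW' : (0 : ℝ) < W := by exact_mod_cast hW
  have hEm : MeasurableSet E :=
    ((measurableSet_Ici (a := (0 : ℝ))).inter measurableSet_Iio).inter (measurableSet_pickFrom L P)
  have h1 : volume {u : unitInterval | ∃ a, weightedPick L u = some a ∧ P a} =
      volume (Subtype.val '' {u : unitInterval | ∃ a, weightedPick L u = some a ∧ P a}) :=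
    comap_subtype_coe_apply measurableSet_Icc volume _
  have h2 : (Subtype.val '' {u : unitInterval | ∃ a, weightedPick L u = some a ∧ P a}) =ᵐ[volume]
      ((fun u : ℝ => u * (W : ℝ)) ⁻¹' E : Set ℝ) := by
    -- The point `u = 1` is sent to the total weight, just outside the half-open interval; it is a
    -- null set.
    have hnull : ∀ᵐ u : ℝ, u ≠ 1 := by
      simp [ae_iff]
    filter_upwards [hnull] with u hu
    refine propext ?_
    change u ∈ Subtype.val '' _ ↔ u * (W : ℝ) ∈ E
    constructor
    · rintro ⟨⟨u, hu0, hu1⟩, h, rfl⟩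
      have hu1' : u < 1 := lt_of_le_of_ne hu1 hu
      exact ⟨⟨by positivity, by nlinarith⟩, h⟩
    · rintro ⟨⟨h3, h4⟩, h5⟩
      refine ⟨⟨u, ⟨?_, ?_⟩⟩, h5, rfl⟩
      · by_contra hneg
        push Not at hneg
        nlinarith
      · by_contra hneg
        push Not at hneg
        nlinarith
  rw [h1, measure_congr h2, Real.volume_preimage_mul_right hW'.ne', volume_pickFrom,
    ENNReal.ofReal_div_of_pos hW', abs_of_pos (inv_pos.2 hW'), ENNReal.ofReal_inv_of_pos hW',
    mul_comm, ENNReal.ofReal_natCast, div_eq_mul_inv, ENNReal.ofReal_natCast]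

end WeightedPick

/-! ### Multinomial counts followed by draws give independent mixture samples -/

section Mixture

/-- Number of earlier occurrences of the `l`-th name. -/
def rank {α : Type*} [DecidableEq α] (c : ℕ → α) (l : ℕ) : ℕ :=
  ((List.range l).filter fun l' => c l' = c l).length

theorem rank_lt {α : Type*} [DecidableEq α] (c : ℕ → α) {l l' : ℕ} (h : l < l') (hc : c l = c l') :
    rank c l < rank c l' := by
  unfold rank
  rw [hc]
  have h1 : ((List.range (l + 1)).filter fun l'' => c l'' = c l').length =
      ((List.range l).filter fun l'' => c l'' = c l').length + 1 := by
    simp [List.range_succ, List.filter_append, hc]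
  have h2 : ((List.range (l + 1)).filter fun l'' => c l'' = c l').length ≤
      ((List.range l').filter fun l'' => c l'' = c l').length := by
    refine List.Sublist.length_le (List.Sublist.filter _ ?_)
    exact List.range_sublist.2 h
  omega

/-- The slots with name `i` have ranks `0, 1, 2, …` in this order. So using the first draws of `i`,
as many as its count, is the same as letting every slot use the draw numbered by its rank. -/
theorem range_map_eq_filter_map {α β : Type*} [DecidableEq α] (c : ℕ → α) (i : α) (f : ℕ → β)
    (n : ℕ) :
    (List.range ((List.range n).filter fun l => c l = i).length).map f =
      ((List.range n).filter fun l => c l = i).map fun l => f (rank c l) := by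
  induction n with
  | zero => simp
  | succ n ih =>
    rw [List.range_succ, List.filter_append]
    by_cases h : c n = i
    · simp only [h, List.filter_cons, decide_true, if_true, List.filter_nil, List.length_append,
        List.length_cons, List.length_nil, List.range_succ, List.map_append, List.map_cons,
        List.map_nil, ih]
      simp [rank, h]
    · simp [h, ih]

variable {k : ℕ} {V : Type*} [MeasurableSpace V]

/-- First a random name, then a value with the law belonging to that name. -/
def mixtureLaw (p : Fin k → ENNReal) (κ : Fin k → Measure V) : Measure (Fin k × V) :=
  ∑ i, p i • (κ i).map (Prod.mk i)

theorem mixtureLaw_apply (p : Fin k → ENNReal) (κ : Fin k → Measure V) {s : Set (Fin k × V)}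
    (hs : MeasurableSet s) : mixtureLaw p κ s = ∑ i, p i * κ i (Prod.mk i ⁻¹' s) := by
  simp [mixtureLaw, Measure.map_apply measurable_prodMk_left hs]

theorem isProbabilityMeasure_mixtureLaw {p : Fin k → ENNReal} (κ : Fin k → Measure V)
    [∀ i, IsProbabilityMeasure (κ i)] (hp : ∑ i, p i = 1) :
    IsProbabilityMeasure (mixtureLaw p κ) := by
  constructor
  rw [mixtureLaw_apply _ _ MeasurableSet.univ]
  simpa using hp

theorem measurable_names_values {Ω : Type*} [MeasurableSpace Ω] (m : ℕ)
    {I : ℕ → Ω → Fin k} (hI : ∀ l, Measurable (I l)) {Y : Fin k → ℕ → Ω → V}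
    (hY : ∀ i r, Measurable (Y i r)) :
    Measurable (fun ω (l : Fin m) => (I l ω, Y (I l ω) (rank (fun l => I l ω) l) ω)) := by
  have hrank : ∀ l, Measurable fun ω => rank (fun l => I l ω) l := fun l =>
    Measurable.length_filter_range fun l' => measurableSet_eq_fun (hI l') (hI l)
  refine measurable_pi_lambda _ fun l => (hI l).prodMk ?_
  have h1 : Measurable fun q : (Fin k × ℕ) × Ω => Y q.1.1 q.1.2 q.2 :=
    measurable_from_prod_countable_right (f := fun q : (Fin k × ℕ) × Ω => Y q.1.1 q.1.2 q.2)
      fun q => hY q.1 q.2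
  exact h1.comp (((hI l).prodMk (hrank l)).prodMk measurable_id)

/-- Drawing names first, and then for every name as many values as it occurred, amounts to
independent draws from the mixture. -/
theorem map_names_values {Ω : Type*} [MeasurableSpace Ω] (P : Measure Ω) (m : ℕ)
    {I : ℕ → Ω → Fin k} (hI : ∀ l, Measurable (I l)) {Y : Fin k → ℕ → Ω → V}
    (hY : ∀ i r, Measurable (Y i r)) {p : Fin k → ENNReal} {κ : Fin k → Measure V}
    [∀ i, IsProbabilityMeasure (κ i)] (hp : ∑ i, p i = 1)
    (hind : ∀ (ι : Fin m → Fin k) (r : Fin m → ℕ), Function.Injective (fun l => (ι l, r l)) →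
      ∀ B : Fin m → Set V, (∀ l, MeasurableSet (B l)) →
      P {ω | ∀ l : Fin m, I l ω = ι l ∧ Y (ι l) (r l) ω ∈ B l} = ∏ l, p (ι l) * κ (ι l) (B l)) :
    P.map (fun ω (l : Fin m) => (I l ω, Y (I l ω) (rank (fun l => I l ω) l) ω)) =
      Measure.pi fun _ => mixtureLaw p κ := by
  classical
  have := isProbabilityMeasure_mixtureLaw κ hp
  obtain ⟨i₀⟩ : Nonempty (Fin k) := by
    by_contra hne
    rw [not_nonempty_iff] at hne
    simp at hp
  have hΦ := measurable_names_values m hI hY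
  symm
  refine Measure.pi_eq fun s hs => ?_
  rw [Measure.map_apply hΦ (MeasurableSet.univ_pi hs)]
  -- `rank` takes a sequence on all of `ℕ`; the filling value `i₀` is irrelevant, since the rank of
  -- a slot looks at earlier slots only.
  let ext' : (Fin m → Fin k) → ℕ → Fin k := fun ι l => if h : l < m then ι ⟨l, h⟩ else i₀
  let R : (Fin m → Fin k) → Fin m → ℕ := fun ι l => rank (ext' ι) l
  have hR : ∀ ω (ι : Fin m → Fin k), (∀ l : Fin m, I l ω = ι l) →
      ∀ l : Fin m, rank (fun l => I l ω) l = R ι l := by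
    intro ω ι h l
    simp only [R, rank]
    congr 1
    refine List.filter_congr fun l' hl' => ?_
    rw [List.mem_range] at hl'
    have hl'm : l' < m := hl'.trans l.2
    have e1 : ext' ι l' = I l' ω := by simp [ext', hl'm, ← h]
    have e2 : ext' ι l = I l ω := by simp [ext', ← h]
    rw [e1, e2]
  -- For a fixed sequence of names the ranks are fixed too, and slots sharing a name have different
  -- ranks. So no draw is used twice and `hind` applies to each of the finitely many name sequences.
  have hinj : ∀ ι : Fin m → Fin k, Function.Injective (fun l => (ι l, R ι l)) := by
    intro ι l l' h
    simp only [Prod.mk.injEq] at h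
    have e : ∀ l : Fin m, ext' ι l = ι l := fun l => by simp [ext']
    rcases lt_trichotomy l l' with hl | hl | hl
    · exact absurd h.2 (rank_lt (ext' ι) hl (by rw [e, e, h.1])).ne
    · exact hl
    · exact absurd h.2 (rank_lt (ext' ι) hl (by rw [e, e, h.1])).ne'
  let T : (Fin m → Fin k) → Set Ω := fun ι =>
    {ω | ∀ l : Fin m, I l ω = ι l ∧ Y (ι l) (R ι l) ω ∈ Prod.mk (ι l) ⁻¹' s l}
  have hpre : (fun ω (l : Fin m) => (I l ω, Y (I l ω) (rank (fun l => I l ω) l) ω)) ⁻¹'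
      (Set.univ.pi s) = ⋃ ι ∈ (Finset.univ : Finset (Fin m → Fin k)), T ι := by
    ext ω
    simp only [Set.mem_preimage, Set.mem_pi, Set.mem_univ, true_imp_iff, Finset.mem_univ,
      Set.iUnion_true, Set.mem_iUnion, T, Set.mem_ofPred_eq]
    constructor
    · intro h
      refine ⟨fun l => I l ω, fun l => ⟨rfl, ?_⟩⟩
      have := h l
      rwa [hR ω (fun l => I l ω) (fun _ => rfl) l] at this
    · rintro ⟨ι, h⟩ l
      rw [hR ω ι (fun l => (h l).1) l, (h l).1]
      exact (h l).2
  have hTm : ∀ ι, MeasurableSet (T ι) := by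
    intro ι
    have : T ι = ⋂ l : Fin m, ({ω | I l ω = ι l} ∩ (Y (ι l) (R ι l)) ⁻¹' (Prod.mk (ι l) ⁻¹' s l)) := by
      ext ω; simp [T]
    rw [this]
    exact MeasurableSet.iInter fun l => ((hI l) (measurableSet_singleton _)).inter
      (hY _ _ (measurable_prodMk_left (hs l)))
  rw [hpre, measure_biUnion_finset _ fun ι _ => hTm ι]
  · rw [Finset.sum_congr rfl fun ι _ => hind ι (R ι) (hinj ι) _ fun l => measurable_prodMk_left (hs l)]
    simp only [mixtureLaw_apply _ _ (hs _)]
    rw [Finset.prod_univ_sum, Fintype.piFinset_univ]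
  · intro ι _ ι' _ hne
    rw [Function.onFun, Set.disjoint_left]
    intro ω h h'
    exact hne (funext fun l => (h l).1.symm.trans (h' l).1)

theorem infinitePi_box {ι : Type*} {Ω : ι → Type*} [∀ i, MeasurableSpace (Ω i)]
    (μ : ∀ i, Measure (Ω i)) [∀ i, IsProbabilityMeasure (μ i)] {τ : Type*} [Fintype τ]
    {e : τ → ι} (he : Function.Injective e) {B : ∀ s, Set (Ω (e s))}
    (hB : ∀ s, MeasurableSet (B s)) :
    Measure.infinitePi μ {y | ∀ s, y (e s) ∈ B s} = ∏ s, μ (e s) (B s) := by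
  have h1 := Measure.map_infinitePi_infinitePi_of_inj (P := μ) he
  rw [Measure.infinitePi_eq_pi (μ := fun s => μ (e s))] at h1
  rw [← Measure.pi_pi, ← h1, Measure.map_apply (by fun_prop) (MeasurableSet.univ_pi hB)]
  congr 1
  ext y
  simp

end Mixture

/-! ### Random choice of a player -/

section Players

variable {k : ℕ}

theorem mem_players {N : Finset (Fin k)} {i : Fin k} : i ∈ players N ↔ i ∈ N := by
  simp [players]

theorem sum_players {M : Type*} [AddCommMonoid M] (N : Finset (Fin k)) (f : Fin k → M) :
    ((players N).map f).sum = ∑ i ∈ N, f i := by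
  have h1 : (players N).Nodup := (List.nodup_finRange k).filter _
  have h2 : (players N).toFinset = N := by ext i; simp [mem_players]
  rw [← List.sum_toFinset f h1, h2]

theorem length_players (N : Finset (Fin k)) : (players N).length = N.card := by
  have := sum_players N fun _ => 1
  simpa using this

theorem players_ne_nil {N : Finset (Fin k)} (hN : N.Nonempty) : players N ≠ [] := by
  obtain ⟨i, hi⟩ := hN
  exact List.ne_nil_of_mem (mem_players.2 hi)

/-- The name selected by a weighted pick among the players in `N`. -/
def pickName (i₀ : Fin k) (N : Finset (Fin k)) (a : Fin k → ℕ) (u : unitInterval) : Fin k :=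
  (weightedPick ((players N).map fun i => (i, a i)) u).getD i₀

theorem weightedPick_players (i₀ : Fin k) {N : Finset (Fin k)} (hN : N.Nonempty) (a : Fin k → ℕ)
    (u : unitInterval) : weightedPick ((players N).map fun i => (i, a i)) u =
      some (pickName i₀ N a u) := by
  obtain ⟨b, -, hb⟩ := weightedPick_isSome
    (L := (players N).map fun i => (i, a i)) (by simpa using players_ne_nil hN) u
  simp [pickName, hb]

theorem pickName_mem (i₀ : Fin k) {N : Finset (Fin k)} (hN : N.Nonempty) (a : Fin k → ℕ)
    (u : unitInterval) : pickName i₀ N a u ∈ N := by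
  have := weightedPick_mem (weightedPick_players i₀ hN a u)
  simpa [mem_players, Function.comp_def] using this

theorem measurable_pickName (i₀ : Fin k) {N : Finset (Fin k)} (hN : N.Nonempty) (a : Fin k → ℕ) :
    Measurable (pickName i₀ N a) := by
  refine measurable_to_countable' fun i => ?_
  have := measurableSet_weightedPick (γ := unitInterval)
    (L := fun _ => (players N).map fun i => (i, a i))
    (v := fun u => (u : ℝ)) measurable_const measurable_subtype_coe i
  convert this using 1
  ext u
  simp [weightedPick_players i₀ hN a u]

theorem multinomial_eq (i₀ : Fin k) {N : Finset (Fin k)} (hN : N.Nonempty) (a : Fin k → ℕ) (n : ℕ)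
    (coin : ℕ → unitInterval) (i : Fin k) :
    multinomial ((players N).map fun i => (i, a i)) n coin i =
      ((List.range n).filter fun l => pickName i₀ N a (coin l) = i).length := by
  unfold multinomial
  simp only [weightedPick_players i₀ hN, Option.some.injEq]

/-- The probability that a weighted pick among the players in `N` selects `i`. -/
def nameProb (N : Finset (Fin k)) (a : Fin k → ℕ) (i : Fin k) : ℝ :=
  (if i ∈ N then (a i : ℝ) else 0) / ∑ i ∈ N, (a i : ℝ)

theorem nameProb_nonneg (N : Finset (Fin k)) (a : Fin k → ℕ) (i : Fin k) : 0 ≤ nameProb N a i := by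
  unfold nameProb
  split_ifs <;> positivity

theorem volume_pickName (i₀ : Fin k) {N : Finset (Fin k)} (hN : N.Nonempty) {a : Fin k → ℕ}
    (ha : 0 < ∑ i ∈ N, a i) (i : Fin k) :
    volume (pickName i₀ N a ⁻¹' {i}) = ENNReal.ofReal (nameProb N a i) := by
  have hs : (((players N).map fun i => (i, a i)).map Prod.snd).sum = ∑ i ∈ N, a i := by
    rw [List.map_map, ← sum_players]; rfl
  have := volume_weightedPick ((players N).map fun i => (i, a i)) (fun b => b = i) (by rwa [hs])
  rw [hs] at this
  convert this using 2
  · ext u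
    simp [weightedPick_players i₀ hN a u]
  · unfold nameProb
    congr 1
    · rw [List.filter_map, List.map_map]
      simp only [Function.comp_def]
      have h1 : ((players N).filter fun x => x = i) = players (N.filter fun x => x = i) := by
        simp [players, List.filter_filter, and_comm]
      rw [h1, sum_players]
      by_cases hi : i ∈ N
      · rw [Finset.filter_eq' N i]; simp [hi]
      · rw [Finset.filter_eq' N i]; simp [hi]
    · push_cast; rfl

theorem sum_nameProb {N : Finset (Fin k)} {a : Fin k → ℕ} (ha : 0 < ∑ i ∈ N, a i) :
    ∑ i, ENNReal.ofReal (nameProb N a i) = 1 := by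
  rw [← ENNReal.ofReal_sum_of_nonneg]
  · have : (0 : ℝ) < ∑ i ∈ N, (a i : ℝ) := by exact_mod_cast ha
    simp only [nameProb]
    rw [← Finset.sum_div, Finset.sum_ite_mem, Finset.univ_inter, div_self this.ne']
    simp
  · exact fun i _ => nameProb_nonneg N a i

/-- The values with name `i` in a list of named values. -/
def grouped {V : Type*} {m : ℕ} (z : Fin m → Fin k × V) (i : Fin k) : List V :=
  ((List.finRange m).filter fun l => (z l).1 = i).map fun l => (z l).2

/-- Translates the per-player lists of the algorithm into one sample indexed by the center's slots,
to which `map_names_values` refers. -/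
theorem grouped_eq_map_range {V : Type*} (m : ℕ) (c : ℕ → Fin k) (y : Fin k → ℕ → V) (i : Fin k) :
    grouped (fun l : Fin m => (c l, y (c l) (rank c l))) i =
      (List.range ((List.range m).filter fun l => c l = i).length).map (y i) := by
  rw [range_map_eq_filter_map c i (y i) m, ← List.map_coe_finRange_eq_range, List.filter_map, List.map_map]
  unfold grouped
  refine List.map_congr_left fun l hl => ?_
  have : c l = i := by simpa using (List.mem_filter.1 hl).2
  simp [this]

theorem countP_grouped {V : Type*} {m : ℕ} {N : Finset (Fin k)} {z : Fin m → Fin k × V}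
    (hz : ∀ l, (z l).1 ∈ N) (Q : V → Bool) :
    ((players N).map fun i => (grouped z i).countP Q).sum = hits (fun v => Q v.2) z := by
  rw [sum_players, hits, Finset.card_filter, ← Finset.sum_fiberwise_of_maps_to (t := N) (g := fun l => (z l).1)
    (fun l _ => hz l)]
  refine Finset.sum_congr rfl fun i _ => ?_
  rw [grouped, List.countP_map, List.countP_filter, List.countP_eq_length_filter,
    ← List.toFinset_card_of_nodup ((List.nodup_finRange m).filter _), ← Finset.card_filter,
    Finset.filter_filter]
  congr 1
  ext l
  simp [and_comm]

end Players

/-! ### Measurability of Distributed Boosting -/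

section BoostMeasurability

variable {X : Type u} {k : ℕ} {Ω : Type*}

/-- The examples transmitted in a boosting round. -/
def sentExamples (n j : ℕ) (N : Finset (Fin k))
    (S : Fin k → List (X × Bool)) (ω : Randomness X k) (t : ℕ) (hs : List (X → Bool)) :
    List (X × Bool) :=
  (players N).flatMap fun i =>
    (List.range (multinomial ((players N).map fun i => (i, approxWeight (report hs (S i)))) n
      (fun l => ω.2 (.request j t l)) i)).filterMap fun r =>
        weightedPick ((S i).map fun z => (z, boostWeight hs z)) (ω.2 (.pick j t i r))

theorem boostRound_fst (A : List (X × Bool) → X → Bool) (n j : ℕ) (N : Finset (Fin k))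
    (S : Fin k → List (X × Bool)) (ω : Randomness X k) (t : ℕ) (hs : List (X → Bool)) :
    (boostRound A n j N S ω t hs).1 = A (sentExamples n j N S ω t hs) := rfl

variable [MeasurableSpace X] [MeasurableSpace Ω]

/-- The powers of `Bool` are finite and discrete. Boosting weights and votes depend on the
hypotheses only through the list of their values at a point, so their measurability comes down to
that of this list. -/
theorem measurable_of_list_bool {β : Type*} [MeasurableSpace β] (f : List Bool → β) :
    Measurable f :=
  measurable_of_ofFn fun _ => Measurable.of_discrete

theorem measurable_of_list_bool_prod {β : Type*} [MeasurableSpace β] (f : List Bool × Bool → β) :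
    Measurable f :=
  measurable_list_prod fun _ => Measurable.of_discrete

/-- A random list of hypotheses whose values are jointly measurable. -/
def MeasurableHyps (hs : Ω → List (X → Bool)) : Prop :=
  Measurable fun p : Ω × X => (hs p.1).map fun h => h p.2

theorem MeasurableHyps.boostWeight {hs : Ω → List (X → Bool)} (h : MeasurableHyps hs) :
    Measurable fun p : Ω × (X × Bool) => CollabPAC.boostWeight (hs p.1) p.2 := by
  have h1 := (measurable_of_list_bool_prod
    (fun q : List Bool × Bool => 2 ^ q.1.countP fun b => b ≠ q.2)).comp
    ((h.comp (f := fun p : Ω × (X × Bool) => (p.1, p.2.1)) (by fun_prop)).prodMk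
      (measurable_snd.snd))
  convert h1 using 2 with p
  simp [CollabPAC.boostWeight, List.countP_map, Function.comp_def]

theorem MeasurableHyps.majority {hs : Ω → List (X → Bool)} (h : MeasurableHyps hs) :
    Measurable fun p : Ω × X => CollabPAC.majority (hs p.1) p.2 := by
  have h1 := (measurable_of_list_bool
    (fun q : List Bool => decide (q.length < 2 * q.countP fun b => b))).comp h
  convert h1 using 2 with p
  simp [CollabPAC.majority, List.countP_map, Function.comp_def]

theorem measurable_learner {H : Set (X → Bool)} {A : List (X × Bool) → X → Bool}
    (hA : IsConsistentLearner H A) : Measurable fun p : List (X × Bool) × X => A p.1 p.2 :=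
  measurable_list_prod hA.measurable

theorem measurable_report {hs : Ω → List (X → Bool)} (h : MeasurableHyps hs)
    {S : Ω → List (X × Bool)} (hS : Measurable S) : Measurable fun x => report (hs x) (S x) :=
  (measurable_from_nat (f := Nat.size)).comp (hS.listMap h.boostWeight).listSum

theorem measurable_sentExamples (n j : ℕ) (N : Finset (Fin k))
    {S : Ω → Fin k → List (X × Bool)} (hS : ∀ i, Measurable fun x => S x i)
    {ω : Ω → Randomness X k} (hω : Measurable ω) (t : ℕ) {hs : Ω → List (X → Bool)}
    (h : MeasurableHyps hs) :
    Measurable fun x => sentExamples n j N (S x) (ω x) t (hs x) := by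
  have hcoin : ∀ q : Coin k, Measurable fun x => ((ω x).2 q : ℝ) := fun q =>
    measurable_subtype_coe.comp ((measurable_pi_apply q).comp hω.snd)
  refine Measurable.listFlatMap_const _ fun i _ => ?_
  simp only [List.filterMap_eq_flatMap_toList]
  refine Measurable.listRangeFlatMap ?_ fun r => ?_
  · unfold multinomial
    refine Measurable.length_filter_range fun l => ?_
    refine measurableSet_weightedPick ?_ (hcoin _) i
    refine Measurable.listMap_const _ fun i _ => Measurable.prodMk measurable_const ?_
    exact (measurable_from_nat (f := approxWeight)).comp (measurable_report h (hS i))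
  · have h1 : Measurable fun x => (S x i).map fun z => (z, boostWeight (hs x) z) :=
      (hS i).listMap (measurable_snd.prodMk h.boostWeight)
    have h2 := Measurable.weightedPick_elim h1 (hcoin (.pick j t i r))
      (f := fun p : Ω × (X × Bool) => [p.2]) (g := fun _ => [])
      (Measurable.listCons measurable_snd measurable_const) measurable_const
    convert h2 using 2 with x
    cases weightedPick ((S x i).map fun z => (z, boostWeight (hs x) z)) ((ω x).2 (.pick j t i r)) <;> rfl

theorem measurable_boost {H : Set (X → Bool)} {A : List (X × Bool) → X → Bool}
    (hA : IsConsistentLearner H A) (n j : ℕ) (N : Finset (Fin k))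
    {S : Ω → Fin k → List (X × Bool)} (hS : ∀ i, Measurable fun x => S x i)
    {ω : Ω → Randomness X k} (hω : Measurable ω) (t : ℕ) :
    MeasurableHyps fun x => (boost A n j N (S x) (ω x) t).1 := by
  induction t with
  | zero => simp [MeasurableHyps, boost]
  | succ t ih =>
    unfold MeasurableHyps
    simp only [boost, List.map_cons]
    refine Measurable.listCons ?_ ih
    simp only [boostRound_fst]
    have h1 := measurable_sentExamples n j N hS hω t ih
    exact (measurable_learner hA).comp ((h1.comp measurable_fst).prodMk measurable_snd)

theorem measurable_reservoir {hstar : X → Bool} (hstar_meas : Measurable hstar) (m j : ℕ)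
    (N : Finset (Fin k)) (i : Fin k) :
    Measurable fun ω : Randomness X k => reservoir hstar m j N ω i := by
  have hd : ∀ q : Draw k, Measurable fun ω : Randomness X k => ω.1 q := fun q =>
    (measurable_pi_apply q).comp measurable_fst
  refine Measurable.listRangeMap ?_ fun r => (hd _).prodMk (hstar_meas.comp (hd _))
  unfold mixtureSizes multinomial
  refine Measurable.length_filter_range fun l => ?_
  exact measurableSet_weightedPick measurable_const
    (measurable_subtype_coe.comp ((measurable_pi_apply (Coin.slot j l)).comp
      (measurable_snd (α := Draw k → X) (β := Coin k → unitInterval)))) i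

end BoostMeasurability

/-! ### Reservoirs and resampled points as independent samples -/

section Samples

variable {X : Type u} {k : ℕ}

/-- The examples of the reservoirs of round `j` with their owners, in the order of the center's
random numbers. -/
def resSample (i₀ : Fin k) (m j : ℕ) (N : Finset (Fin k)) (y : Randomness X k) :
    Fin m → Fin k × X := fun l =>
  (pickName i₀ N (fun _ => 1) (y.2 (.slot j l)),
    y.1 (.reservoir j (pickName i₀ N (fun _ => 1) (y.2 (.slot j l)))
      (rank (fun l => pickName i₀ N (fun _ => 1) (y.2 (.slot j l))) l)))

theorem reservoir_eq (i₀ : Fin k) {N : Finset (Fin k)} (hN : N.Nonempty) (hstar : X → Bool)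
    (m j : ℕ) (y : Randomness X k) (i : Fin k) :
    reservoir hstar m j N y i = (grouped (resSample i₀ m j N y) i).map fun x => (x, hstar x) := by
  unfold reservoir mixtureSizes resSample
  rw [multinomial_eq i₀ hN, grouped_eq_map_range m
    (fun l => pickName i₀ N (fun _ => 1) (y.2 (.slot j l))) (fun i r => y.1 (.reservoir j i r)) i,
    List.map_map]
  rfl

/-- The random numbers by which the examples of a boosting round are drawn from the reservoirs,
with the owners of the reservoirs, in the order of the center's random numbers. -/
def pickSample (i₀ : Fin k) (n j t : ℕ) (N : Finset (Fin k)) (a : Fin k → ℕ)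
    (y : Randomness X k) : Fin n → Fin k × unitInterval := fun l =>
  (pickName i₀ N a (y.2 (.request j t l)),
    y.2 (.pick j t (pickName i₀ N a (y.2 (.request j t l)))
      (rank (fun l => pickName i₀ N a (y.2 (.request j t l))) l)))

/-- The examples drawn from the weighted lists `L i` by given random numbers. -/
def pickedExamples {α : Type*} {n : ℕ} (N : Finset (Fin k)) (L : Fin k → List (α × ℕ))
    (z : Fin n → Fin k × unitInterval) : List α :=
  (players N).flatMap fun i => (grouped z i).filterMap fun u : unitInterval => weightedPick (L i) u

/-- Isolates the randomness of a boosting round: once the reservoirs and the earlier hypotheses are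
fixed, the transmitted points are a deterministic function of `pickSample`, whose law is a product.
-/
theorem sentExamples_eq (i₀ : Fin k) {N : Finset (Fin k)} (hN : N.Nonempty) (n j t : ℕ)
    (S : Fin k → List (X × Bool)) (y : Randomness X k) (hs : List (X → Bool)) :
    sentExamples n j N S y t hs =
      pickedExamples N (fun i => (S i).map fun z => (z, boostWeight hs z))
        (pickSample i₀ n j t N (fun i => approxWeight (report hs (S i))) y) := by
  unfold sentExamples pickedExamples
  congr 1
  ext1 i
  unfold pickSample
  rw [multinomial_eq i₀ hN, grouped_eq_map_range n
    (fun l => pickName i₀ N (fun i => approxWeight (report hs (S i))) (y.2 (.request j t l)))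
    (fun i r => y.2 (.pick j t i r)) i, List.filterMap_map]
  rfl

theorem mem_pickedExamples {α : Type*} {n : ℕ} {N : Finset (Fin k)} {L : Fin k → List (α × ℕ)}
    {z : Fin n → Fin k × unitInterval} {l : Fin n} (hl : (z l).1 ∈ N) {a : α}
    (ha : weightedPick (L (z l).1) (z l).2 = some a) : a ∈ pickedExamples N L z := by
  unfold pickedExamples grouped
  rw [List.mem_flatMap]
  refine ⟨(z l).1, mem_players.2 hl, List.mem_filterMap.2 ⟨(z l).2, ?_, ha⟩⟩
  exact List.mem_map.2 ⟨l, by simp, rfl⟩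

theorem exists_of_mem_pickedExamples {α : Type*} {n : ℕ} {N : Finset (Fin k)}
    {L : Fin k → List (α × ℕ)} {z : Fin n → Fin k × unitInterval} {a : α}
    (ha : a ∈ pickedExamples N L z) : ∃ i, a ∈ (L i).map Prod.fst := by
  unfold pickedExamples at ha
  rw [List.mem_flatMap] at ha
  obtain ⟨i, -, hi⟩ := ha
  obtain ⟨u, -, hu⟩ := List.mem_filterMap.1 hi
  exact ⟨i, weightedPick_mem hu⟩

variable [MeasurableSpace X] (D : Fin k → Measure X) [∀ i, IsProbabilityMeasure (D i)]

theorem measurable_resSample (i₀ : Fin k) {N : Finset (Fin k)} (hN : N.Nonempty) (m j : ℕ) :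
    Measurable (resSample (X := X) i₀ m j N) :=
  measurable_names_values m
    (I := fun l (y : Randomness X k) => pickName i₀ N (fun _ => 1) (y.2 (.slot j l)))
    (Y := fun i r y => y.1 (.reservoir j i r))
    (fun _ => (measurable_pickName i₀ hN _).comp ((measurable_pi_apply _).comp measurable_snd))
    fun _ _ => (measurable_pi_apply _).comp measurable_fst

theorem measurable_pickSample (i₀ : Fin k) {N : Finset (Fin k)} (hN : N.Nonempty) (n j t : ℕ)
    (a : Fin k → ℕ) : Measurable (pickSample (X := X) i₀ n j t N a) :=
  measurable_names_values n
    (I := fun l (y : Randomness X k) => pickName i₀ N a (y.2 (.request j t l)))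
    (Y := fun i r y => y.2 (.pick j t i r))
    (fun _ => (measurable_pickName i₀ hN _).comp ((measurable_pi_apply _).comp measurable_snd))
    fun _ _ => (measurable_pi_apply _).comp measurable_snd

/-- Names come from the center's coins and values from the players' draws, two independent blocks,
so the probability of a box splits into a product over the slots. -/
theorem law_map_resSample (i₀ : Fin k) {N : Finset (Fin k)} (hN : N.Nonempty) (m j : ℕ) :
    (law D).map (resSample i₀ m j N) =
      Measure.pi fun _ => mixtureLaw (fun i => ENNReal.ofReal (nameProb N (fun _ => 1) i)) D := by
  have ha : 0 < ∑ i ∈ N, (fun _ : Fin k => 1) i := by simpa using hN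
  refine map_names_values (law D) m
    (I := fun l (y : Randomness X k) => pickName i₀ N (fun _ => 1) (y.2 (.slot j l)))
    (Y := fun i r y => y.1 (.reservoir j i r))
    (fun l => (measurable_pickName i₀ hN _).comp ((measurable_pi_apply _).comp measurable_snd))
    (fun i r => (measurable_pi_apply _).comp measurable_fst) (sum_nameProb ha) ?_
  intro ι r hinj B hB
  have hset : {ω : Randomness X k | ∀ l : Fin m, pickName i₀ N (fun _ => 1) (ω.2 (.slot j l)) = ι l ∧
      ω.1 (.reservoir j (ι l) (r l)) ∈ B l} =
      {x : Draw k → X | ∀ l : Fin m, x (.reservoir j (ι l) (r l)) ∈ B l} ×ˢ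
      {x : Coin k → unitInterval |
        ∀ l : Fin m, x (.slot j l) ∈ pickName i₀ N (fun _ => 1) ⁻¹' {ι l}} := by
    ext ⟨y1, y2⟩
    simp only [Set.mem_ofPred_eq, Set.mem_prod, Set.mem_preimage, Set.mem_singleton_iff]
    exact ⟨fun h => ⟨fun l => (h l).2, fun l => (h l).1⟩, fun h l => ⟨h.2 l, h.1 l⟩⟩
  rw [hset, law, Measure.prod_prod,
    infinitePi_box (fun q : Draw k => D q.player) (e := fun l => .reservoir j (ι l) (r l)) _ hB,
    infinitePi_box (fun _ : Coin k => (volume : Measure unitInterval)) (e := fun l : Fin m => .slot j l)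
      _ (fun l => measurable_pickName i₀ hN _ (measurableSet_singleton (ι l))),
    ← Finset.prod_mul_distrib]
  · refine Finset.prod_congr rfl fun l _ => ?_
    rw [volume_pickName i₀ hN ha, mul_comm]
    rfl
  · intro l l' h
    simpa [Fin.ext_iff] using h
  · intro l l' h
    simp only [Draw.reservoir.injEq, true_and] at h
    exact hinj (Prod.ext h.1 h.2)

theorem law_map_pickSample (i₀ : Fin k) {N : Finset (Fin k)} (hN : N.Nonempty) (n j t : ℕ)
    {a : Fin k → ℕ} (ha : 0 < ∑ i ∈ N, a i) :
    (law D).map (pickSample i₀ n j t N a) =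
      Measure.pi fun _ => mixtureLaw (fun i => ENNReal.ofReal (nameProb N a i)) fun _ => volume := by
  refine map_names_values (law D) n
    (I := fun l (y : Randomness X k) => pickName i₀ N a (y.2 (.request j t l)))
    (Y := fun i r y => y.2 (.pick j t i r))
    (fun l => (measurable_pickName i₀ hN _).comp ((measurable_pi_apply _).comp measurable_snd))
    (fun i r => (measurable_pi_apply _).comp measurable_snd) (sum_nameProb ha) ?_
  intro ι r hinj B hB
  -- Here names and values are both coins, so one injective family indexed by a disjoint sum
  -- describes the box.
  let e : Fin n ⊕ Fin n → Coin k :=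
    Sum.elim (fun l => .request j t l) fun l => .pick j t (ι l) (r l)
  let B' : Fin n ⊕ Fin n → Set unitInterval :=
    Sum.elim (fun l => pickName i₀ N a ⁻¹' {ι l}) B
  have hset : {ω : Randomness X k | ∀ l : Fin n, pickName i₀ N a (ω.2 (.request j t l)) = ι l ∧
      ω.2 (.pick j t (ι l) (r l)) ∈ B l} =
      Set.univ ×ˢ {x : Coin k → unitInterval | ∀ s, x (e s) ∈ B' s} := by
    ext ⟨y1, y2⟩
    simp only [Set.mem_ofPred_eq, Set.mem_prod, Set.mem_univ, true_and, Sum.forall, e, B',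
      Sum.elim_inl, Sum.elim_inr, Set.mem_preimage, Set.mem_singleton_iff]
    exact ⟨fun h => ⟨fun l => (h l).1, fun l => (h l).2⟩, fun h l => ⟨h.1 l, h.2 l⟩⟩
  rw [hset, law, Measure.prod_prod, measure_univ, one_mul,
    infinitePi_box (fun _ : Coin k => (volume : Measure unitInterval)) (e := e) _ (B := B') _,
    Fintype.prod_sum_type, ← Finset.prod_mul_distrib]
  · refine Finset.prod_congr rfl fun l _ => ?_
    simp only [B', Sum.elim_inl, Sum.elim_inr]
    rw [volume_pickName i₀ hN ha]
  · rintro (l | l) (l' | l') h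
    · simpa [e, Fin.ext_iff] using h
    · simp [e] at h
    · simp [e] at h
    · simp only [e, Sum.elim_inr, Coin.pick.injEq, true_and] at h
      exact congrArg Sum.inr (hinj (Prod.ext h.1 h.2))
  · rintro (l | l)
    · exact measurable_pickName i₀ hN _ (measurableSet_singleton _)
    · exact hB l

end Samples

/-! ### The error of a weak hypothesis under the boosting weights -/

section WeakLearner

variable {X : Type u} {k : ℕ}

/-- Total boosting weight of the reservoirs. -/
def totalWeight (N : Finset (Fin k)) (S : Fin k → List (X × Bool)) (hs : List (X → Bool)) : ℕ :=
  ∑ i ∈ N, ((S i).map (boostWeight hs)).sum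

/-- Total boosting weight of the errors of `h` on the reservoirs. -/
def errorWeight (N : Finset (Fin k)) (S : Fin k → List (X × Bool)) (hs : List (X → Bool))
    (h : X → Bool) : ℕ :=
  ∑ i ∈ N, (((S i).filter fun z => h z.1 ≠ z.2).map (boostWeight hs)).sum

theorem approxWeight_bounds (W : ℕ) :
    W ≤ approxWeight (Nat.size W) ∧ approxWeight (Nat.size W) ≤ 2 * W := by
  unfold approxWeight
  by_cases h : Nat.size W = 0
  · rw [Nat.size_eq_zero] at h
    simp [h]
  · rw [if_neg h]
    refine ⟨(Nat.lt_size_self W).le, ?_⟩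
    have h1 : 2 ^ (Nat.size W - 1) ≤ W := Nat.lt_size.1 (by omega)
    have h2 : 2 ^ Nat.size W = 2 * 2 ^ (Nat.size W - 1) := by
      rw [← pow_succ']; congr 1; omega
    omega

theorem sum_map_filter_le {α : Type*} (L : List α) (P : α → Bool) (f : α → ℕ) :
    ((L.filter P).map f).sum ≤ (L.map f).sum := by
  induction L with
  | nil => simp
  | cons a L ih =>
    by_cases h : P a = true <;> simp [h] <;> omega

/-- A weak hypothesis of large error under the boosting weights has large error on the points
drawn according to the approximate weights. -/
theorem le_mixtureLaw_errors {N : Finset (Fin k)} (S : Fin k → List (X × Bool))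
    (hs : List (X → Bool)) (h : X → Bool) (hW : 0 < totalWeight N S hs)
    (hE : totalWeight N S hs ≤ 8 * errorWeight N S hs h)
    {s : Set (Fin k × unitInterval)} (hs_meas : MeasurableSet s)
    (hs_eq : ∀ i, Prod.mk i ⁻¹' s = {u : unitInterval |
      ∃ z, weightedPick ((S i).map fun z => (z, boostWeight hs z)) u = some z ∧ h z.1 ≠ z.2}) :
    ENNReal.ofReal (1 / 16) ≤ mixtureLaw
      (fun i => ENNReal.ofReal (nameProb N (fun i => approxWeight (report hs (S i))) i))
      (fun _ => volume) s := by
  set a : Fin k → ℕ := fun i => approxWeight (report hs (S i)) with ha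
  let W : Fin k → ℕ := fun i => ((S i).map (boostWeight hs)).sum
  let E : Fin k → ℕ := fun i => (((S i).filter fun z => h z.1 ≠ z.2).map (boostWeight hs)).sum
  have hEW : ∀ i, E i ≤ W i := fun i => sum_map_filter_le _ _ _
  have hab : ∀ i, W i ≤ a i ∧ a i ≤ 2 * W i := fun i => approxWeight_bounds _
  have hA2 : ∑ i ∈ N, a i ≤ 2 * totalWeight N S hs := by
    unfold totalWeight
    rw [Finset.mul_sum]
    exact Finset.sum_le_sum fun i _ => (hab i).2
  have hA1 : totalWeight N S hs ≤ ∑ i ∈ N, a i := Finset.sum_le_sum fun i _ => (hab i).1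
  have hApos : (0 : ℝ) < ∑ i ∈ N, (a i : ℝ) := by exact_mod_cast hW.trans_le hA1
  rw [mixtureLaw_apply _ _ hs_meas]
  -- Player `i` is chosen with probability `a i / ∑ a`, then an error with probability `E i / W i`;
  -- as `a i ≥ W i`, the product is at least `E i / ∑ a`. Since `∑ a` is at most twice the true
  -- total weight, an error of `1/8` becomes `1/16`.
  have hterm : ∀ i ∈ N, ENNReal.ofReal (E i / ∑ i ∈ N, (a i : ℝ)) ≤
      ENNReal.ofReal (nameProb N a i) * volume (Prod.mk i ⁻¹' s) := by
    intro i hi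
    rcases Nat.eq_zero_or_pos (W i) with h0 | hpos
    · have : E i = 0 := by have := hEW i; omega
      simp [this]
    · have hsum : (((S i).map fun z => (z, boostWeight hs z)).map Prod.snd).sum = W i := by
        simp [W, List.map_map, Function.comp_def]
      have hfil : (((((S i).map fun z => (z, boostWeight hs z))).filter
          fun z => h z.1.1 ≠ z.1.2).map Prod.snd).sum = E i := by
        simp [E, List.filter_map, List.map_map, Function.comp_def]
      have hv := volume_weightedPick ((S i).map fun z => (z, boostWeight hs z))
        (fun z => h z.1 ≠ z.2) (by rw [hsum]; exact hpos)
      rw [hs_eq, hv, hsum, hfil, ← ENNReal.ofReal_mul]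
      · refine ENNReal.ofReal_le_ofReal ?_
        simp only [nameProb, if_pos hi]
        have hWi : (0 : ℝ) < W i := by exact_mod_cast hpos
        have haW : (W i : ℝ) ≤ a i := by exact_mod_cast (hab i).1
        rw [div_mul_div_comm, div_le_div_iff₀ hApos (mul_pos hApos hWi)]
        have : (E i : ℝ) * (W i) ≤ a i * E i := by
          rw [mul_comm]; exact mul_le_mul_of_nonneg_right haW (Nat.cast_nonneg _)
        calc (E i : ℝ) * ((∑ i ∈ N, (a i : ℝ)) * W i) = (E i * W i) * ∑ i ∈ N, (a i : ℝ) := by ring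
          _ ≤ _ := mul_le_mul_of_nonneg_right this hApos.le
      · exact nameProb_nonneg _ _ _
  calc ENNReal.ofReal (1 / 16) ≤ ENNReal.ofReal (∑ i ∈ N, (E i : ℝ) / ∑ i ∈ N, (a i : ℝ)) := by
        refine ENNReal.ofReal_le_ofReal ?_
        rw [← Finset.sum_div, le_div_iff₀ hApos]
        have h1 : (∑ i ∈ N, (a i : ℝ)) ≤ 2 * totalWeight N S hs := by exact_mod_cast hA2
        have h2 : (totalWeight N S hs : ℝ) ≤ 8 * ∑ i ∈ N, (E i : ℝ) := by exact_mod_cast hE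
        linarith
    _ = ∑ i ∈ N, ENNReal.ofReal (E i / ∑ i ∈ N, (a i : ℝ)) :=
        ENNReal.ofReal_sum_of_nonneg fun i _ => by positivity
    _ ≤ ∑ i ∈ N, ENNReal.ofReal (nameProb N a i) * volume (Prod.mk i ⁻¹' s) :=
        Finset.sum_le_sum hterm
    _ ≤ _ := Finset.sum_le_sum_of_subset (Finset.subset_univ _)

variable [MeasurableSpace X] {H : Set (X → Bool)} {d : ℕ} {A : List (X × Bool) → X → Bool}

/-- A weak hypothesis rarely errs on an eighth of the boosting weight. -/
theorem law_weak_error_le (hA : IsConsistentLearner H A) (hH : HasVCDim H d)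
    {hstar : X → Bool} (hstar_mem : hstar ∈ H) (D : Fin k → Measure X)
    [∀ i, IsProbabilityMeasure (D i)] (n j t : ℕ) {N : Finset (Fin k)} (hN : N.Nonempty)
    {S : Fin k → List (X × Bool)} (hS : ∀ i, ∀ z ∈ S i, z.2 = hstar z.1)
    (hs : List (X → Bool)) :
    law D {y | 0 < totalWeight N S hs ∧
        totalWeight N S hs ≤ 8 * errorWeight N S hs (boostRound A n j N S y t hs).1} ≤
      ENNReal.ofReal (2 * (640 ^ d * Real.exp (n / 320)) * Real.exp (-(n / 160))) := by
  by_cases hW : 0 < totalWeight N S hs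
  swap
  · simp [hW]
  obtain ⟨i₀, hi₀⟩ := id hN
  have : Nonempty X := by
    exact nonempty_of_isProbabilityMeasure (D i₀)
  set a : Fin k → ℕ := fun i => approxWeight (report hs (S i)) with ha
  have hapos : 0 < ∑ i ∈ N, a i :=
    hW.trans_le (Finset.sum_le_sum fun i _ => (approxWeight_bounds _).1)
  set L : Fin k → List ((X × Bool) × ℕ) := fun i => (S i).map fun z => (z, boostWeight hs z) with hL
  let G : (Fin n → Fin k × unitInterval) → Fin k × unitInterval → Bool := fun z q =>
    (weightedPick (L q.1) q.2).elim false fun w => decide (A (pickedExamples N L z) w.1 ≠ w.2)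
  have hreal : ∀ z : Fin n → Fin k × unitInterval,
      ∃ h ∈ H, ∀ w ∈ pickedExamples N L z, h w.1 = w.2 := by
    refine fun z => ⟨hstar, hstar_mem, fun w hw => ?_⟩
    obtain ⟨i, hi⟩ := exists_of_mem_pickedExamples hw
    have : w ∈ S i := by simpa [hL, List.map_map, Function.comp_def] using hi
    exact (hS i w this).symm
  have hpicked : Measurable fun z : Fin n → Fin k × unitInterval => pickedExamples N L z := by
    refine Measurable.listFlatMap_const _ fun i _ => ?_
    have h1 : ∀ z : Fin n → Fin k × unitInterval,
        ((grouped z i).filterMap fun u : unitInterval => weightedPick (L i) u) =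
        (List.finRange n).flatMap fun l => if (z l).1 = i then
          (weightedPick (L i) (z l).2).elim [] fun w => [w] else [] := by
      intro z
      unfold grouped
      induction List.finRange n with
      | nil => simp
      | cons l M ih =>
        rw [List.filter_cons, List.flatMap_cons, ← ih]
        by_cases hl : (z l).1 = i
        · simp only [hl, decide_true, if_true, List.map_cons, List.filterMap_cons]
          cases weightedPick (L i) (z l).2 <;> simp
        · simp [hl]
    simp only [h1]
    refine Measurable.listFlatMap_const _ fun l _ => ?_
    have hz : Measurable fun z : Fin n → Fin k × unitInterval => z l := measurable_pi_apply l
    refine Measurable.ite (hz.fst (measurableSet_singleton i)) ?_ measurable_const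
    exact Measurable.weightedPick_elim measurable_const (measurable_subtype_coe.comp hz.snd)
      (f := fun p : (Fin n → Fin k × unitInterval) × (X × Bool) => [p.2])
      (Measurable.listCons measurable_snd measurable_const) measurable_const
  have hGm : Measurable fun p : (Fin n → Fin k × unitInterval) × (Fin k × unitInterval) =>
      G p.1 p.2 := by
    have hLm : Measurable L := Measurable.of_discrete
    refine Measurable.weightedPick_elim
      (L := fun p : (Fin n → Fin k × unitInterval) × (Fin k × unitInterval) => L p.2.1)
      (v := fun p => (p.2.2 : ℝ))
      (f := fun q : ((Fin n → Fin k × unitInterval) × (Fin k × unitInterval)) × (X × Bool) =>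
        decide (A (pickedExamples N L q.1.1) q.2.1 ≠ q.2.2))
      (hLm.comp (by fun_prop)) (measurable_subtype_coe.comp (by fun_prop)) ?_ measurable_const
    have h1 : Measurable fun q : ((Fin n → Fin k × unitInterval) × (Fin k × unitInterval)) ×
        (X × Bool) => A (pickedExamples N L q.1.1) q.2.1 :=
      (measurable_learner hA).comp ((hpicked.comp (by fun_prop)).prodMk (by fun_prop))
    exact (Measurable.of_discrete (f := fun b : Bool × Bool => decide (b.1 ≠ b.2))).comp
      (h1.prodMk (by fun_prop : Measurable fun q : ((Fin n → Fin k × unitInterval) ×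
        (Fin k × unitInterval)) × (X × Bool) => q.2.2))
  set ν := mixtureLaw (fun i => ENNReal.ofReal (nameProb N a i))
    (fun _ : Fin k => (volume : Measure unitInterval)) with hν
  have hprob : IsProbabilityMeasure ν := isProbabilityMeasure_mixtureLaw _ (sum_nameProb hapos)
  have hpat : ∀ w : Fin n → (Fin k × unitInterval) × (Fin k × unitInterval),
      ∃ P : Finset (Fin n → Bool × Bool), (∀ z, (fun l => (G z (w l).1, G z (w l).2)) ∈ P) ∧
        (P.card : ℝ) ≤ 640 ^ d * Real.exp (n / 320) := by
    intro w
    obtain ⟨P, hP, hc⟩ := exists_pair_patterns w (𝒢 := Set.range G)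
      (Γ := 640 ^ d * Real.exp (n / 320)) (by
        intro v
        -- With `r = 1/640` the double sample of `2 n` points contributes `exp (n / 320)`, half of
        -- the available exponent `p₀ n / 10 = n / 160` for `p₀ = 1/16`.
        obtain ⟨P, hP, hc⟩ := exists_error_patterns hH
          (fun s => weightedPick (L (v s).1) (v s).2) (r := 1 / 640) (by norm_num) (by norm_num)
        refine ⟨P, ?_, ?_⟩
        · rintro g ⟨z, rfl⟩
          exact hP _ (hA.mem _ (hreal z))
        · refine hc.trans (le_of_eq ?_)
          rw [Fintype.card_prod, Fintype.card_fin, Fintype.card_bool]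
          push_cast
          congr 1
          · norm_num
          · congr 1; ring)
    exact ⟨P, fun z => hP _ ⟨z, rfl⟩, hc⟩
  have hmain := relative_deviation ν hGm hpat (p₀ := 1 / 16) (by norm_num)
  refine le_trans ?_ (hmain.trans (ENNReal.ofReal_le_ofReal (le_of_eq ?_)))
  swap
  · congr 3; ring
  rw [hν, ← law_map_pickSample D i₀ hN n j t hapos]
  refine le_trans (measure_mono ?_) (Measure.le_map_apply
    (measurable_pickSample i₀ hN n j t a).aemeasurable _)
  intro y hy
  have hE := hy.2
  rw [boostRound_fst, sentExamples_eq i₀ hN] at hE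
  set z := pickSample i₀ n j t N a y with hz
  refine ⟨?_, ?_⟩
  · rw [← hν, measureReal_def, ← ENNReal.ofReal_le_iff_le_toReal (measure_ne_top _ _)]
    refine le_mixtureLaw_errors S hs _ hW hE ?_ ?_
    · exact hGm.comp (measurable_prodMk_left (x := z)) (measurableSet_singleton true)
    · intro i
      ext u
      change (weightedPick (L i) u).elim false
        (fun w => decide (A (pickedExamples N L z) w.1 ≠ w.2)) = true ↔
        ∃ w, weightedPick (L i) u = some w ∧ A (pickedExamples N L z) w.1 ≠ w.2
      cases weightedPick (L i) u with
      | none => simp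
      | some w => simp only [Option.elim, decide_eq_true_eq, Option.some.injEq, exists_eq_left']
  · have h0 : hits (G z) z = 0 := by
      unfold hits
      rw [Finset.card_eq_zero, Finset.filter_eq_empty_iff]
      intro l _
      have hzN : (z l).1 ∈ N := pickName_mem i₀ hN a _
      simp only [G]
      cases hw : weightedPick (L (z l).1) (z l).2 with
      | none => simp
      | some w =>
        have := hA.consistent _ (hreal z) w (mem_pickedExamples hzN hw)
        simp [this]
    change ((hits (G z) z : ℕ) : ℝ) ≤ _
    rw [h0]
    simp only [Nat.cast_zero]
    positivity

end WeakLearner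

/-! ### The weight potential of AdaBoost -/

section Boosting

variable {X : Type u} {k : ℕ} {H : Set (X → Bool)} {A : List (X × Bool) → X → Bool}

theorem sentExamples_mem {n j t : ℕ} {N : Finset (Fin k)} {S : Fin k → List (X × Bool)}
    {ω : Randomness X k} {hs : List (X → Bool)} {z : X × Bool}
    (hz : z ∈ sentExamples n j N S ω t hs) : ∃ i, z ∈ S i := by
  unfold sentExamples at hz
  rw [List.mem_flatMap] at hz
  obtain ⟨i, -, hi⟩ := hz
  obtain ⟨r, -, hr⟩ := List.mem_filterMap.1 hi
  exact ⟨i, by simpa [Function.comp_def] using weightedPick_mem hr⟩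

theorem length_boost (A : List (X × Bool) → X → Bool) (n j : ℕ) (N : Finset (Fin k))
    (S : Fin k → List (X × Bool)) (ω : Randomness X k) (T : ℕ) :
    (boost A n j N S ω T).1.length = T := by
  induction T with
  | zero => rfl
  | succ T ih => simp [boost, ih]

theorem boost_mem [MeasurableSpace X] (hA : IsConsistentLearner H A) {hstar : X → Bool}
    (hstar_mem : hstar ∈ H) (n j : ℕ) (N : Finset (Fin k)) {S : Fin k → List (X × Bool)}
    (hS : ∀ i, ∀ z ∈ S i, z.2 = hstar z.1) (ω : Randomness X k) (T : ℕ) :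
    ∀ h ∈ (boost A n j N S ω T).1, h ∈ H := by
  induction T with
  | zero => simp [boost]
  | succ T ih =>
    simp only [boost, List.mem_cons, boostRound_fst]
    rintro h (rfl | hh)
    · refine hA.mem _ ⟨hstar, hstar_mem, fun z hz => ?_⟩
      obtain ⟨i, hi⟩ := sentExamples_mem hz
      exact (hS i z hi).symm
    · exact ih h hh

theorem sentExamples_congr {n j t : ℕ} {N : Finset (Fin k)} {S : Fin k → List (X × Bool)}
    {ω ω' : Randomness X k} {hs : List (X → Bool)}
    (h1 : ∀ l, ω.2 (.request j t l) = ω'.2 (.request j t l))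
    (h2 : ∀ i r, ω.2 (.pick j t i r) = ω'.2 (.pick j t i r)) :
    sentExamples n j N S ω t hs = sentExamples n j N S ω' t hs := by
  simp only [sentExamples, h1, h2]

/-- Names the coins that the first `T` rounds read, so that resampling any others leaves their
hypotheses unchanged. -/
theorem boost_congr {n j : ℕ} {N : Finset (Fin k)} {S : Fin k → List (X × Bool)}
    {ω ω' : Randomness X k} {T : ℕ}
    (h1 : ∀ t < T, ∀ l, ω.2 (.request j t l) = ω'.2 (.request j t l))
    (h2 : ∀ t < T, ∀ i r, ω.2 (.pick j t i r) = ω'.2 (.pick j t i r)) :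
    (boost A n j N S ω T).1 = (boost A n j N S ω' T).1 := by
  induction T with
  | zero => rfl
  | succ T ih =>
    simp only [boost, boostRound_fst]
    rw [ih (fun t ht => h1 t (by omega)) (fun t ht => h2 t (by omega)),
      sentExamples_congr (h1 T (by omega)) (h2 T (by omega))]

theorem reservoir_congr {hstar : X → Bool} {m j : ℕ} {N : Finset (Fin k)} {ω ω' : Randomness X k}
    (h1 : ∀ l, ω.2 (.slot j l) = ω'.2 (.slot j l))
    (h2 : ∀ i r, ω.1 (.reservoir j i r) = ω'.1 (.reservoir j i r)) :
    reservoir hstar m j N ω = reservoir hstar m j N ω' := by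
  ext1 i
  simp only [reservoir, mixtureSizes, h1, h2]

theorem reservoir_label {hstar : X → Bool} {m j : ℕ} {N : Finset (Fin k)} {ω : Randomness X k}
    (i : Fin k) : ∀ z ∈ reservoir hstar m j N ω i, z.2 = hstar z.1 := by
  intro z hz
  obtain ⟨r, -, rfl⟩ := List.mem_map.1 hz
  rfl

theorem boostWeight_cons (h : X → Bool) (hs : List (X → Bool)) (z : X × Bool) :
    boostWeight (h :: hs) z = boostWeight hs z + if h z.1 ≠ z.2 then boostWeight hs z else 0 := by
  unfold boostWeight
  by_cases hz : h z.1 = z.2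
  · simp [hz]
  · simp [hz, pow_succ]; ring

theorem sum_map_filter {α : Type*} (L : List α) (P : α → Prop) [DecidablePred P] (f : α → ℕ) :
    ((L.filter P).map f).sum = (L.map fun z => if P z then f z else 0).sum := by
  induction L with
  | nil => simp
  | cons a L ih => by_cases h : P a <;> simp [h, ih]

theorem countP_eq_sum_map {α : Type*} (L : List α) (P : α → Bool) :
    L.countP P = (L.map fun z => if P z then 1 else 0).sum := by
  induction L with
  | nil => simp
  | cons a L ih => by_cases h : P a <;> simp [h, ih, add_comm]

theorem totalWeight_cons (N : Finset (Fin k)) (S : Fin k → List (X × Bool)) (hs : List (X → Bool))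
    (h : X → Bool) : totalWeight N S (h :: hs) = totalWeight N S hs + errorWeight N S hs h := by
  unfold totalWeight errorWeight
  rw [← Finset.sum_add_distrib]
  refine Finset.sum_congr rfl fun i _ => ?_
  rw [sum_map_filter, ← List.sum_map_add, ← funext fun z => boostWeight_cons h hs z]

/-- Number of errors of `h` on the reservoirs. -/
def misclassified (N : Finset (Fin k)) (S : Fin k → List (X × Bool)) (h : X → Bool) : ℕ :=
  ∑ i ∈ N, (S i).countP fun z => h z.1 ≠ z.2

/-- A wrong majority needs at least `⌈T/2⌉` wrong votes. Ties go to `false`, so a wrong `true` has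
strictly more than half of the votes against the label and a wrong `false` at least half. -/
theorem pow_le_boostWeight {hs : List (X → Bool)} {z : X × Bool} (h : majority hs z.1 ≠ z.2) :
    2 ^ ((hs.length + 1) / 2) ≤ boostWeight hs z := by
  unfold boostWeight
  refine Nat.pow_le_pow_right (by norm_num) ?_
  have hsum := List.length_eq_countP_add_countP (fun h : X → Bool => h z.1) (l := hs)
  unfold majority at h
  obtain ⟨x, b⟩ := z
  cases b
  · have : (hs.countP fun h => decide (h x ≠ false)) = hs.countP fun h => h x := by
      congr 1; ext h; simp
    simp only [this]
    simp at h
    omega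
  · have : (hs.countP fun h => decide (h x ≠ true)) = hs.countP fun h => decide ¬(h x = true) := by
      congr 1
    simp only [this]
    simp at h hsum ⊢
    omega

/-- The total weight is a potential: it bounds the errors of the final vote, each of which carries
weight at least `2^⌈T/2⌉`. -/
theorem misclassified_mul_le (N : Finset (Fin k)) (S : Fin k → List (X × Bool))
    (hs : List (X → Bool)) :
    misclassified N S (majority hs) * 2 ^ ((hs.length + 1) / 2) ≤ totalWeight N S hs := by
  unfold misclassified totalWeight
  rw [Finset.sum_mul]
  refine Finset.sum_le_sum fun i _ => ?_
  induction S i with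
  | nil => simp
  | cons z L ih =>
    rw [List.countP_cons, List.map_cons, List.sum_cons, add_mul, add_comm]
    refine add_le_add ?_ ih
    split_ifs with h
    · simpa using pow_le_boostWeight (by simpa using h)
    · simp

/-- If all weak hypotheses err on less than an eighth of the weight, the total weight grows
slowly. -/
theorem totalWeight_boost_le (n j : ℕ) (N : Finset (Fin k)) (S : Fin k → List (X × Bool))
    (ω : Randomness X k) (T : ℕ)
    (h : ∀ t < T, ¬ (0 < totalWeight N S (boost A n j N S ω t).1 ∧
      totalWeight N S (boost A n j N S ω t).1 ≤ 8 * errorWeight N S (boost A n j N S ω t).1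
        (boostRound A n j N S ω t (boost A n j N S ω t).1).1)) :
    8 ^ T * totalWeight N S (boost A n j N S ω T).1 ≤ 9 ^ T * totalWeight N S [] := by
  induction T with
  | zero => simp [boost]
  | succ T ih =>
    have h1 := ih fun t ht => h t (by omega)
    have h2 := h T (by omega)
    have hle : errorWeight N S (boost A n j N S ω T).1
        (boostRound A n j N S ω T (boost A n j N S ω T).1).1 ≤
        totalWeight N S (boost A n j N S ω T).1 :=
      Finset.sum_le_sum fun i _ => sum_map_filter_le _ _ _
    have h3 : (boost A n j N S ω (T + 1)).1 =
      (boostRound A n j N S ω T (boost A n j N S ω T).1).1 :: (boost A n j N S ω T).1 := rfl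
    rw [h3, totalWeight_cons, pow_succ, pow_succ]
    set W := totalWeight N S (boost A n j N S ω T).1
    set E := errorWeight N S (boost A n j N S ω T).1
        (boostRound A n j N S ω T (boost A n j N S ω T).1).1
    -- Erring doubles the weight, so a round adds `E < W / 8`; if `W = 0`, then `E ≤ W` vanishes as
    -- well.
    have h4 : 8 * (W + E) ≤ 9 * W := by
      by_cases hW : 0 < W
      · have : ¬ W ≤ 8 * E := fun h => h2 ⟨hW, h⟩
        omega
      · omega
    calc 8 ^ T * 8 * (W + E) = 8 ^ T * (8 * (W + E)) := by ring
      _ ≤ 8 ^ T * (9 * W) := Nat.mul_le_mul_left _ h4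
      _ = 9 * (8 ^ T * W) := by ring
      _ ≤ 9 * (9 ^ T * totalWeight N S []) := Nat.mul_le_mul_left _ h1
      _ = _ := by ring

theorem totalWeight_nil_reservoir (hstar : X → Bool) (m j : ℕ) {N : Finset (Fin k)}
    (hN : N.Nonempty) (ω : Randomness X k) :
    totalWeight N (reservoir hstar m j N ω) [] = m := by
  obtain ⟨i₀, hi₀⟩ := id hN
  have h1 := countP_grouped (N := N) (z := resSample i₀ m j N ω) (fun l => pickName_mem i₀ hN _ _)
    (fun _ => true)
  have h2 : hits (fun _ : Fin k × X => true) (resSample i₀ m j N ω) = m := by simp [hits]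
  rw [sum_players, h2] at h1
  refine Eq.trans ?_ h1
  refine Finset.sum_congr rfl fun i _ => ?_
  rw [reservoir_eq i₀ hN]
  simp [boostWeight, Function.comp_def]

/-- The growth bound and the potential give `M 2^(T/2) ≤ (9/8)^T m`. The target `ε / 4 * m / 8` is
the number of hits allowed by `relative_deviation` for `p₀ = ε / 4`. -/
theorem misclassified_boost_le {ε : ℝ} (hε : 0 < ε) (hε1 : ε < 1) (hstar : X → Bool)
    (m n j T : ℕ) (hT : 30 * Real.log (2 / ε) ≤ T) {N : Finset (Fin k)}
    (hN : N.Nonempty) (ω : Randomness X k)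
    (h : let S := reservoir hstar m j N ω
      ∀ t < T, ¬ (0 < totalWeight N S (boost A n j N S ω t).1 ∧
      totalWeight N S (boost A n j N S ω t).1 ≤ 8 * errorWeight N S (boost A n j N S ω t).1
        (boostRound A n j N S ω t (boost A n j N S ω t).1).1)) :
    (misclassified N (reservoir hstar m j N ω)
      (majority (boost A n j N (reservoir hstar m j N ω) ω T).1) : ℝ) ≤ ε / 4 * m / 8 := by
  set S := reservoir hstar m j N ω
  have h1 := totalWeight_boost_le n j N S ω T h
  rw [totalWeight_nil_reservoir hstar m j hN ω] at h1
  have h2 := misclassified_mul_le N S (boost A n j N S ω T).1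
  rw [length_boost] at h2
  set M := misclassified N S (majority (boost A n j N S ω T).1)
  set W := totalWeight N S (boost A n j N S ω T).1
  have h3 : 8 ^ T * (M * 2 ^ ((T + 1) / 2)) ≤ 9 ^ T * m := (Nat.mul_le_mul_left _ h2).trans h1
  have h4 : (8 ^ T * (M * 2 ^ ((T + 1) / 2))) ^ 2 ≤ (9 ^ T * m) ^ 2 := Nat.pow_le_pow_left h3 2
  have h5 : 128 ^ T * M ^ 2 ≤ 81 ^ T * m ^ 2 := by
    have e1 : (8 ^ T * (M * 2 ^ ((T + 1) / 2))) ^ 2 = 64 ^ T * M ^ 2 * 2 ^ ((T + 1) / 2 * 2) := by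
      rw [mul_pow, mul_pow, ← pow_mul, ← pow_mul, mul_comm T 2, pow_mul]; norm_num; ring
    have e2 : (9 ^ T * m) ^ 2 = 81 ^ T * m ^ 2 := by
      rw [mul_pow, ← pow_mul, mul_comm T 2, pow_mul]; norm_num
    have e3 : 2 ^ T ≤ 2 ^ ((T + 1) / 2 * 2) := Nat.pow_le_pow_right (by norm_num) (by omega)
    have e4 : (128 : ℕ) ^ T = 64 ^ T * 2 ^ T := by rw [← mul_pow]; norm_num
    rw [e1, e2] at h4
    calc 128 ^ T * M ^ 2 = 64 ^ T * M ^ 2 * 2 ^ T := by rw [e4]; ring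
      _ ≤ _ := Nat.mul_le_mul_left _ e3
      _ ≤ _ := h4
  have h6 : (128 : ℝ) ^ T * (M : ℝ) ^ 2 ≤ 81 ^ T * (m : ℝ) ^ 2 := by exact_mod_cast h5
  have h7 : (81 : ℝ) ^ T ≤ 128 ^ T * Real.exp (-(10 * Real.log (2 / ε))) := by
    have e1 : (81 / 128 : ℝ) ^ T ≤ Real.exp (-(T / 3)) := by
      have : (81 / 128 : ℝ) ≤ Real.exp (-(1 / 3)) := by
        linarith [Real.add_one_le_exp (-(1 / 3) : ℝ)]
      calc (81 / 128 : ℝ) ^ T ≤ Real.exp (-(1 / 3)) ^ T := pow_le_pow_left₀ (by norm_num) this T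
        _ = _ := by rw [← Real.exp_nat_mul]; congr 1; ring
    have e2 : Real.exp (-(T / 3)) ≤ Real.exp (-(10 * Real.log (2 / ε))) :=
      Real.exp_le_exp.2 (by linarith)
    have e3 := e1.trans e2
    rw [div_pow, div_le_iff₀ (by positivity)] at e3
    linarith
  have h8 : Real.exp (-(10 * Real.log (2 / ε))) ≤ (ε / 32) ^ 2 := by
    have e1 : Real.exp (-(10 * Real.log (2 / ε))) = (ε / 2) ^ 10 := by
      have e0 : Real.log (2 / ε) = -Real.log (ε / 2) := by rw [← Real.log_inv, inv_div]
      rw [show -(10 * Real.log (2 / ε)) = ((10 : ℕ) : ℝ) * Real.log (ε / 2) by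
        rw [e0]; push_cast; ring, Real.exp_nat_mul, Real.exp_log (by positivity)]
    rw [e1]
    have e2 : (ε / 2) ^ 8 ≤ (1 / 2) ^ 8 := pow_le_pow_left₀ (by positivity) (by linarith) 8
    calc (ε / 2) ^ 10 = (ε / 2) ^ 2 * (ε / 2) ^ 8 := by ring
      _ ≤ (ε / 2) ^ 2 * (1 / 2) ^ 8 := mul_le_mul_of_nonneg_left e2 (by positivity)
      _ = _ := by ring
  have h9 : (M : ℝ) ^ 2 ≤ (ε / 32 * m) ^ 2 := by
    have e0 : (0 : ℝ) < 128 ^ T := by positivity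
    have e1 : (128 : ℝ) ^ T * (M : ℝ) ^ 2 ≤ 128 ^ T * ((ε / 32 * m) ^ 2) := by
      calc _ ≤ 81 ^ T * (m : ℝ) ^ 2 := h6
        _ ≤ 128 ^ T * Real.exp (-(10 * Real.log (2 / ε))) * (m : ℝ) ^ 2 :=
          mul_le_mul_of_nonneg_right h7 (by positivity)
        _ ≤ 128 ^ T * (ε / 32) ^ 2 * (m : ℝ) ^ 2 := by gcongr
        _ = _ := by ring
    exact le_of_mul_le_mul_left e1 e0
  have h10 := (abs_le.1 (abs_le_of_sq_le_sq h9 (by positivity))).2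
  linarith

end Boosting

/-! ### Measurability of weights and errors -/

section BoostingMeasurability

variable {X : Type u} [MeasurableSpace X] {k : ℕ} {Ω : Type*} [MeasurableSpace Ω]

theorem measurable_totalWeight (N : Finset (Fin k)) {S : Ω → Fin k → List (X × Bool)}
    (hS : ∀ i, Measurable fun x => S x i) {hs : Ω → List (X → Bool)} (h : MeasurableHyps hs) :
    Measurable fun x => totalWeight N (S x) (hs x) :=
  Finset.measurable_sum _ fun i _ => ((hS i).listMap h.boostWeight).listSum

theorem measurable_ne {h : Ω → X → Bool} (hh : Measurable fun p : Ω × X => h p.1 p.2) :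
    MeasurableSet {p : Ω × (X × Bool) | h p.1 p.2.1 ≠ p.2.2} :=
  (measurableSet_eq_fun (hh.comp (f := fun p : Ω × (X × Bool) => (p.1, p.2.1)) (by fun_prop))
    measurable_snd.snd).compl

theorem measurable_errorWeight (N : Finset (Fin k)) {S : Ω → Fin k → List (X × Bool)}
    (hS : ∀ i, Measurable fun x => S x i) {hs : Ω → List (X → Bool)} (h : MeasurableHyps hs)
    {g : Ω → X → Bool} (hg : Measurable fun p : Ω × X => g p.1 p.2) :
    Measurable fun x => errorWeight N (S x) (hs x) (g x) := by
  unfold errorWeight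
  simp only [sum_map_filter]
  exact Finset.measurable_sum _ fun i _ => ((hS i).listMap
    (Measurable.ite (measurable_ne hg) h.boostWeight measurable_const)).listSum

theorem measurable_misclassified (N : Finset (Fin k)) {S : Ω → Fin k → List (X × Bool)}
    (hS : ∀ i, Measurable fun x => S x i) {g : Ω → X → Bool}
    (hg : Measurable fun p : Ω × X => g p.1 p.2) :
    Measurable fun x => misclassified N (S x) (g x) := by
  unfold misclassified
  simp only [countP_eq_sum_map, decide_eq_true_eq]
  exact Finset.measurable_sum _ fun i _ => ((hS i).listMap
    (Measurable.ite (measurable_ne hg) measurable_const measurable_const)).listSum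

theorem measurable_err (D : Measure X) [IsProbabilityMeasure D] {hstar : X → Bool}
    (hstar_meas : Measurable hstar) {g : Ω → X → Bool}
    (hg : Measurable fun p : Ω × X => g p.1 p.2) : Measurable fun x => err D hstar (g x) := by
  have hs : MeasurableSet {p : Ω × X | g p.1 p.2 ≠ hstar p.2} :=
    (measurableSet_eq_fun hg (hstar_meas.comp measurable_snd)).compl
  exact (measurable_measure_prodMk_left (ν := D) hs).ennreal_toReal

theorem measurable_grouped {V : Type*} [MeasurableSpace V] {m : ℕ} (i : Fin k) :
    Measurable fun z : Fin m → Fin k × V => grouped z i := by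
  have h1 : ∀ z : Fin m → Fin k × V, grouped z i =
      (List.finRange m).flatMap fun l => if (z l).1 = i then [(z l).2] else [] := by
    intro z
    unfold grouped
    induction List.finRange m with
    | nil => simp
    | cons l M ih =>
      rw [List.filter_cons, List.flatMap_cons, ← ih]
      by_cases hl : (z l).1 = i <;> simp [hl]
  simp only [h1]
  refine Measurable.listFlatMap_const _ fun l _ => ?_
  have hz : Measurable fun z : Fin m → Fin k × V => z l := measurable_pi_apply l
  exact Measurable.ite (hz.fst (measurableSet_singleton i))
    (Measurable.listCons hz.snd measurable_const) measurable_const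

end BoostingMeasurability

/-! ### Distributed Boosting learns the mixture -/

section FirstStep

variable {X : Type u} {k : ℕ}

open Classical in
theorem splice_fst (J : Set (Draw k)) (K : Set (Coin k)) (x y : Randomness X k) (q : Draw k) :
    (splice J K x y).1 q = if q ∈ J then y.1 q else x.1 q := rfl

open Classical in
theorem splice_snd (J : Set (Draw k)) (K : Set (Coin k)) (x y : Randomness X k) (q : Coin k) :
    (splice J K x y).2 q = if q ∈ K then y.2 q else x.2 q := rfl

variable [MeasurableSpace X] {H : Set (X → Bool)} {d : ℕ} {A : List (X × Bool) → X → Bool}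

/-- Error on the uniform mixture of the players in `N`. -/
def mixtureErr (N : Finset (Fin k)) (D : Fin k → Measure X) (hstar h : X → Bool) : ℝ :=
  (∑ i ∈ N, err (D i) hstar h) / N.card

theorem mixtureLaw_real_eq {N : Finset (Fin k)} (D : Fin k → Measure X)
    [∀ i, IsProbabilityMeasure (D i)] {hstar h : X → Bool}
    {s : Set (Fin k × X)} (hs : MeasurableSet s)
    (hsec : ∀ i, Prod.mk i ⁻¹' s = {x | h x ≠ hstar x}) :
    (mixtureLaw (fun i => ENNReal.ofReal (nameProb N (fun _ => 1) i)) D).real s =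
      mixtureErr N D hstar h := by
  rw [measureReal_def, mixtureLaw_apply _ _ hs, ENNReal.toReal_sum fun i _ =>
    ENNReal.mul_ne_top ENNReal.ofReal_ne_top (measure_ne_top _ _)]
  simp only [ENNReal.toReal_mul, hsec, ENNReal.toReal_ofReal (nameProb_nonneg _ _ _)]
  simp only [nameProb, mixtureErr, err, measureReal_def, Nat.cast_one, Finset.sum_const, nsmul_eq_mul,
    mul_one, div_mul_eq_mul_div, ite_mul, one_mul, zero_mul]
  rw [← Finset.sum_div, Finset.sum_ite_mem, Finset.univ_inter]

/-- Majority votes that err on few examples of the reservoirs rarely have a large error. -/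
theorem law_unrepresentative_le (hA : IsConsistentLearner H A) (hH : HasVCDim H d)
    {hstar : X → Bool} (hstar_mem : hstar ∈ H) (hstar_meas : Measurable hstar)
    (D : Fin k → Measure X) [∀ i, IsProbabilityMeasure (D i)] (m n j T : ℕ) {N : Finset (Fin k)}
    (hN : N.Nonempty) (x : Randomness X k) {p₀ r : ℝ} (hp₀ : 0 < p₀) (hr : 0 < r) (hr1 : r ≤ 1) :
    law D {y | p₀ ≤ mixtureErr N D hstar
          (majority (boost A n j N (reservoir hstar m j N y) x T).1) ∧
        (misclassified N (reservoir hstar m j N y)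
          (majority (boost A n j N (reservoir hstar m j N y) x T).1) : ℝ) ≤ p₀ * m / 8} ≤
      ENNReal.ofReal (2 * ((1 / r) ^ d * Real.exp (r * (2 * m))) ^ T *
        Real.exp (-(p₀ * m / 10))) := by
  obtain ⟨i₀, hi₀⟩ := id hN
  let S : (Fin m → Fin k × X) → Fin k → List (X × Bool) := fun z i =>
    (grouped z i).map fun x => (x, hstar x)
  -- The boosting coins are frozen at `x`, so the vote is a deterministic function of the reservoir
  -- sample.
  let V : (Fin m → Fin k × X) → X → Bool := fun z => majority (boost A n j N (S z) x T).1
  let G : (Fin m → Fin k × X) → Fin k × X → Bool := fun z q => decide (V z q.2 ≠ hstar q.2)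
  have hSm : ∀ i, Measurable fun z => S z i := fun i =>
    (measurable_grouped i).listMap (f := fun _ x => (x, hstar x))
      (measurable_snd.prodMk (hstar_meas.comp measurable_snd))
  have hSl : ∀ z i, ∀ w ∈ S z i, w.2 = hstar w.1 := by
    intro z i w hw
    obtain ⟨v, -, rfl⟩ := List.mem_map.1 hw
    rfl
  have hVm : Measurable fun p : (Fin m → Fin k × X) × X => V p.1 p.2 :=
    (measurable_boost hA n j N hSm (ω := fun _ => x) measurable_const T).majority
  have hGm : Measurable fun p : (Fin m → Fin k × X) × (Fin k × X) => G p.1 p.2 := by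
    have h1 := hVm.comp (f := fun p : (Fin m → Fin k × X) × (Fin k × X) => (p.1, p.2.2))
      (by fun_prop)
    have h2 : Measurable fun p : (Fin m → Fin k × X) × (Fin k × X) => hstar p.2.2 :=
      hstar_meas.comp (by fun_prop)
    exact (Measurable.of_discrete (f := fun b : Bool × Bool => decide (b.1 ≠ b.2))).comp
      (h1.prodMk h2)
  set ν := mixtureLaw (fun i => ENNReal.ofReal (nameProb N (fun _ => 1) i)) D with hν
  have hprob : IsProbabilityMeasure ν :=
    isProbabilityMeasure_mixtureLaw _ (sum_nameProb (by simpa using hN))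
  have hpat : ∀ w : Fin m → (Fin k × X) × (Fin k × X),
      ∃ P : Finset (Fin m → Bool × Bool), (∀ z, (fun l => (G z (w l).1, G z (w l).2)) ∈ P) ∧
        (P.card : ℝ) ≤ ((1 / r) ^ d * Real.exp (r * (2 * m))) ^ T := by
    intro w
    obtain ⟨P, hP, hc⟩ := exists_pair_patterns w (𝒢 := Set.range G)
      (Γ := ((1 / r) ^ d * Real.exp (r * (2 * m))) ^ T) (by
        intro v
        obtain ⟨P, hP, hc⟩ := exists_majority_patterns hH (fun s => (v s).2) hstar T hr hr1
        refine ⟨P, ?_, ?_⟩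
        · rintro g ⟨z, rfl⟩
          exact hP _ (length_boost _ _ _ _ _ _ _) (boost_mem hA hstar_mem n j N (hSl z) x T)
        · refine hc.trans (le_of_eq ?_)
          rw [Fintype.card_prod, Fintype.card_fin, Fintype.card_bool]
          push_cast
          rw [mul_comm (m : ℝ) 2])
    exact ⟨P, fun z => hP _ ⟨z, rfl⟩, hc⟩
  have hmain := relative_deviation ν hGm hpat hp₀
  refine le_trans ?_ hmain
  rw [hν, ← law_map_resSample D i₀ hN m j]
  refine le_trans (measure_mono ?_) (Measure.le_map_apply
    (measurable_resSample i₀ hN m j).aemeasurable _)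
  intro y hy
  set z := resSample i₀ m j N y with hz
  have hres : reservoir hstar m j N y = S z := funext fun i => reservoir_eq i₀ hN hstar m j y i
  simp only [Set.mem_ofPred_eq, hres] at hy
  refine ⟨?_, ?_⟩
  · rw [← hν, mixtureLaw_real_eq D (hstar := hstar) (h := V z)]
    · exact hy.1
    · exact hGm.comp (measurable_prodMk_left (x := z)) (measurableSet_singleton true)
    · intro i
      ext v
      simp [G, z]
  · refine le_trans (le_of_eq ?_) hy.2
    norm_cast
    rw [← countP_grouped (N := N) (z := z) (fun l => pickName_mem i₀ hN _ _)
      (fun v => decide (V z v ≠ hstar v)), sum_players]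
    refine Finset.sum_congr rfl fun i _ => ?_
    simp only [S, List.countP_map]
    rfl

/-- The hypothesis computed by Distributed Boosting is measurable. -/
theorem measurable_boostStep (hA : IsConsistentLearner H A) {hstar : X → Bool}
    (hstar_meas : Measurable hstar) (m T n j : ℕ) (N : Finset (Fin k)) :
    Measurable fun p : Randomness X k × X => (boostStep A hstar m T n p.1 j N).1 p.2 :=
  (measurable_boost hA n j N (S := fun ω => reservoir hstar m j N ω)
    (fun i => measurable_reservoir hstar_meas m j N i) (ω := fun ω => ω) measurable_id T).majority

theorem measurable_mixtureErr {Ω : Type*} [MeasurableSpace Ω] (N : Finset (Fin k))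
    (D : Fin k → Measure X) [∀ i, IsProbabilityMeasure (D i)] {hstar : X → Bool}
    (hstar_meas : Measurable hstar) {g : Ω → X → Bool}
    (hg : Measurable fun p : Ω × X => g p.1 p.2) :
    Measurable fun x => mixtureErr N D hstar (g x) :=
  (Finset.measurable_sum _ fun i _ => measurable_err (D i) hstar_meas hg).div_const _

/-- Distributed Boosting learns the mixture of the players' distributions. -/
theorem law_boostStep_le (hA : IsConsistentLearner H A) (hH : HasVCDim H d)
    {hstar : X → Bool} (hstar_mem : hstar ∈ H) (hstar_meas : Measurable hstar)
    (D : Fin k → Measure X) [∀ i, IsProbabilityMeasure (D i)] (m n j T : ℕ) {N : Finset (Fin k)}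
    (hN : N.Nonempty) {ε r : ℝ} (hε : 0 < ε) (hε1 : ε < 1) (hT : 30 * Real.log (2 / ε) ≤ T)
    (hr : 0 < r) (hr1 : r ≤ 1) :
    law D {ω | ε / 4 ≤ mixtureErr N D hstar (boostStep A hstar m T n ω j N).1} ≤
      T * ENNReal.ofReal (2 * (640 ^ d * Real.exp (n / 320)) * Real.exp (-(n / 160))) +
      ENNReal.ofReal (2 * ((1 / r) ^ d * Real.exp (r * (2 * m))) ^ T *
        Real.exp (-(ε / 4 * m / 10))) := by
  let S : Randomness X k → Fin k → List (X × Bool) := fun ω => reservoir hstar m j N ω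
  let hyps : Randomness X k → ℕ → List (X → Bool) := fun ω t => (boost A n j N (S ω) ω t).1
  let bad : ℕ → Set (Randomness X k) := fun t =>
    {ω | 0 < totalWeight N (S ω) (hyps ω t) ∧ totalWeight N (S ω) (hyps ω t) ≤
      8 * errorWeight N (S ω) (hyps ω t) (boostRound A n j N (S ω) ω t (hyps ω t)).1}
  let unrep : Set (Randomness X k) :=
    {ω | ε / 4 ≤ mixtureErr N D hstar (majority (hyps ω T)) ∧
      (misclassified N (S ω) (majority (hyps ω T)) : ℝ) ≤ ε / 4 * m / 8}
  have hSm : ∀ i, Measurable fun ω => S ω i := fun i => measurable_reservoir hstar_meas m j N i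
  have hhyps : ∀ t, MeasurableHyps fun ω => hyps ω t := fun t =>
    measurable_boost hA n j N hSm (ω := fun ω => ω) measurable_id t
  have hsub : {ω | ε / 4 ≤ mixtureErr N D hstar (boostStep A hstar m T n ω j N).1} ⊆
      (⋃ t ∈ Finset.range T, bad t) ∪ unrep := by
    intro ω hω
    by_cases h : ω ∈ ⋃ t ∈ Finset.range T, bad t
    · exact Or.inl h
    · refine Or.inr ⟨hω, ?_⟩
      refine misclassified_boost_le hε hε1 hstar m n j T hT hN ω ?_
      intro _ t ht hb
      exact h (Set.mem_biUnion (Finset.mem_coe.2 (Finset.mem_range.2 ht)) hb)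
  have hbad : ∀ t, law D (bad t) ≤
      ENNReal.ofReal (2 * (640 ^ d * Real.exp (n / 320)) * Real.exp (-(n / 160))) := by
    intro t
    have hround : Measurable fun p : Randomness X k × X =>
        (boostRound A n j N (S p.1) p.1 t (hyps p.1 t)).1 p.2 := by
      simp only [boostRound_fst]
      exact (measurable_learner hA).comp (((measurable_sentExamples n j N hSm (ω := fun ω => ω)
        measurable_id t (hhyps t)).comp measurable_fst).prodMk measurable_snd)
    have hm : MeasurableSet (bad t) := by
      have h1 := measurable_totalWeight N hSm (hhyps t)
      have h2 := measurable_errorWeight N hSm (hhyps t)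
        (g := fun ω => (boostRound A n j N (S ω) ω t (hyps ω t)).1) hround
      exact (measurableSet_lt measurable_const h1).inter
        (measurableSet_le h1 (h2.const_mul 8))
    -- Only the coins of boosting round `t` are fresh; the reservoirs and the earlier weak
    -- hypotheses, hence the weights, are fixed.
    let K : Set (Coin k) := {q | (∃ l, q = .request j t l) ∨ ∃ i r, q = .pick j t i r}
    refine law_le_of_splice D ∅ K hm fun x => ?_
    refine le_trans (measure_mono ?_)
      (law_weak_error_le hA hH hstar_mem D n j t hN (S := S x) (fun i => reservoir_label i) (hyps x t))
    intro y hy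
    have e1 : S (splice ∅ K x y) = S x := by
      refine reservoir_congr (fun l => ?_) fun i r => ?_
      · rw [splice_snd, if_neg (by simp [K])]
      · rw [splice_fst, if_neg (by simp)]
    have e2 : hyps (splice ∅ K x y) t = hyps x t := by
      simp only [hyps, e1]
      refine boost_congr (fun t' ht' l => ?_) fun t' ht' i r => ?_
      · rw [splice_snd, if_neg (by simp [K]; intro h; omega)]
      · rw [splice_snd, if_neg (by simp [K]; intro h; omega)]
    have e3 : sentExamples n j N (S x) (splice ∅ K x y) t (hyps x t) =
        sentExamples n j N (S x) y t (hyps x t) := by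
      refine sentExamples_congr (fun l => ?_) fun i r => ?_
      · rw [splice_snd, if_pos (by simp [K])]
      · rw [splice_snd, if_pos (by simp [K])]
    simp only [Set.mem_ofPred_eq, bad, e1, e2, boostRound_fst, e3] at hy ⊢
    exact hy
  have hunrep : law D unrep ≤ ENNReal.ofReal (2 * ((1 / r) ^ d * Real.exp (r * (2 * m))) ^ T *
        Real.exp (-(ε / 4 * m / 10))) := by
    have hm : MeasurableSet unrep := by
      have h1 := measurable_mixtureErr N D hstar_meas (g := fun ω => majority (hyps ω T))
        (hhyps T).majority
      have h2 := measurable_misclassified N hSm (g := fun ω => majority (hyps ω T))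
        (hhyps T).majority
      exact (measurableSet_le measurable_const h1).inter
        (measurableSet_le ((measurable_from_nat (f := fun n : ℕ => (n : ℝ))).comp h2)
          measurable_const)
    -- Now the reservoirs are fresh and all boosting coins are fixed, so that the final vote is a
    -- rule applied to the reservoirs.
    let J : Set (Draw k) := {q | ∃ i r, q = .reservoir j i r}
    let K : Set (Coin k) := {q | ∃ l, q = .slot j l}
    refine law_le_of_splice D J K hm fun x => ?_
    refine le_trans (measure_mono ?_)
      (law_unrepresentative_le hA hH hstar_mem hstar_meas D m n j T hN x (by positivity) hr hr1)
    intro y hy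
    have e1 : S (splice J K x y) = S y := by
      refine reservoir_congr (fun l => ?_) fun i r => ?_
      · rw [splice_snd, if_pos (by simp [K])]
      · rw [splice_fst, if_pos (by simp [J])]
    have e2 : hyps (splice J K x y) T = (boost A n j N (S y) x T).1 := by
      simp only [hyps, e1]
      refine boost_congr (fun t' ht' l => ?_) fun t' ht' i r => ?_
      · rw [splice_snd, if_neg (by simp [K])]
      · rw [splice_snd, if_neg (by simp [K])]
    simp only [Set.mem_ofPred_eq, unrep, e1, e2] at hy ⊢
    exact hy
  refine (measure_mono hsub).trans ((measure_union_le _ _).trans (add_le_add ?_ hunrep))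
  refine (measure_biUnion_finset_le _ _).trans ((Finset.sum_le_sum fun t _ => hbad t).trans ?_)
  simp

end FirstStep

/-! ### Analysis of the loop: tests, halving, union bound -/

section Loop

variable {X : Type u} {k : ℕ}

/-- First steps of the rounds of Personalized Learning. -/
abbrev FirstStep (X : Type u) (k : ℕ) :=
  Randomness X k → ℕ → Finset (Fin k) → (X → Bool) × List (Message X)

/-- The players that have no classifier before round `j`. -/
def activeAt (learn : FirstStep X k) (hstar : X → Bool) (c ε δ' : ℝ) (j : ℕ)
    (ω : Randomness X k) : Finset (Fin k) := (loop (learn ω) hstar c ε δ' ω j).active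

open Classical in
theorem activeAt_succ (learn : FirstStep X k) (hstar : X → Bool) (c ε δ' : ℝ) (j : ℕ)
    (ω : Randomness X k) : activeAt learn hstar c ε δ' (j + 1) ω =
      (activeAt learn hstar c ε δ' j ω).filter fun i =>
        ¬ PassesTest hstar ε (testSize c ε δ' (activeAt learn hstar c ε δ' j ω).card) ω j
          (learn ω j (activeAt learn hstar c ε δ' j ω)).1 i := by
  unfold activeAt
  simp only [loop]
  split_ifs with h
  · simp [h]
  · simp only
    ext i
    simp only [Finset.mem_sdiff, Finset.mem_filter]
    tauto

/-- The first step in round `j` depends on the randomness for round `j` only, and not on the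
samples for the tests. -/
def IsLocal (learn : FirstStep X k) : Prop :=
  ∀ (j : ℕ) (N : Finset (Fin k)) (ω ω' : Randomness X k),
    (∀ i r, ω.1 (.reservoir j i r) = ω'.1 (.reservoir j i r)) →
    (∀ l, ω.2 (.slot j l) = ω'.2 (.slot j l)) →
    (∀ t l, ω.2 (.request j t l) = ω'.2 (.request j t l)) →
    (∀ t i r, ω.2 (.pick j t i r) = ω'.2 (.pick j t i r)) → (learn ω j N).1 = (learn ω' j N).1

def Draw.round : Draw k → ℕ
  | .reservoir j _ _ => j
  | .test j _ _ => j

def Coin.round : Coin k → ℕ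
  | .slot j _ => j
  | .request j _ _ => j
  | .pick j _ _ _ => j

theorem passesTest_congr {hstar h : X → Bool} {ε : ℝ} {T : ℕ} {ω ω' : Randomness X k} {j : ℕ}
    {i : Fin k} (hω : ∀ r, ω.1 (.test j i r) = ω'.1 (.test j i r)) :
    PassesTest hstar ε T ω j h i ↔ PassesTest hstar ε T ω' j h i := by
  simp only [PassesTest, hω]

/-- The active set before round `j` reads only randomness of earlier rounds. Fresh randomness for
round `j` therefore meets a fixed set of players. -/
theorem activeAt_congr {learn : FirstStep X k} (hloc : IsLocal learn) (hstar : X → Bool)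
    (c ε δ' : ℝ) {j : ℕ} {ω ω' : Randomness X k} (h1 : ∀ q, q.round < j → ω.1 q = ω'.1 q)
    (h2 : ∀ q, q.round < j → ω.2 q = ω'.2 q) :
    activeAt learn hstar c ε δ' j ω = activeAt learn hstar c ε δ' j ω' := by
  classical
  induction j with
  | zero => rfl
  | succ j ih =>
    rw [activeAt_succ, activeAt_succ, ih (fun q hq => h1 q (by omega)) (fun q hq => h2 q (by omega))]
    rw [hloc j _ ω ω' (fun i r => h1 _ (Nat.lt_succ_self j)) (fun l => h2 _ (Nat.lt_succ_self j))
      (fun t l => h2 _ (Nat.lt_succ_self j)) (fun t i r => h2 _ (Nat.lt_succ_self j))]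
    refine Finset.filter_congr fun i _ => not_congr ?_
    exact passesTest_congr fun r => h1 _ (Nat.lt_succ_self j)

variable [MeasurableSpace X]

theorem measurableSet_passesTest {Ω : Type*} [MeasurableSpace Ω] {hstar : X → Bool}
    (hstar_meas : Measurable hstar) (ε : ℝ) (T j : ℕ) {ω : Ω → Randomness X k} (hω : Measurable ω)
    {h : Ω → X → Bool} (hh : Measurable fun p : Ω × X => h p.1 p.2) (i : Fin k) :
    MeasurableSet {x | PassesTest hstar ε T (ω x) j (h x) i} := by
  have hd : ∀ q : Draw k, Measurable fun x => (ω x).1 q := fun q =>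
    (measurable_pi_apply q).comp hω.fst
  have h1 : Measurable fun x => (List.range T).countP fun r =>
      decide (h x ((ω x).1 (.test j i r)) ≠ hstar ((ω x).1 (.test j i r))) := by
    refine Measurable.countP_const _ fun r _ => ?_
    exact (Measurable.of_discrete (f := fun b : Bool × Bool => decide (b.1 ≠ b.2))).comp
      ((hh.comp (measurable_id.prodMk (hd _))).prodMk (hstar_meas.comp (hd _)))
  exact measurableSet_le (((measurable_from_nat (f := fun n : ℕ => (n : ℝ))).comp h1).div_const _)
    measurable_const

theorem measurableSet_activeAt {learn : FirstStep X k}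
    (hlearn : ∀ j N, Measurable fun p : Randomness X k × X => (learn p.1 j N).1 p.2)
    {hstar : X → Bool} (hstar_meas : Measurable hstar) (c ε δ' : ℝ) (j : ℕ) (N : Finset (Fin k)) :
    MeasurableSet {ω | activeAt learn hstar c ε δ' j ω = N} := by
  classical
  induction j generalizing N with
  | zero =>
    change MeasurableSet {_ω : Randomness X k | (Finset.univ : Finset (Fin k)) = N}
    exact MeasurableSet.const _
  | succ j ih =>
    have : {ω | activeAt learn hstar c ε δ' (j + 1) ω = N} = ⋃ M : Finset (Fin k),
        {ω | activeAt learn hstar c ε δ' j ω = M} ∩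
        (fun ω (i : Fin k) => PassesTest hstar ε (testSize c ε δ' M.card) ω j (learn ω j M).1 i) ⁻¹'
          {q : Fin k → Prop | (M.filter fun i => ¬ q i) = N} := by
      ext ω
      simp only [Set.mem_ofPred_eq, Set.mem_iUnion, Set.mem_inter_iff, Set.mem_preimage,
        activeAt_succ, exists_eq_left']
    rw [this]
    refine MeasurableSet.iUnion fun M => (ih M).inter ?_
    refine measurable_pi_lambda _ (fun i => ?_) (MeasurableSet.of_discrete)
    exact measurableSet_setOfPred.1
      (measurableSet_passesTest hstar_meas ε _ j measurable_id (hlearn j M) i)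

variable (D : Fin k → Measure X) [∀ i, IsProbabilityMeasure (D i)]

theorem log_four_thirds_le : Real.log (4 / 3) ≤ 0.304 := by
  have h1 : Real.log (4 / 3) = Real.log 2 - Real.log (3 / 2) := by
    rw [← Real.log_div (by norm_num) (by norm_num)]; norm_num
  have := log_three_halves_ge
  have := Real.log_two_lt_d9
  rw [h1]
  linarith

theorem law_map_test (j : ℕ) (i : Fin k) (T : ℕ) :
    (law D).map (fun y (r : Fin T) => y.1 (.test j i r)) = Measure.pi fun _ => D i := by
  have hinj : Function.Injective fun r : Fin T => (Draw.test j i r : Draw k) := by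
    intro r r' h
    simpa [Fin.ext_iff] using h
  have h1 := Measure.map_infinitePi_infinitePi_of_inj (P := fun q : Draw k => D q.player) hinj
  rw [Measure.infinitePi_eq_pi (μ := fun r : Fin T => D (Draw.player (.test j i r)))] at h1
  have h2 : (law D).map Prod.fst = Measure.infinitePi fun q : Draw k => D q.player :=
    measurePreserving_fst.map_eq
  rw [← h2, Measure.map_map (by fun_prop) measurable_fst] at h1
  exact h1

/-- `TEST` errs with small probability. -/
theorem law_test_le {hstar h : X → Bool} (hstar_meas : Measurable hstar) (hh : Measurable h)
    {ε : ℝ} (hε : 0 < ε) (T j : ℕ) (i : Fin k) :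
    law D {y | (err (D i) hstar h < ε / 2 ∧ ¬ PassesTest hstar ε T y j h i) ∨
      (ε ≤ err (D i) hstar h ∧ PassesTest hstar ε T y j h i)} ≤
      ENNReal.ofReal (Real.exp (-(ε * T / 50))) := by
  let g : X → Bool := fun x => decide (h x ≠ hstar x)
  have hg : Measurable g := (Measurable.of_discrete
    (f := fun b : Bool × Bool => decide (b.1 ≠ b.2))).comp (hh.prodMk hstar_meas)
  set p := err (D i) hstar h with hp
  have hgp : (D i).real {x | g x = true} = p := by
    rw [hp, err]; congr 1; ext x; simp [g]
  have hp0 : 0 ≤ p := measureReal_nonneg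
  have hT0 : (0 : ℝ) ≤ T := Nat.cast_nonneg _
  let Φ : Randomness X k → Fin T → X := fun y r => y.1 (.test j i r)
  have hΦ : Measurable Φ := by
    refine measurable_pi_lambda _ fun r => ?_
    exact (measurable_pi_apply (Draw.test j i r)).comp
      (measurable_fst (α := Draw k → X) (β := Coin k → unitInterval))
  have hcount : ∀ y : Randomness X k, ((List.range T).countP fun r =>
      decide (h (y.1 (.test j i r)) ≠ hstar (y.1 (.test j i r)))) = hits g (Φ y) := by
    intro y
    rw [← List.map_coe_finRange_eq_range, List.countP_map, List.countP_eq_length_filter,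
      ← List.toFinset_card_of_nodup ((List.nodup_finRange T).filter _), hits]
    congr 1
    ext r
    simp [g, Φ]
  have hpass : ∀ y, PassesTest hstar ε T y j h i ↔ (hits g (Φ y) : ℝ) ≤ 3 * ε / 4 * T := by
    intro y
    unfold PassesTest
    rw [hcount]
    -- For `T = 0` the quotient is `0 / 0 = 0` and the test is passed, in agreement with the product
    -- form.
    rcases Nat.eq_zero_or_pos T with h0 | hpos
    · subst h0
      simp [hits]; positivity
    · rw [div_le_iff₀ (by exact_mod_cast hpos)]
  have hbound : ∀ θ : ℝ, (Real.exp θ - 1) * (p * T) - θ * (3 * ε / 4 * T) ≤ -(ε * T / 50) →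
      law D (Φ ⁻¹' {z | θ * (3 * ε / 4 * T) ≤ θ * hits g z}) ≤
        ENNReal.ofReal (Real.exp (-(ε * T / 50))) := by
    intro θ hθ
    refine (Measure.le_map_apply hΦ.aemeasurable _).trans ?_
    rw [law_map_test D j i T]
    refine (chernoff (D i) hg T θ _).trans (ENNReal.ofReal_le_ofReal (Real.exp_le_exp.2 ?_))
    rw [hgp]
    exact hθ
  have hl1 := log_three_halves_ge
  have hl2 := log_four_thirds_le
  have hεT : 0 ≤ ε * T := by positivity
  by_cases h1 : p < ε / 2
  -- Rejecting a good hypothesis is an upper tail. The exponent is at most `(1/4 - 0.39 · 3/4) ε T`,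
  -- below `-ε T / 50`.
  · refine (measure_mono ?_).trans (hbound (Real.log (3 / 2)) ?_)
    · rintro y (⟨-, hy⟩ | ⟨hy, -⟩)
      · rw [hpass, not_le] at hy
        exact mul_le_mul_of_nonneg_left hy.le (by linarith)
      · linarith
    · rw [Real.exp_log (by norm_num)]
      have e1 : p * T ≤ ε / 2 * T := mul_le_mul_of_nonneg_right h1.le hT0
      have e2 : 0.39 * (3 * ε / 4 * T) ≤ Real.log (3 / 2) * (3 * ε / 4 * T) :=
        mul_le_mul_of_nonneg_right hl1 (by positivity)
      nlinarith
  · by_cases h2 : ε ≤ p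
    -- Accepting a bad hypothesis is a lower tail. The exponent is at most `(-1/4 + 0.304 · 3/4) ε T
    -- = -0.022 ε T`.
    · have hneg : Real.log (3 / 4) = -Real.log (4 / 3) := by
        rw [← Real.log_inv]; norm_num
      refine (measure_mono ?_).trans (hbound (Real.log (3 / 4)) ?_)
      · rintro y (⟨hy, -⟩ | ⟨-, hy⟩)
        · exact absurd hy h1
        · rw [hpass] at hy
          refine mul_le_mul_of_nonpos_left hy ?_
          exact Real.log_nonpos (by norm_num) (by norm_num)
      · rw [Real.exp_log (by norm_num), hneg]
        have e1 : ε * T ≤ p * T := mul_le_mul_of_nonneg_right h2 hT0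
        have e2 : Real.log (4 / 3) * (3 * ε / 4 * T) ≤ 0.304 * (3 * ε / 4 * T) :=
          mul_le_mul_of_nonneg_right hl2 (by positivity)
        nlinarith
    -- For errors in `[ε / 2, ε)` either verdict is acceptable.
    · refine (measure_mono (t := ∅) ?_).trans (by simp)
      rintro y (⟨hy, -⟩ | ⟨hy, -⟩)
      · exact h1 hy
      · exact h2 hy

/-- With the prescribed number of examples, all tests of a round are correct with high
probability. -/
theorem law_tests_le {hstar h : X → Bool} (hstar_meas : Measurable hstar) (hh : Measurable h)
    {ε δ' : ℝ} (hε : 0 < ε) (hε1 : ε < 1) (hδ : 0 < δ') (hδ1 : δ' ≤ 1) (j : ℕ)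
    (N : Finset (Fin k)) :
    law D {y | ∃ i ∈ N,
      (err (D i) hstar h < ε / 2 ∧ ¬ PassesTest hstar ε (testSize 100 ε δ' N.card) y j h i) ∨
      (ε ≤ err (D i) hstar h ∧ PassesTest hstar ε (testSize 100 ε δ' N.card) y j h i)} ≤
      ENNReal.ofReal δ' := by
  set T := testSize 100 ε δ' N.card with hT
  have hset : {y : Randomness X k | ∃ i ∈ N,
      (err (D i) hstar h < ε / 2 ∧ ¬ PassesTest hstar ε T y j h i) ∨
      (ε ≤ err (D i) hstar h ∧ PassesTest hstar ε T y j h i)} =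
      ⋃ i ∈ N, {y | (err (D i) hstar h < ε / 2 ∧ ¬ PassesTest hstar ε T y j h i) ∨
      (ε ≤ err (D i) hstar h ∧ PassesTest hstar ε T y j h i)} := by
    ext y; simp
  rw [hset]
  refine (measure_biUnion_finset_le _ _).trans ((Finset.sum_le_sum fun i _ =>
    law_test_le D hstar_meas hh hε T j i).trans ?_)
  rw [Finset.sum_const, nsmul_eq_mul, ← ENNReal.ofReal_natCast, ← ENNReal.ofReal_mul (by positivity)]
  refine ENNReal.ofReal_le_ofReal ?_
  rcases N.eq_empty_or_nonempty with h0 | hne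
  · subst h0; simpa using hδ.le
  have hn : (1 : ℝ) ≤ N.card := by exact_mod_cast hne.card_pos
  have hTge : 100 * Real.log (N.card / (ε * δ')) / ε ≤ T := Nat.le_ceil _
  rw [div_le_iff₀ hε] at hTge
  -- The constant `100` makes a single test fail with probability at most the square of `ε δ' / n`;
  -- one factor pays for the union over `n` players.
  have hexp : Real.exp (-(ε * T / 50)) ≤ (ε * δ' / N.card) ^ 2 := by
    have e0 : Real.log (N.card / (ε * δ')) = -Real.log (ε * δ' / N.card) := by
      rw [← Real.log_inv, inv_div]
    have e1 : (ε * δ' / N.card) ^ 2 = Real.exp (2 * Real.log (ε * δ' / N.card)) := by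
      rw [show (2 : ℝ) = ((2 : ℕ) : ℝ) by norm_num, Real.exp_nat_mul, Real.exp_log (by positivity)]
    rw [e1]
    refine Real.exp_le_exp.2 ?_
    rw [e0] at hTge
    linarith
  calc (N.card : ℝ) * Real.exp (-(ε * T / 50)) ≤ N.card * (ε * δ' / N.card) ^ 2 :=
        mul_le_mul_of_nonneg_left hexp (by positivity)
    _ = (ε ^ 2 * δ' / N.card) * δ' := by field_simp
    _ ≤ 1 * δ' := by
        refine mul_le_mul_of_nonneg_right ?_ hδ.le
        rw [div_le_one (by linarith)]
        have : ε ^ 2 * δ' ≤ 1 := mul_le_one₀ (pow_le_one₀ hε.le hε1.le) hδ.le hδ1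
        linarith
    _ = δ' := one_mul _

/-- A round fails if the first step fails to learn the mixture or a test is wrong. -/
def RoundFails (learn : FirstStep X k) (hstar : X → Bool) (c ε δ' : ℝ) (j : ℕ)
    (ω : Randomness X k) : Prop :=
  let N := activeAt learn hstar c ε δ' j ω
  (N.Nonempty ∧ ε / 4 ≤ mixtureErr N D hstar (learn ω j N).1) ∨
  ∃ i ∈ N, (err (D i) hstar (learn ω j N).1 < ε / 2 ∧
      ¬ PassesTest hstar ε (testSize c ε δ' N.card) ω j (learn ω j N).1 i) ∨
    (ε ≤ err (D i) hstar (learn ω j N).1 ∧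
      PassesTest hstar ε (testSize c ε δ' N.card) ω j (learn ω j N).1 i)

-- Markov's inequality for the average of the errors. Strictness of `hmix` gives strictly fewer than
-- half, which finishes the last round of the loop.
omit [∀ i, IsProbabilityMeasure (D i)] in
theorem card_failing_lt {N F : Finset (Fin k)} (hFN : F ⊆ N) (hN : N.Nonempty) {hstar h : X → Bool}
    {ε : ℝ} (hε : 0 < ε) (hmix : mixtureErr N D hstar h < ε / 4)
    (hF : ∀ i ∈ F, ε / 2 ≤ err (D i) hstar h) : 2 * F.card < N.card := by
  have hn : (0 : ℝ) < N.card := by exact_mod_cast hN.card_pos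
  rw [mixtureErr, div_lt_iff₀ hn] at hmix
  have h1 : F.card • (ε / 2) ≤ ∑ i ∈ F, err (D i) hstar h := Finset.card_nsmul_le_sum _ _ _ hF
  have h2 : ∑ i ∈ F, err (D i) hstar h ≤ ∑ i ∈ N, err (D i) hstar h :=
    Finset.sum_le_sum_of_subset_of_nonneg hFN fun i _ _ => measureReal_nonneg
  rw [nsmul_eq_mul] at h1
  have h3 : (F.card : ℝ) * (ε / 2) < ε / 4 * N.card := (h1.trans h2).trans_lt hmix
  have h4 : ε * (2 * F.card) < ε * N.card := by linarith
  have h5 := lt_of_mul_lt_mul_left h4 hε.le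
  exact_mod_cast h5

omit [∀ i, IsProbabilityMeasure (D i)] in
/-- If no round fails, the algorithm completes. -/
theorem completed_of_not_roundFails (hk : 2 ≤ k) (learn : FirstStep X k) (hstar : X → Bool)
    {c ε δ' : ℝ} (hε : 0 < ε) (ω : Randomness X k)
    (h : ∀ j < rounds k, ¬ RoundFails D learn hstar c ε δ' j ω) :
    Completed D hstar ε (loop (learn ω) hstar c ε δ' ω (rounds k)) := by
  classical
  set r := rounds k with hr
  have hkr : k ≤ 2 ^ r := Nat.le_pow_clog (by norm_num) k
  have hr0 : 0 < r := Nat.clog_pos (by norm_num) hk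
  -- Initially `k` may equal `2 ^ r`, so the bound is not strict. After one successful round it is,
  -- and at `j = r` a strict bound means that no player is left.
  have inv : ∀ j ≤ r,
      (∀ i, i ∉ activeAt learn hstar c ε δ' j ω → ∃ h,
        (loop (learn ω) hstar c ε δ' ω j).output i = some h ∧ err (D i) hstar h < ε) ∧
      (activeAt learn hstar c ε δ' j ω).card * 2 ^ j ≤ 2 ^ r ∧
      (0 < j → (activeAt learn hstar c ε δ' j ω).card * 2 ^ j < 2 ^ r) := by
    intro j
    induction j with
    | zero =>
      refine fun _ => ⟨fun i hi => absurd (Finset.mem_univ i) hi, ?_, fun h => absurd h (by simp)⟩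
      simpa [activeAt, loop] using hkr
    | succ j ih =>
      intro hj
      obtain ⟨i1, i2, -⟩ := ih (by omega)
      have hnf := h j (by omega)
      set N := activeAt learn hstar c ε δ' j ω with hN
      have hsucc := activeAt_succ learn hstar c ε δ' j ω
      rw [← hN] at hsucc
      by_cases hne : N = ∅
      · have e1 : loop (learn ω) hstar c ε δ' ω (j + 1) = loop (learn ω) hstar c ε δ' ω j := by
          have : (loop (learn ω) hstar c ε δ' ω j).active = ∅ := hne
          simp [loop, this]
        have e2 : activeAt learn hstar c ε δ' (j + 1) ω = ∅ := by rw [hsucc, hne]; rfl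
        rw [e1, e2]
        refine ⟨fun i _ => i1 i (by rw [hne]; simp), by simp, by simp⟩
      · have hnon : N.Nonempty := Finset.nonempty_iff_ne_empty.2 hne
        unfold RoundFails at hnf
        simp only [← hN, not_or, not_and, not_exists, not_le] at hnf
        obtain ⟨hmix, htest⟩ := hnf
        have hlt : 2 * (activeAt learn hstar c ε δ' (j + 1) ω).card < N.card := by
          refine card_failing_lt D ?_ hnon hε (hmix hnon) ?_
          · rw [hsucc]; exact Finset.filter_subset _ _
          · intro i hi
            rw [hsucc, Finset.mem_filter] at hi
            by_contra hlt
            push Not at hlt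
            exact (htest i hi.1).1 hlt hi.2
        have hlt2 : (activeAt learn hstar c ε δ' (j + 1) ω).card * 2 ^ (j + 1) < 2 ^ r := by
          calc _ = 2 * (activeAt learn hstar c ε δ' (j + 1) ω).card * 2 ^ j := by ring
            _ < N.card * 2 ^ j := Nat.mul_lt_mul_of_pos_right hlt (by positivity)
            _ ≤ 2 ^ r := i2
        refine ⟨fun i hi => ?_, hlt2.le, fun _ => hlt2⟩
        have hne' : ¬ (loop (learn ω) hstar c ε δ' ω j).active = ∅ := hne
        have hout : (loop (learn ω) hstar c ε δ' ω (j + 1)).output i =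
            if i ∈ N.filter (PassesTest hstar ε (testSize c ε δ' N.card) ω j (learn ω j N).1) then
              some (learn ω j N).1 else (loop (learn ω) hstar c ε δ' ω j).output i := by
          simp only [loop, hne', if_false]
          rfl
        rw [hout]
        split_ifs with hp
        · rw [Finset.mem_filter] at hp
          refine ⟨_, rfl, ?_⟩
          by_contra hge
          push Not at hge
          exact (htest i hp.1).2 hge hp.2
        · refine i1 i fun hiN => hi ?_
          rw [hsucc, Finset.mem_filter]
          rw [Finset.mem_filter] at hp
          exact ⟨hiN, fun hpass => hp ⟨hiN, hpass⟩⟩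
  obtain ⟨i1, -, i3⟩ := inv r le_rfl
  have hempty : activeAt learn hstar c ε δ' r ω = ∅ := by
    rw [← Finset.card_eq_zero]
    have := i3 hr0
    by_contra hne
    have h1 : 1 ≤ (activeAt learn hstar c ε δ' r ω).card := Nat.one_le_iff_ne_zero.2 hne
    exact absurd (Nat.mul_le_mul_right (2 ^ r) h1) (by omega)
  intro i
  exact i1 i (by rw [hempty]; simp)

/-- The active set takes finitely many values, so the event is a finite union over them. -/
theorem measurableSet_of_activeAt {learn : FirstStep X k}
    (hlearn : ∀ j N, Measurable fun p : Randomness X k × X => (learn p.1 j N).1 p.2)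
    {hstar : X → Bool} (hstar_meas : Measurable hstar) (c ε δ' : ℝ) (j : ℕ)
    {P : Finset (Fin k) → Randomness X k → Prop} (hP : ∀ N, MeasurableSet {ω | P N ω}) :
    MeasurableSet {ω | P (activeAt learn hstar c ε δ' j ω) ω} := by
  have : {ω | P (activeAt learn hstar c ε δ' j ω) ω} = ⋃ N : Finset (Fin k),
      {ω | activeAt learn hstar c ε δ' j ω = N} ∩ {ω | P N ω} := by
    ext ω; simp
  rw [this]
  exact MeasurableSet.iUnion fun N =>
    (measurableSet_activeAt hlearn hstar_meas c ε δ' j N).inter (hP N)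

/-- A round fails with small probability if the first step learns the mixture. -/
theorem law_roundFails_le {learn : FirstStep X k} (hloc : IsLocal learn)
    (hlearn : ∀ j N, Measurable fun p : Randomness X k × X => (learn p.1 j N).1 p.2)
    {hstar : X → Bool} (hstar_meas : Measurable hstar)
    {ε δ' : ℝ} (hε : 0 < ε) (hε1 : ε < 1) (hδ : 0 < δ') (hδ1 : δ' ≤ 1) (j : ℕ)
    (hgood : ∀ N : Finset (Fin k), N.Nonempty →
      law D {ω | ε / 4 ≤ mixtureErr N D hstar (learn ω j N).1} ≤ ENNReal.ofReal δ') :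
    law D {ω | RoundFails D learn hstar 100 ε δ' j ω} ≤ 2 * ENNReal.ofReal δ' := by
  let act := activeAt learn hstar 100 ε δ' j
  let E₁ : Set (Randomness X k) :=
    {ω | (act ω).Nonempty ∧ ε / 4 ≤ mixtureErr (act ω) D hstar (learn ω j (act ω)).1}
  let E₂ : Set (Randomness X k) := {ω | ∃ i ∈ act ω, (err (D i) hstar (learn ω j (act ω)).1 < ε / 2 ∧
      ¬ PassesTest hstar ε (testSize 100 ε δ' (act ω).card) ω j (learn ω j (act ω)).1 i) ∨
    (ε ≤ err (D i) hstar (learn ω j (act ω)).1 ∧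
      PassesTest hstar ε (testSize 100 ε δ' (act ω).card) ω j (learn ω j (act ω)).1 i)}
  have hE₁m : MeasurableSet E₁ := by
    refine measurableSet_of_activeAt hlearn hstar_meas 100 ε δ' j
      (P := fun N ω => N.Nonempty ∧ ε / 4 ≤ mixtureErr N D hstar (learn ω j N).1) fun N => ?_
    exact (MeasurableSet.const _).inter (measurableSet_le measurable_const
      (measurable_mixtureErr N D hstar_meas (g := fun ω => (learn ω j N).1) (hlearn j N)))
  have hE₂m : MeasurableSet E₂ := by
    refine measurableSet_of_activeAt hlearn hstar_meas 100 ε δ' j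
      (P := fun N ω => ∃ i ∈ N, (err (D i) hstar (learn ω j N).1 < ε / 2 ∧
        ¬ PassesTest hstar ε (testSize 100 ε δ' N.card) ω j (learn ω j N).1 i) ∨
        (ε ≤ err (D i) hstar (learn ω j N).1 ∧
        PassesTest hstar ε (testSize 100 ε δ' N.card) ω j (learn ω j N).1 i)) fun N => ?_
    have : ∀ i, MeasurableSet {ω | (err (D i) hstar (learn ω j N).1 < ε / 2 ∧
        ¬ PassesTest hstar ε (testSize 100 ε δ' N.card) ω j (learn ω j N).1 i) ∨
        (ε ≤ err (D i) hstar (learn ω j N).1 ∧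
        PassesTest hstar ε (testSize 100 ε δ' N.card) ω j (learn ω j N).1 i)} := by
      intro i
      have h1 := measurable_err (D i) hstar_meas (g := fun ω => (learn ω j N).1) (hlearn j N)
      have h2 := measurableSet_passesTest hstar_meas ε (testSize 100 ε δ' N.card) j
        (ω := fun ω : Randomness X k => ω) (h := fun ω => (learn ω j N).1) measurable_id (hlearn j N) i
      exact ((measurableSet_lt h1 measurable_const).inter h2.compl).union
        ((measurableSet_le measurable_const h1).inter h2)
    have hu : {ω | ∃ i ∈ N, (err (D i) hstar (learn ω j N).1 < ε / 2 ∧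
        ¬ PassesTest hstar ε (testSize 100 ε δ' N.card) ω j (learn ω j N).1 i) ∨
        (ε ≤ err (D i) hstar (learn ω j N).1 ∧
        PassesTest hstar ε (testSize 100 ε δ' N.card) ω j (learn ω j N).1 i)} =
        ⋃ i ∈ N, {ω | (err (D i) hstar (learn ω j N).1 < ε / 2 ∧
        ¬ PassesTest hstar ε (testSize 100 ε δ' N.card) ω j (learn ω j N).1 i) ∨
        (ε ≤ err (D i) hstar (learn ω j N).1 ∧
        PassesTest hstar ε (testSize 100 ε δ' N.card) ω j (learn ω j N).1 i)} := by
      ext ω; simp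
    rw [hu]
    exact Finset.measurableSet_biUnion _ fun i _ => this i
  have hE₁ : law D E₁ ≤ ENNReal.ofReal δ' := by
    -- Resampling the reservoirs and coins of round `j` leaves the active set fixed, so `hgood` is
    -- applied to a deterministic set.
    refine law_le_of_splice D {q | ∃ i r, q = .reservoir j i r} {q | q.round = j} hE₁m fun x => ?_
    set J : Set (Draw k) := {q | ∃ i r, q = .reservoir j i r} with hJ
    set K : Set (Coin k) := {q | q.round = j} with hK
    have e1 : ∀ y, act (splice J K x y) = act x := by
      refine fun y => activeAt_congr hloc hstar 100 ε δ' (fun q hq => ?_) fun q hq => ?_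
      · rw [splice_fst, if_neg]
        rintro ⟨i, r, rfl⟩
        exact absurd hq (lt_irrefl j)
      · rw [splice_snd, if_neg]
        intro (h : q.round = j)
        omega
    have e2 : ∀ y N, (learn (splice J K x y) j N).1 = (learn y j N).1 := by
      refine fun y N => hloc j N _ _ (fun i r => ?_) (fun l => ?_) (fun t l => ?_) fun t i r => ?_
      · rw [splice_fst, if_pos ⟨i, r, rfl⟩]
      all_goals rw [splice_snd]; exact if_pos rfl
    by_cases hne : (act x).Nonempty
    · refine (measure_mono fun y hy => ?_).trans (hgood (act x) hne)
      simp only [E₁, Set.mem_ofPred_eq, e1, e2] at hy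
      exact hy.2
    · refine (measure_mono (t := ∅) fun y hy => ?_).trans (by simp)
      simp only [E₁, Set.mem_ofPred_eq, e1, e2] at hy
      exact hne hy.1
  have hE₂ : law D E₂ ≤ ENNReal.ofReal δ' := by
    -- Resampling only the test examples of round `j` fixes both the active set and, by locality,
    -- the hypothesis under test.
    refine law_le_of_splice D {q | ∃ i r, q = .test j i r} ∅ hE₂m fun x => ?_
    set J : Set (Draw k) := {q | ∃ i r, q = .test j i r} with hJ
    have e1 : ∀ y, act (splice J ∅ x y) = act x := by
      refine fun y => activeAt_congr hloc hstar 100 ε δ' (fun q hq => ?_) fun q hq => ?_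
      · rw [splice_fst, if_neg]
        rintro ⟨i, r, rfl⟩
        exact absurd hq (lt_irrefl j)
      · rw [splice_snd, if_neg (by simp)]
    have e2 : ∀ y N, (learn (splice J ∅ x y) j N).1 = (learn x j N).1 := by
      refine fun y N => hloc j N _ _ (fun i r => ?_) (fun l => ?_) (fun t l => ?_) fun t i r => ?_
      · rw [splice_fst, if_neg (by simp [hJ])]
      all_goals rw [splice_snd, if_neg (by simp)]
    have e3 : ∀ y T h i, PassesTest hstar ε T (splice J ∅ x y) j h i ↔
        PassesTest hstar ε T y j h i := by
      refine fun y T h i => passesTest_congr fun r => ?_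
      rw [splice_fst, if_pos ⟨i, r, rfl⟩]
    refine (measure_mono fun y hy => ?_).trans (law_tests_le D hstar_meas
      (h := (learn x j (act x)).1) ((hlearn j (act x)).comp measurable_prodMk_left) hε hε1 hδ hδ1 j
      (act x))
    simp only [E₂, Set.mem_ofPred_eq, e1, e2, e3] at hy
    exact hy
  have hsub : {ω | RoundFails D learn hstar 100 ε δ' j ω} ⊆ E₁ ∪ E₂ := fun ω hω => hω
  refine (measure_mono hsub).trans ((measure_union_le _ _).trans ?_)
  rw [two_mul]
  exact add_le_add hE₁ hE₂

/-- Personalized Learning completes with high probability if its first step learns mixtures. -/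
theorem law_not_completed_le (hk : 2 ≤ k) {learn : FirstStep X k} (hloc : IsLocal learn)
    (hlearn : ∀ j N, Measurable fun p : Randomness X k × X => (learn p.1 j N).1 p.2)
    {hstar : X → Bool} (hstar_meas : Measurable hstar)
    {ε δ : ℝ} (hε : 0 < ε) (hε1 : ε < 1) (hδ : 0 < δ) (hδ1 : δ < 1)
    (hgood : ∀ j (N : Finset (Fin k)), N.Nonempty →
      law D {ω | ε / 4 ≤ mixtureErr N D hstar (learn ω j N).1} ≤
        ENNReal.ofReal (stepConfidence k δ)) :
    law D {ω | ¬ Completed D hstar ε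
      (loop (learn ω) hstar 100 ε (stepConfidence k δ) ω (rounds k))} ≤ ENNReal.ofReal δ := by
  have hr0 : 0 < rounds k := Nat.clog_pos (by norm_num) hk
  have hr1 : (1 : ℝ) ≤ rounds k := by exact_mod_cast hr0
  have hδ' : 0 < stepConfidence k δ := by unfold stepConfidence; positivity
  have hδ'1 : stepConfidence k δ ≤ 1 := by
    unfold stepConfidence
    rw [div_le_one (by positivity)]
    linarith
  have hsub : {ω | ¬ Completed D hstar ε
      (loop (learn ω) hstar 100 ε (stepConfidence k δ) ω (rounds k))} ⊆
      ⋃ j ∈ Finset.range (rounds k),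
        {ω | RoundFails D learn hstar 100 ε (stepConfidence k δ) j ω} := by
    intro ω hω
    by_contra hnot
    refine hω (completed_of_not_roundFails D hk learn hstar hε ω fun j hj hf => hnot ?_)
    exact Set.mem_biUnion (Finset.mem_coe.2 (Finset.mem_range.2 hj)) hf
  refine (measure_mono hsub).trans ((measure_biUnion_finset_le _ _).trans
    ((Finset.sum_le_sum fun j _ => law_roundFails_le D hloc hlearn hstar_meas hε hε1 hδ' hδ'1 j
      (hgood j)).trans (le_of_eq ?_)))
  rw [Finset.sum_const, Finset.card_range, nsmul_eq_mul, ← ENNReal.ofReal_natCast,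
    show (2 : ENNReal) = ENNReal.ofReal 2 by simp, ← ENNReal.ofReal_mul (by norm_num),
    ← ENNReal.ofReal_mul (by positivity)]
  congr 1
  unfold stepConfidence
  field_simp

end Loop

/-! ### Choice of the constants -/

section BoostStep

variable {X : Type u} {k : ℕ} {A : List (X × Bool) → X → Bool}

theorem isLocal_boostStep (hstar : X → Bool) (m T n : ℕ) :
    IsLocal (k := k) (fun ω => boostStep A hstar m T n ω) := by
  intro j N ω ω' h1 h2 h3 h4
  simp only [boostStep]
  rw [reservoir_congr h2 h1, boost_congr (fun t _ l => h3 t l) (fun t _ i r => h4 t i r)]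

theorem log_two_le_log_two_div {ε : ℝ} (hε : 0 < ε) (hε1 : ε < 1) :
    Real.log 2 ≤ Real.log (2 / ε) :=
  Real.log_le_log (by norm_num) ((le_div_iff₀ hε).2 (by nlinarith))

theorem boostRounds_pos {ε : ℝ} (hε : 0 < ε) (hε1 : ε < 1) : 1 ≤ boostRounds 30 ε := by
  have := log_two_le_log_two_div hε hε1
  have := Real.log_two_gt_d9
  exact Nat.ceil_pos.2 (by linarith)

theorem log_nat_succ_ge {T : ℕ} (hT : 1 ≤ T) : Real.log 2 ≤ Real.log (T + 1) := by
  refine Real.log_le_log (by norm_num) ?_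
  have : (1 : ℝ) ≤ T := by exact_mod_cast hT
  linarith

/-- The failure probability of all weak learners together. -/
theorem weak_failure_le {d T : ℕ} (hd : 1 ≤ d) {δ' : ℝ} (hδ : 0 < δ') (hδ1 : δ' ≤ 1) :
    (T : ℝ) * (2 * (640 ^ d * Real.exp ((weakSize 2880 d T δ' : ℕ) / 320)) *
      Real.exp (-((weakSize 2880 d T δ' : ℕ) / 160))) ≤ δ' / 2 := by
  set n := weakSize 2880 d T δ' with hn
  have hd' : (1 : ℝ) ≤ d := by exact_mod_cast hd
  have hT : (0 : ℝ) ≤ T := Nat.cast_nonneg T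
  have h0 : 0 ≤ Real.log ((T + 1) / δ') := by
    refine Real.log_nonneg ((le_div_iff₀ hδ).2 ?_)
    linarith
  have hn' : 2880 * (d + Real.log ((T + 1) / δ')) ≤ n := Nat.le_ceil _
  have h640 : Real.log 640 ≤ 10 * Real.log 2 := by
    rw [← Real.log_rpow (by norm_num)]
    exact Real.log_le_log (by norm_num) (by norm_num)
  have h4 : Real.log 4 = 2 * Real.log 2 := by
    rw [← Real.log_rpow (by norm_num)]; norm_num
  have h2 := Real.log_two_lt_d9
  -- The net exponent is `n / 320`, and `2880 / 320 = 9`: this covers `d log 640 ≤ 7 d` and `log 4 ≤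
  -- 2 d`, with the logarithm to spare.
  have key : (n : ℝ) / 320 + -(n / 160) ≤
      -(Real.log 4 + d * Real.log 640 + Real.log ((T + 1) / δ')) := by
    have : (d : ℝ) * Real.log 640 ≤ d * 7 := by
      refine mul_le_mul_of_nonneg_left ?_ (by linarith)
      linarith
    linarith
  have h640d : (640 : ℝ) ^ d = Real.exp (d * Real.log 640) := by
    rw [Real.exp_nat_mul, Real.exp_log (by norm_num)]
  calc (T : ℝ) * (2 * (640 ^ d * Real.exp (n / 320)) * Real.exp (-(n / 160)))
      = T * 2 * 640 ^ d * Real.exp (n / 320 + -(n / 160)) := by rw [Real.exp_add]; ring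
    _ ≤ T * 2 * 640 ^ d *
        Real.exp (-(Real.log 4 + d * Real.log 640 + Real.log ((T + 1) / δ'))) := by gcongr
    _ = T * 2 * (1 / 4) * (1 / ((T + 1) / δ')) := by
        rw [Real.exp_neg, Real.exp_add, Real.exp_add, ← h640d, Real.exp_log (by norm_num),
          Real.exp_log (by positivity)]
        field_simp
    _ ≤ δ' / 2 := by
        rw [one_div_div]
        have : (T : ℝ) / (T + 1) ≤ 1 := (div_le_one (by positivity)).2 (by linarith)
        calc (T : ℝ) * 2 * (1 / 4) * (δ' / (T + 1)) = δ' / 2 * (T / (T + 1)) := by ring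
          _ ≤ δ' / 2 := mul_le_of_le_one_right (by positivity) this

/-- The probability that the reservoirs misrepresent a majority vote. -/
theorem reservoir_failure_le {d T : ℕ} (hd : 1 ≤ d) (hT : 1 ≤ T) {ε δ' : ℝ} (hε : 0 < ε)
    (hε1 : ε < 1) (hδ : 0 < δ') (hδ1 : δ' ≤ 1) :
    2 * ((1 / (ε / (160 * T))) ^ d *
      Real.exp (ε / (160 * T) * (2 * (reservoirSize 1440 d T ε δ' : ℕ)))) ^ T *
      Real.exp (-(ε / 4 * (reservoirSize 1440 d T ε δ' : ℕ) / 10)) ≤ δ' / 2 := by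
  set m := reservoirSize 1440 d T ε δ' with hm
  have hd' : (1 : ℝ) ≤ d := by exact_mod_cast hd
  have hT' : (1 : ℝ) ≤ T := by exact_mod_cast hT
  have hdT : (1 : ℝ) ≤ d * T := one_le_mul_of_one_le_of_one_le hd' hT'
  have hl := log_two_le_log_two_div hε hε1
  have hL := log_nat_succ_ge hT
  have h2 := Real.log_two_lt_d9
  have h2' := Real.log_two_gt_d9
  set l := Real.log (2 / ε) with hl'
  set L := Real.log (T + 1) with hL'
  have h0 : 0 ≤ Real.log (1 / δ') := Real.log_nonneg ((le_div_iff₀ hδ).2 (by linarith))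
  have hm' : 1440 * (d * T * L * l + Real.log (1 / δ')) ≤ ε * m := by
    have : 1440 * (d * T * L * l + Real.log (1 / δ')) / ε ≤ m := Nat.le_ceil _
    rw [div_le_iff₀ hε] at this
    linarith
  have h4 : Real.log 4 = 2 * Real.log 2 := by
    rw [← Real.log_rpow (by norm_num)]; norm_num
  set b := Real.log (1 / (ε / (160 * T))) with hb
  have hbpos : 0 < 1 / (ε / (160 * T)) := by positivity
  -- `b = log 80 + log T + log (2/ε)`. Each summand is bounded by a multiple of `L l`, because `L`
  -- and `l` are both at least `log 2`.
  have hble : b ≤ 15 * (L * l) := by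
    have e1 : 1 / (ε / (160 * T)) = 80 * (T * (2 / ε)) := by field_simp; norm_num
    have e2 : b = Real.log 80 + (Real.log T + l) := by
      rw [hb, e1, Real.log_mul (by norm_num) (by positivity), Real.log_mul (by positivity)
        (by positivity)]
    have e3 : Real.log 80 ≤ 7 * Real.log 2 := by
      rw [← Real.log_rpow (by norm_num)]
      exact Real.log_le_log (by norm_num) (by norm_num)
    have e4 : Real.log T ≤ L := Real.log_le_log (by linarith) (by linarith)
    nlinarith
  have hLl : 0.48 ≤ L * l := by nlinarith
  -- With `r = ε / (160 T)` the pattern count costs `exp (ε m / 80)`, half of the exponent `ε m /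
  -- 40`. The other half is at least `18 (d T L l + log (1/δ'))`, and the surplus `3 d T L l ≥ 1.44`
  -- pays for `log 4`.
  have key : (d * T) * b + Real.log 4 + Real.log (1 / δ') ≤ ε * m / 80 := by
    have e1 : (d * T) * b ≤ (d * T) * (15 * (L * l)) := mul_le_mul_of_nonneg_left hble (by linarith)
    have e2 : L * l ≤ (d * T) * (L * l) := le_mul_of_one_le_left (by linarith) hdT
    nlinarith
  calc 2 * ((1 / (ε / (160 * T))) ^ d * Real.exp (ε / (160 * T) * (2 * m))) ^ T *
        Real.exp (-(ε / 4 * m / 10))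
      = 2 * Real.exp ((d * T) * b - ε * m / 80) := by
        rw [mul_pow, ← pow_mul, ← Real.exp_log hbpos, ← hb, ← Real.exp_nat_mul, ← Real.exp_nat_mul,
          mul_assoc, ← Real.exp_add, ← Real.exp_add]
        congr 2
        push_cast
        field_simp
        ring
    _ ≤ 2 * Real.exp (-(Real.log 4 + Real.log (1 / δ'))) := by
        gcongr
        linarith
    _ = δ' / 2 := by
        rw [Real.exp_neg, Real.exp_add, Real.exp_log (by norm_num), Real.exp_log (by positivity)]
        field_simp
        norm_num

variable [MeasurableSpace X] {H : Set (X → Bool)} {d : ℕ}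

theorem stepConfidence_pos {k : ℕ} (hk : 2 ≤ k) {δ : ℝ} (hδ : 0 < δ) : 0 < stepConfidence k δ := by
  have : 0 < rounds k := Nat.clog_pos (by norm_num) hk
  unfold stepConfidence
  positivity

theorem stepConfidence_lt {k : ℕ} (hk : 2 ≤ k) {δ : ℝ} (hδ1 : δ < 1) :
    stepConfidence k δ < 1 / 2 := by
  have hr0 : 0 < rounds k := Nat.clog_pos (by norm_num) hk
  have hr1 : (1 : ℝ) ≤ rounds k := by exact_mod_cast hr0
  unfold stepConfidence
  rw [div_lt_iff₀ (by positivity)]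
  linarith

theorem law_not_completed_personalizedBoosting_le (hHm : ∀ h ∈ H, Measurable h)
    (hA : IsConsistentLearner H A) (hH : HasVCDim H d) (hd : 1 ≤ d)
    {hstar : X → Bool} (hstar_mem : hstar ∈ H) (D : Fin k → Measure X)
    [∀ i, IsProbabilityMeasure (D i)] (hk : 2 ≤ k) {ε δ : ℝ} (hε : 0 < ε) (hε1 : ε < 1)
    (hδ : 0 < δ) (hδ1 : δ < 1) :
    law D {ω | ¬ Completed D hstar ε
      (personalizedBoosting ⟨30, 2880, 1440, 100⟩ d A hstar ε δ ω)} ≤ ENNReal.ofReal δ := by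
  have hstar_meas := hHm _ hstar_mem
  have hδ' := stepConfidence_pos hk hδ
  have hδ'1 : stepConfidence k δ ≤ 1 := by linarith [stepConfidence_lt hk hδ1]
  have hT := boostRounds_pos hε hε1
  have hT' : (1 : ℝ) ≤ boostRounds 30 ε := by exact_mod_cast hT
  refine law_not_completed_le D hk (isLocal_boostStep hstar _ _ _)
    (fun j N => measurable_boostStep hA hstar_meas _ _ _ j N) hstar_meas hε hε1 hδ hδ1
    fun j N hN => ?_
  refine (law_boostStep_le hA hH hstar_mem hstar_meas D _ _ j _ hN hε hε1 (Nat.le_ceil _)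
    (r := ε / (160 * boostRounds 30 ε)) (by positivity)
    ((div_le_one (by positivity)).2 (by linarith))).trans ?_
  rw [← ENNReal.ofReal_natCast, ← ENNReal.ofReal_mul (by positivity),
    ← ENNReal.ofReal_add (by positivity) (by positivity)]
  refine ENNReal.ofReal_le_ofReal ?_
  exact (add_le_add (weak_failure_le (T := boostRounds 30 ε) hd hδ' hδ'1)
    (reservoir_failure_le hd hT hε hε1 hδ' hδ'1)).trans (add_halves _).le

end BoostStep

/-! ### Deterministic communication counts -/

section Communication

variable {X : Type u} {k : ℕ} {A : List (X × Bool) → X → Bool}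

theorem samplesSent_append (a b : List (Message X)) :
    samplesSent (a ++ b) = samplesSent a + samplesSent b := by
  simp [samplesSent]

theorem bitsSent_append (a b : List (Message X)) :
    bitsSent (a ++ b) = bitsSent a + bitsSent b := by
  simp [bitsSent]

theorem samplesSent_map_sample (S : List (X × Bool)) :
    samplesSent (S.map Message.sample) = S.length := by
  simp [samplesSent, Function.comp_def, Message.samples]

theorem bitsSent_map_sample (S : List (X × Bool)) : bitsSent (S.map Message.sample) = 0 := by
  simp [bitsSent, Function.comp_def, Message.bitLength]

theorem samplesSent_map_bits {ι : Type*} (L : List ι) (f : ι → List Bool) :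
    samplesSent (X := X) (L.map fun i => .bits (f i)) = 0 := by
  simp [samplesSent, Function.comp_def, Message.samples]

theorem bitsSent_map_bits {ι : Type*} (L : List ι) (f : ι → List Bool) :
    bitsSent (X := X) (L.map fun i => .bits (f i)) = (L.map fun i => (f i).length).sum := by
  simp [bitsSent, Function.comp_def, Message.bitLength]

theorem length_encodeNat (v : ℕ) : (encodeNat v).length = 2 * v.size + 1 := by
  simp only [encodeNat, List.length_append, List.length_replicate, List.length_cons,
    Nat.size_eq_bits_len]
  ring

theorem samplesSent_announce (N : Finset (Fin k)) (s : Fin k → ℕ) :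
    samplesSent (announce (X := X) N s) = 0 := samplesSent_map_bits _ _

theorem bitsSent_announce_le (N : Finset (Fin k)) {s : Fin k → ℕ} {B : ℕ}
    (hB : ∀ i ∈ N, (s i).size ≤ B) : bitsSent (announce (X := X) N s) ≤ k * (2 * B + 1) := by
  unfold announce
  rw [bitsSent_map_bits, sum_players]
  calc ∑ i ∈ N, (encodeNat (s i)).length ≤ ∑ _i ∈ N, (2 * B + 1) := by
        refine Finset.sum_le_sum fun i hi => ?_
        rw [length_encodeNat]
        have := hB i hi
        omega
    _ ≤ k * (2 * B + 1) := by
        rw [Finset.sum_const, smul_eq_mul]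
        exact Nat.mul_le_mul_right _ (by simpa using N.card_le_univ)

theorem sum_multinomial {N : Finset (Fin k)} (hN : N.Nonempty) (a : Fin k → ℕ) (n : ℕ)
    (coin : ℕ → unitInterval) :
    ∑ i ∈ N, multinomial ((players N).map fun i => (i, a i)) n coin i = n := by
  obtain ⟨i₀, -⟩ := id hN
  have h := Finset.card_eq_sum_card_fiberwise (s := Finset.range n) (t := N)
    (f := fun l => pickName i₀ N a (coin l)) (fun l _ => pickName_mem i₀ hN a _)
  rw [Finset.card_range] at h
  exact (Finset.sum_congr rfl fun i _ => multinomial_eq i₀ hN a n coin i).trans h.symm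

theorem multinomial_le (L : List (Fin k × ℕ)) (n : ℕ) (coin : ℕ → unitInterval) (i : Fin k) :
    multinomial L n coin i ≤ n :=
  (List.length_filter_le _ _).trans (List.length_range (n := n)).le

/-- The requests sum to exactly `n`; there is only an inequality since a request to an empty
reservoir returns nothing. -/
theorem length_sentExamples_le {N : Finset (Fin k)} (hN : N.Nonempty) (n j : ℕ)
    (S : Fin k → List (X × Bool)) (ω : Randomness X k) (t : ℕ) (hs : List (X → Bool)) :
    (sentExamples n j N S ω t hs).length ≤ n := by
  unfold sentExamples
  rw [List.length_flatMap, sum_players]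
  refine (Finset.sum_le_sum fun i _ => ?_).trans (sum_multinomial hN
    (fun i => approxWeight (report hs (S i))) n fun l => ω.2 (.request j t l)).le
  refine (List.length_filterMap_le _ _).trans ?_
  rw [List.length_range]

theorem boostRound_snd (A : List (X × Bool) → X → Bool) (n j : ℕ) (N : Finset (Fin k))
    (S : Fin k → List (X × Bool)) (ω : Randomness X k) (t : ℕ) (hs : List (X → Bool)) :
    (boostRound A n j N S ω t hs).2 = announce N (fun i => report hs (S i)) ++
      announce N (multinomial ((players N).map fun i => (i, approxWeight (report hs (S i)))) n
        fun l => ω.2 (.request j t l)) ++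
      (sentExamples n j N S ω t hs).map Message.sample := rfl

theorem samplesSent_boost_le {N : Finset (Fin k)} (hN : N.Nonempty) (n j : ℕ)
    (S : Fin k → List (X × Bool)) (ω : Randomness X k) (T : ℕ) :
    samplesSent (boost A n j N S ω T).2 ≤ T * n := by
  induction T with
  | zero => simp [boost, samplesSent]
  | succ T ih =>
    simp only [boost, boostRound_snd, samplesSent_append, samplesSent_announce,
      samplesSent_map_sample]
    have := length_sentExamples_le hN n j S ω T (boost A n j N S ω T).1
    rw [Nat.succ_mul]
    omega

theorem boostWeight_le (hs : List (X → Bool)) (z : X × Bool) :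
    boostWeight hs z ≤ 2 ^ hs.length :=
  Nat.pow_le_pow_right (by norm_num) List.countP_le_length

theorem size_mul_two_pow_le (m t : ℕ) : (m * 2 ^ t).size ≤ m.size + t := by
  rw [Nat.size_le, pow_add]
  exact Nat.mul_lt_mul_of_pos_right (Nat.lt_size_self m) (by positivity)

/-- After `t` rounds the weight is at most `m 2^t`, so the reported exponent is at most `m.size +
t`. Its code therefore has length logarithmic in `m.size + t`, doubly logarithmic in the weight. -/
theorem report_le {hs : List (X → Bool)} {S : List (X × Bool)} {m : ℕ} (hS : S.length ≤ m) :
    report hs S ≤ m.size + hs.length := by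
  refine le_trans (Nat.size_le_size ?_) (size_mul_two_pow_le m hs.length)
  refine (List.sum_le_card_nsmul _ (2 ^ hs.length) fun w hw => ?_).trans ?_
  · obtain ⟨z, -, rfl⟩ := List.mem_map.1 hw
    exact boostWeight_le hs z
  · rw [List.length_map, smul_eq_mul]
    exact Nat.mul_le_mul_right _ hS

theorem bitsSent_boost_le (n j : ℕ) (N : Finset (Fin k))
    {S : Fin k → List (X × Bool)} {m : ℕ} (hS : ∀ i, (S i).length ≤ m) (ω : Randomness X k)
    {t T : ℕ} (ht : t ≤ T) :
    bitsSent (boost A n j N S ω t).2 ≤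
      t * (k * (2 * (m.size + T).size + 1) + k * (2 * n.size + 1)) := by
  induction t with
  | zero => simp [boost, bitsSent]
  | succ t ih =>
    simp only [boost, boostRound_snd, bitsSent_append, bitsSent_map_sample]
    have h1 := bitsSent_announce_le (X := X) N
      (s := fun i => report (boost A n j N S ω t).1 (S i)) (B := (m.size + T).size)
      fun i _ => Nat.size_le_size ((report_le (hS i)).trans (by rw [length_boost]; omega))
    have h2 := bitsSent_announce_le (X := X) N
      (s := multinomial ((players N).map fun i =>
        (i, approxWeight (report (boost A n j N S ω t).1 (S i)))) n fun l => ω.2 (.request j t l))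
      (B := n.size) fun i _ => Nat.size_le_size (multinomial_le _ _ _ i)
    have h3 := ih (by omega)
    rw [Nat.succ_mul]
    omega

theorem length_reservoir_le (hstar : X → Bool) (m j : ℕ) (N : Finset (Fin k))
    (ω : Randomness X k) (i : Fin k) : (reservoir hstar m j N ω i).length ≤ m := by
  simp only [reservoir, List.length_map, List.length_range]
  exact multinomial_le _ _ _ _

theorem samplesSent_boostStep_le (hstar : X → Bool) (m T n : ℕ) (ω : Randomness X k) (j : ℕ)
    {N : Finset (Fin k)} (hN : N.Nonempty) :
    samplesSent (boostStep A hstar m T n ω j N).2 ≤ T * n := by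
  simp only [boostStep, samplesSent_append, samplesSent_announce, zero_add]
  exact samplesSent_boost_le hN n j _ ω T

theorem bitsSent_boostStep_le (hstar : X → Bool) (m T n : ℕ) (ω : Randomness X k) (j : ℕ)
    (N : Finset (Fin k)) : bitsSent (boostStep A hstar m T n ω j N).2 ≤
      k * (2 * m.size + 1) +
        T * (k * (2 * (m.size + T).size + 1) + k * (2 * n.size + 1)) := by
  simp only [boostStep, bitsSent_append]
  exact add_le_add (bitsSent_announce_le N fun i _ => Nat.size_le_size (multinomial_le _ _ _ i))
    (bitsSent_boost_le n j N (length_reservoir_le hstar m j N ω) ω le_rfl)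

theorem samplesSent_plainStep (hstar : X → Bool) (m : ℕ) (ω : Randomness X k) (j : ℕ)
    {N : Finset (Fin k)} (hN : N.Nonempty) : samplesSent (plainStep A hstar m ω j N).2 = m := by
  simp only [plainStep, samplesSent_append, samplesSent_announce, samplesSent_map_sample, zero_add]
  rw [List.length_flatMap, sum_players]
  simp only [reservoir, List.length_map, List.length_range]
  exact sum_multinomial hN (fun _ => 1) m fun l => ω.2 (.slot j l)

theorem samplesSent_loop_le {learn : ℕ → Finset (Fin k) → (X → Bool) × List (Message X)} {B : ℕ}
    (hB : ∀ j N, N.Nonempty → samplesSent (learn j N).2 ≤ B) (hstar : X → Bool)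
    (c ε δ' : ℝ) (ω : Randomness X k) (j : ℕ) :
    samplesSent (loop learn hstar c ε δ' ω j).transcript ≤ j * B := by
  induction j with
  | zero => simp [loop, samplesSent]
  | succ j ih =>
    simp only [loop]
    rw [Nat.succ_mul]
    split_ifs with h
    · omega
    · simp only [samplesSent_append, samplesSent_map_bits]
      have := hB j _ (Finset.nonempty_of_ne_empty h)
      omega

theorem bitsSent_loop_le {learn : ℕ → Finset (Fin k) → (X → Bool) × List (Message X)} {B : ℕ}
    (hB : ∀ j N, bitsSent (learn j N).2 ≤ B) (hstar : X → Bool)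
    (c ε δ' : ℝ) (ω : Randomness X k) (j : ℕ) :
    bitsSent (loop learn hstar c ε δ' ω j).transcript ≤ j * (B + k) := by
  induction j with
  | zero => simp [loop, bitsSent]
  | succ j ih =>
    simp only [loop]
    rw [Nat.succ_mul]
    split_ifs with h
    · omega
    · simp only [bitsSent_append, bitsSent_map_bits]
      have h1 := hB j (loop learn hstar c ε δ' ω j).active
      have h2 := (loop learn hstar c ε δ' ω j).active.card_le_univ
      simp only [List.length_singleton, List.map_const', List.sum_replicate, smul_eq_mul, mul_one,
        length_players]
      rw [Fintype.card_fin] at h2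
      omega

/-- The first round always takes place, since all players are active, and the blackboard only grows.
This bounds the samples of Personalized Learning from below by one full sample. -/
theorem samplesSent_first_le (hk : 0 < k)
    (learn : ℕ → Finset (Fin k) → (X → Bool) × List (Message X)) (hstar : X → Bool)
    (c ε δ' : ℝ) (ω : Randomness X k) {j : ℕ} (hj : 0 < j) :
    samplesSent (learn 0 Finset.univ).2 ≤
      samplesSent (loop learn hstar c ε δ' ω j).transcript := by
  induction j, hj using Nat.le_induction with
  | base =>
    have : Nonempty (Fin k) := ⟨⟨0, hk⟩⟩
    simp only [loop, Finset.univ_nonempty.ne_empty, if_false, samplesSent_append]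
    omega
  | succ j hj ih =>
    refine ih.trans ?_
    rw [loop]
    split_ifs with h
    · exact le_rfl
    · simp only [samplesSent_append]
      omega

theorem sampleComplexity_le_samplesSent [MeasurableSpace X] (hk : 2 ≤ k) (cTest : ℝ)
    (H : Set (X → Bool)) (hstar : X → Bool) (ε δ : ℝ) (ω : Randomness X k) :
    sampleComplexity H (ε / 4) (stepConfidence k δ) ≤
      samplesSent (personalizedLearning cTest H A hstar ε δ ω).transcript := by
  have : Nonempty (Fin k) := ⟨⟨0, by omega⟩⟩
  have := samplesSent_first_le (by omega : 0 < k) (plainStep A hstar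
    (sampleComplexity H (ε / 4) (stepConfidence k δ)) ω) hstar cTest ε (stepConfidence k δ) ω
    (Nat.clog_pos (by norm_num) hk : 0 < rounds k)
  rwa [samplesSent_plainStep hstar _ ω 0 Finset.univ_nonempty] at this

theorem samplesSent_personalizedBoosting_le (c : Constants) (d : ℕ) (hstar : X → Bool) (ε δ : ℝ)
    (ω : Randomness X k) :
    samplesSent (personalizedBoosting c d A hstar ε δ ω).transcript ≤
      rounds k * (boostRounds c.rounds ε *
        weakSize c.weak d (boostRounds c.rounds ε) (stepConfidence k δ)) :=
  samplesSent_loop_le (fun j _ hN => samplesSent_boostStep_le hstar _ _ _ ω j hN) ..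

theorem bitsSent_personalizedBoosting_le (c : Constants) (d : ℕ) (hstar : X → Bool) (ε δ : ℝ)
    (ω : Randomness X k) {m T n : ℕ} (hT : T = boostRounds c.rounds ε)
    (hm : m = reservoirSize c.reservoir d T ε (stepConfidence k δ))
    (hn : n = weakSize c.weak d T (stepConfidence k δ)) :
    bitsSent (personalizedBoosting c d A hstar ε δ ω).transcript ≤
      rounds k * (k * (2 * m.size + 1) +
        T * (k * (2 * (m.size + T).size + 1) + k * (2 * n.size + 1)) + k) := by
  subst hT hm hn
  exact bitsSent_loop_le (fun j N => bitsSent_boostStep_le hstar _ _ _ ω j N) ..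

end Communication

/-! ### Soft-`O` estimates -/

section Asymptotics

/-- Every quantity in the bounds is at least `1/2`, so a sum of them, constants included, is at most
a multiple of their product. Linear arithmetic then suffices to collect terms. -/
theorem le_mul_prod_of_half_le {a b c d : ℝ} (ha : 1 / 2 ≤ a) (hb : 1 / 2 ≤ b) (hc : 1 / 2 ≤ c)
    (hd : 1 / 2 ≤ d) : 1 ≤ 16 * (a * b * c * d) ∧ a ≤ 8 * (a * b * c * d) ∧
      b ≤ 8 * (a * b * c * d) ∧ c ≤ 8 * (a * b * c * d) ∧ d ≤ 8 * (a * b * c * d) := by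
  have key : ∀ x y z : ℝ, 1 / 2 ≤ x → 1 / 2 ≤ y → 1 / 2 ≤ z → 1 ≤ 8 * (x * y * z) := by
    intro x y z hx hy hz
    have h1 : (1 / 2 : ℝ) * (1 / 2) ≤ x * y := mul_le_mul hx hy (by norm_num) (by linarith)
    have h2 : (1 / 2 : ℝ) * (1 / 2) * (1 / 2) ≤ x * y * z :=
      mul_le_mul h1 hz (by norm_num) (by linarith)
    linarith
  have k1 := key b c d hb hc hd
  have k2 := key a c d ha hc hd
  have k3 := key a b d ha hb hd
  have k4 := key a b c ha hb hc
  have ea : a ≤ 8 * (a * b * c * d) := by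
    calc a ≤ a * (8 * (b * c * d)) := le_mul_of_one_le_right (by linarith) k1
      _ = _ := by ring
  refine ⟨by linarith, ea, ?_, ?_, ?_⟩
  · calc b ≤ b * (8 * (a * c * d)) := le_mul_of_one_le_right (by linarith) k2
      _ = _ := by ring
  · calc c ≤ c * (8 * (a * b * d)) := le_mul_of_one_le_right (by linarith) k3
      _ = _ := by ring
  · calc d ≤ d * (8 * (a * b * c)) := le_mul_of_one_le_right (by linarith) k4
      _ = _ := by ring

theorem size_le_log {x : ℕ} {y : ℝ} (hxy : (x : ℝ) ≤ y) (hy : 1 ≤ y) :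
    (x.size : ℝ) ≤ 1 + 1.5 * Real.log y := by
  have h2 := Real.log_two_gt_d9
  have hl := Real.log_nonneg hy
  rcases Nat.eq_zero_or_pos x.size with h | h
  · rw [h]; push_cast; linarith
  · have h1 : 2 ^ (x.size - 1) ≤ x := Nat.lt_size.1 (by omega)
    have h3 : ((2 : ℝ) ^ (x.size - 1)) ≤ y := le_trans (by exact_mod_cast h1) hxy
    have h4 := Real.log_le_log (by positivity) h3
    rw [Real.log_pow, Nat.cast_sub h] at h4
    push_cast at h4
    have h5 : (0 : ℝ) ≤ x.size - 1 := by
      have : (1 : ℝ) ≤ x.size := by exact_mod_cast h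
      linarith
    nlinarith

/-- `⌈log₂ k⌉ ≤ 1 + log₂ k ≤ 2 log₂ k`, and `2 / log 2 < 3`. -/
theorem rounds_le_log {k : ℕ} (hk : 2 ≤ k) : (rounds k : ℝ) ≤ 3 * Real.log k := by
  have h2 := Real.log_two_gt_d9
  have hk' : (2 : ℝ) ≤ k := by exact_mod_cast hk
  have hK : Real.log 2 ≤ Real.log k := Real.log_le_log (by norm_num) hk'
  have h1 : 2 ^ (rounds k - 1) < k := Nat.pow_pred_clog_lt_self (by norm_num) (by omega)
  have hr : 0 < rounds k := Nat.clog_pos (by norm_num) hk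
  have h3 : ((2 : ℝ) ^ (rounds k - 1)) ≤ k := by exact_mod_cast h1.le
  have h4 := Real.log_le_log (by positivity) h3
  rw [Real.log_pow, Nat.cast_sub hr] at h4
  push_cast at h4
  have h5 : (0 : ℝ) ≤ rounds k - 1 := by
    have : (1 : ℝ) ≤ rounds k := by exact_mod_cast hr
    linarith
  nlinarith

theorem boostRounds_le {ε : ℝ} (hε : 0 < ε) (hε1 : ε < 1) :
    (boostRounds 30 ε : ℝ) + 2 ≤ 35 * Real.log (2 / ε) := by
  have h2 := Real.log_two_gt_d9
  have hl := log_two_le_log_two_div hε hε1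
  have : (boostRounds 30 ε : ℝ) < 30 * Real.log (2 / ε) + 1 := Nat.ceil_lt_add_one (by linarith)
  linarith

theorem log_le_add_mul_log_two {x y : ℝ} (p : ℕ) (hx : 0 < x) (hy : 0 < y) (h : x ≤ 2 ^ p * y) :
    Real.log x ≤ 0.7 * p + Real.log y := by
  have h1 := Real.log_le_log hx h
  rw [Real.log_mul (by positivity) hy.ne', Real.log_pow] at h1
  have h2 := Real.log_two_lt_d9
  have h3 : (p : ℝ) * Real.log 2 ≤ p * 0.7 :=
    mul_le_mul_of_nonneg_left (by linarith) (Nat.cast_nonneg p)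
  linarith

variable {d k : ℕ} {ε δ : ℝ}

theorem half_le_log {x : ℝ} (hx : 2 ≤ x) : 1 / 2 ≤ Real.log x := by
  have h2 := Real.log_two_gt_d9
  have := Real.log_le_log (by norm_num) hx
  linarith

theorem weakSize_le (hk : 2 ≤ k) (T : ℕ) (hδ : 0 < δ) (hδ1 : δ < 1) :
    (weakSize 2880 d T (stepConfidence k δ) : ℝ) ≤
      2880 * (d + Real.log (T + 1) + Real.log (rounds k) + Real.log (2 / δ)) + 1 := by
  have hr0 : 0 < rounds k := Nat.clog_pos (by norm_num) hk
  have hr1 : (1 : ℝ) ≤ rounds k := by exact_mod_cast hr0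
  have hT : (0 : ℝ) ≤ T := Nat.cast_nonneg T
  have e : Real.log ((T + 1) / stepConfidence k δ) =
      Real.log (T + 1) + Real.log (rounds k) + Real.log (2 / δ) := by
    rw [← Real.log_mul (by positivity) (by positivity), ← Real.log_mul (by positivity)
      (by positivity)]
    congr 1
    unfold stepConfidence
    field_simp
  have h1 : 0 ≤ Real.log (2 / δ) := Real.log_nonneg ((le_div_iff₀ hδ).2 (by linarith))
  have h2 : 0 ≤ Real.log (rounds k) := Real.log_nonneg hr1
  have h3 : 0 ≤ Real.log ((T : ℝ) + 1) := Real.log_nonneg (by linarith)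
  unfold weakSize
  refine (Nat.ceil_lt_add_one ?_).le.trans (le_of_eq ?_)
  · rw [e]; positivity
  · rw [e]; ring

theorem sampleBound_le (hk : 2 ≤ k) (hd : 1 ≤ d) (hε : 0 < ε) (hε1 : ε < 1) (hδ : 0 < δ)
    (hδ1 : δ < 1) :
    (rounds k * (boostRounds 30 ε *
      weakSize 2880 d (boostRounds 30 ε) (stepConfidence k δ)) : ℝ) ≤
      10 ^ 8 * (Real.log k * d * Real.log (2 / ε)) *
        Real.log (2 + Real.log k * d * Real.log (2 / ε)) * Real.log (2 / δ) := by
  have hr := rounds_le_log hk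
  have hT := boostRounds_le hε hε1
  have hn := weakSize_le (d := d) hk (boostRounds 30 ε) hδ hδ1
  have hd' : (1 : ℝ) ≤ d := by exact_mod_cast hd
  have hK : 1 / 2 ≤ Real.log k := half_le_log (by exact_mod_cast hk)
  have hl : 1 / 2 ≤ Real.log (2 / ε) := half_le_log ((le_div_iff₀ hε).2 (by linarith))
  have hD : 1 / 2 ≤ Real.log (2 / δ) := half_le_log ((le_div_iff₀ hδ).2 (by linarith))
  have hr0 : 0 < rounds k := Nat.clog_pos (by norm_num) hk
  have hr1 : (1 : ℝ) ≤ rounds k := by exact_mod_cast hr0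
  set T := boostRounds 30 ε
  set n := weakSize 2880 d T (stepConfidence k δ)
  set K := Real.log k
  set l := Real.log (2 / ε)
  set Δ := Real.log (2 / δ)
  set f := K * d * l with hf
  have hT0 : (0 : ℝ) ≤ T := Nat.cast_nonneg T
  have hKf : K ≤ 2 * f := by
    have : 1 / 2 ≤ d * l := by nlinarith
    nlinarith
  have hlf : l ≤ 2 * f := by
    have : 1 / 2 ≤ K * d := by nlinarith
    nlinarith
  have hL : 1 / 2 ≤ Real.log (2 + f) := half_le_log (by linarith)
  -- Since `T + 1 ≤ 35 l ≤ 70 f`, the logarithm of `T` is absorbed by `log (2 + f)`; likewise for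
  -- the number of rounds, which is at most `3 K ≤ 6 f`.
  have h1 : Real.log (T + 1) ≤ 0.7 * (7 : ℕ) + Real.log (2 + f) :=
    log_le_add_mul_log_two 7 (by linarith) (by linarith) (by norm_num; linarith)
  have h2 : Real.log (rounds k) ≤ 0.7 * (3 : ℕ) + Real.log (2 + f) :=
    log_le_add_mul_log_two 3 (by linarith) (by linarith) (by norm_num; linarith)
  set Λ := Real.log (2 + f)
  push_cast at h1 h2
  have hn' : (n : ℝ) ≤ 10 ^ 5 * 8 * (d * Λ * Δ) := by
    obtain ⟨p1, p2, p3, p4, -⟩ := le_mul_prod_of_half_le (by linarith : 1 / 2 ≤ (d : ℝ)) hL hD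
      (by norm_num : (1 / 2 : ℝ) ≤ 1)
    rw [mul_one] at p1 p2 p3 p4
    linarith
  have hrT : (rounds k : ℝ) * T ≤ 3 * K * (35 * l) :=
    mul_le_mul hr (by linarith) hT0 (by linarith)
  calc (rounds k * (T * n) : ℝ) = rounds k * T * n := by ring
    _ ≤ 3 * K * (35 * l) * (10 ^ 5 * 8 * (d * Λ * Δ)) :=
        mul_le_mul hrT hn' (Nat.cast_nonneg n) (by positivity)
    _ = 105 * 8 * 10 ^ 5 * (f * Λ * Δ) := by rw [hf]; ring
    _ ≤ 10 ^ 8 * (f * Λ * Δ) := by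
        refine mul_le_mul_of_nonneg_right (by norm_num) ?_
        have : 0 < f := by linarith
        positivity
    _ = _ := by ring

/-- A crude polynomial bound is enough: the reservoirs are never transmitted and only the bit length
of their size matters. -/
theorem reservoirSize_le (hk : 2 ≤ k) (hε : 0 < ε) (hε1 : ε < 1) (hδ : 0 < δ)
    (hδ1 : δ < 1) :
    (reservoirSize 1440 d (boostRounds 30 ε) ε (stepConfidence k δ) : ℝ) ≤
      2 ^ 20 * ((d + 1) * (2 / ε) ^ 4 * k * Real.log (2 / δ)) := by
  have hr := rounds_le_log hk
  have hT := boostRounds_le hε hε1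
  have hk' : (2 : ℝ) ≤ k := by exact_mod_cast hk
  have he : 2 ≤ 2 / ε := (le_div_iff₀ hε).2 (by linarith)
  have hl : 1 / 2 ≤ Real.log (2 / ε) := half_le_log he
  have hle : Real.log (2 / ε) ≤ 2 / ε := Real.log_le_self (by linarith)
  have hKk : Real.log k ≤ k := Real.log_le_self (by linarith)
  have hD : 1 / 2 ≤ Real.log (2 / δ) := half_le_log ((le_div_iff₀ hδ).2 (by linarith))
  have hr0 : 0 < rounds k := Nat.clog_pos (by norm_num) hk
  have hr1 : (1 : ℝ) ≤ rounds k := by exact_mod_cast hr0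
  have hd0 : (0 : ℝ) ≤ d := Nat.cast_nonneg d
  have e : Real.log (1 / stepConfidence k δ) = Real.log (rounds k) + Real.log (2 / δ) := by
    rw [← Real.log_mul (by positivity) (by positivity)]
    congr 1
    unfold stepConfidence
    field_simp
  have hrlog : Real.log (rounds k) ≤ rounds k := Real.log_le_self (by linarith)
  have hrlog0 : 0 ≤ Real.log (rounds k) := Real.log_nonneg hr1
  have hT0 : (0 : ℝ) ≤ (boostRounds 30 ε : ℕ) := Nat.cast_nonneg _
  unfold reservoirSize
  rw [e]
  set T := boostRounds 30 ε
  set l := Real.log (2 / ε)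
  set Δ := Real.log (2 / δ)
  have hL : Real.log ((T : ℝ) + 1) ≤ T := by
    have := Real.log_le_sub_one_of_pos (by linarith : (0 : ℝ) < T + 1)
    linarith
  have hL0 : 0 ≤ Real.log ((T : ℝ) + 1) := Real.log_nonneg (by linarith)
  set g := 2 / ε with hg
  have hdT : d * T * Real.log ((T : ℝ) + 1) * l ≤ d * (35 * g) * (35 * g) * g := by
    gcongr <;> linarith
  have hdiv : ∀ x : ℝ, x / ε = x * g / 2 := by intro x; rw [hg]; field_simp
  refine (Nat.ceil_lt_add_one (by positivity)).le.trans ?_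
  rw [hdiv]
  have hg3 : 1 ≤ g ^ 3 := one_le_pow₀ (by linarith)
  have hdg : 1 ≤ (d + 1) * g ^ 3 := one_le_mul_of_one_le_of_one_le (by linarith) hg3
  have hkD : 1 ≤ k * Δ := by
    have := mul_le_mul hk' hD (by norm_num) (by linarith)
    linarith
  set Q := (d + 1) * g ^ 3 * (k * Δ) with hQdef
  have hQ : 1 ≤ Q := one_le_mul_of_one_le_of_one_le hdg hkD
  have q1 : d * g ^ 3 ≤ Q :=
    (mul_le_mul_of_nonneg_right (by linarith) (by linarith)).trans
      (le_mul_of_one_le_right (by linarith) hkD)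
  have hkDQ : k * Δ ≤ Q := le_mul_of_one_le_left (by linarith) hdg
  have q2 : Δ ≤ Q := (le_mul_of_one_le_left (by linarith) (by linarith)).trans hkDQ
  have q3 : (k : ℝ) ≤ 2 * Q := by
    have : k * (1 / 2) ≤ k * Δ := mul_le_mul_of_nonneg_left hD (by linarith)
    linarith
  have hgQ : 1 ≤ g * Q := one_le_mul_of_one_le_of_one_le (by linarith) hQ
  calc 1440 * (d * T * Real.log ((T : ℝ) + 1) * l + (Real.log (rounds k) + Δ)) * g / 2 + 1
      ≤ 1440 * (d * (35 * g) * (35 * g) * g + (3 * k + Δ)) * g / 2 + 1 := by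
        gcongr
        linarith
    _ = 720 * g * (1225 * (d * g ^ 3) + 3 * k + Δ) + 1 := by ring
    _ ≤ 720 * g * (1225 * Q + 3 * (2 * Q) + Q) + 1 := by gcongr
    _ = 887040 * (g * Q) + 1 := by ring
    _ ≤ 2 ^ 20 * (g * Q) := by linarith
    _ = _ := by rw [hQdef]; ring

theorem log_two_pow_mul_prod_le {a b c e : ℝ} (ha : 0 < a) (hb : 0 < b) (hc : 0 < c) (he : 0 < e) :
    Real.log (2 ^ 20 * (a * b * c * e)) ≤
      14 + Real.log a + Real.log b + Real.log c + Real.log e := by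
  rw [Real.log_mul (by positivity) (by positivity), Real.log_mul (by positivity) (by positivity),
    Real.log_mul (by positivity) (by positivity), Real.log_mul (by positivity) (by positivity),
    Real.log_pow]
  have := Real.log_two_lt_d9
  push_cast
  linarith

theorem size_reservoirSize_le (hk : 2 ≤ k) (hε : 0 < ε) (hε1 : ε < 1) (hδ : 0 < δ)
    (hδ1 : δ < 1) :
    ((reservoirSize 1440 d (boostRounds 30 ε) ε (stepConfidence k δ)).size : ℝ) ≤
      22 + 6 * (Real.log (d + 1) + Real.log (2 / ε) + Real.log k + Real.log (2 / δ)) := by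
  have hk' : (2 : ℝ) ≤ k := by exact_mod_cast hk
  have he : 2 ≤ 2 / ε := (le_div_iff₀ hε).2 (by linarith)
  have hl : 1 / 2 ≤ Real.log (2 / ε) := half_le_log he
  have hK : 1 / 2 ≤ Real.log k := half_le_log hk'
  have hD : 1 / 2 ≤ Real.log (2 / δ) := half_le_log ((le_div_iff₀ hδ).2 (by linarith))
  have hd0 : (0 : ℝ) ≤ d := Nat.cast_nonneg d
  have hd1 : 0 ≤ Real.log ((d : ℝ) + 1) := Real.log_nonneg (by linarith)
  have hΔ := Real.log_le_self (by linarith : 0 ≤ Real.log (2 / δ))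
  have h1 : (2 : ℝ) ^ 4 ≤ (2 / ε) ^ 4 := pow_le_pow_left₀ (by norm_num) he 4
  have h2 : (1 : ℝ) * 2 ^ 4 * 2 * (1 / 2) ≤ (d + 1) * (2 / ε) ^ 4 * k * Real.log (2 / δ) := by
    gcongr
    linarith
  have h3 := size_le_log (reservoirSize_le (d := d) hk hε hε1 hδ hδ1) (by linarith)
  have h4 := log_two_pow_mul_prod_le (a := d + 1) (b := (2 / ε) ^ 4) (c := k)
    (e := Real.log (2 / δ)) (by linarith) (by positivity) (by linarith) (by linarith)
  rw [Real.log_pow] at h4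
  push_cast at h4
  refine h3.trans ((add_le_add_right (mul_le_mul_of_nonneg_left h4 (by norm_num)) _).trans ?_)
  linarith

theorem bitBound_le (hk : 2 ≤ k) (hd : 1 ≤ d) (hε : 0 < ε) (hε1 : ε < 1) (hδ : 0 < δ)
    (hδ1 : δ < 1) {m T n : ℕ} (hT : T = boostRounds 30 ε)
    (hm : m = reservoirSize 1440 d T ε (stepConfidence k δ))
    (hn : n = weakSize 2880 d T (stepConfidence k δ)) :
    (rounds k * (k * (2 * m.size + 1) +
        T * (k * (2 * (m.size + T).size + 1) + k * (2 * n.size + 1)) + k) : ℝ) ≤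
      2 * 10 ^ 6 * (k * Real.log (d + 1) * Real.log (2 / ε)) *
        Real.log (2 + k * Real.log (d + 1) * Real.log (2 / ε)) ^ 2 * Real.log (2 / δ) := by
  have hr := rounds_le_log hk
  have hT' := boostRounds_le hε hε1
  have hn' := weakSize_le (d := d) hk T hδ hδ1
  have hsm := size_reservoirSize_le (d := d) hk hε hε1 hδ hδ1
  rw [← hT] at hT' hsm
  rw [← hn] at hn'
  rw [← hm] at hsm
  clear hT hm hn
  have hk' : (2 : ℝ) ≤ k := by exact_mod_cast hk
  have hd' : (1 : ℝ) ≤ d := by exact_mod_cast hd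
  have hK : 1 / 2 ≤ Real.log k := half_le_log (by exact_mod_cast hk)
  have hl : 1 / 2 ≤ Real.log (2 / ε) := half_le_log ((le_div_iff₀ hε).2 (by linarith))
  have hD : 1 / 2 ≤ Real.log (2 / δ) := half_le_log ((le_div_iff₀ hδ).2 (by linarith))
  have hd1 : 1 / 2 ≤ Real.log (d + 1) := half_le_log (by linarith)
  have hr0 : 0 < rounds k := Nat.clog_pos (by norm_num) hk
  have hr1 : (1 : ℝ) ≤ rounds k := by exact_mod_cast hr0
  have hT0 : (0 : ℝ) ≤ T := Nat.cast_nonneg T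
  have hrlog := Real.log_le_self (by linarith : (0 : ℝ) ≤ rounds k)
  have hTlog := Real.log_le_sub_one_of_pos (by linarith : (0 : ℝ) < T + 1)
  have hd1log : Real.log (d + 1) ≤ d := by
    have := Real.log_le_sub_one_of_pos (by linarith : (0 : ℝ) < d + 1)
    linarith
  generalize hldef : Real.log (2 / ε) = l at *
  generalize hΔdef : Real.log (2 / δ) = Δ at *
  generalize hKdef : Real.log (k : ℝ) = K at *
  generalize hudef : Real.log ((d : ℝ) + 1) = u at *
  have hΔlog := Real.log_le_self (by linarith : 0 ≤ Δ)
  have hKlog := Real.log_le_self (by linarith : 0 ≤ K)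
  have hul : 1 / 4 ≤ u * l := by
    have := mul_le_mul hd1 hl (by norm_num) (by linarith)
    linarith
  have hku : 1 ≤ k * u := by
    have := mul_le_mul hk' hd1 (by norm_num) (by linarith)
    linarith
  have hkf : k ≤ 4 * (k * u * l) := by
    have := mul_le_mul_of_nonneg_left hul (by linarith : (0 : ℝ) ≤ k)
    linarith
  have hlf : l ≤ k * u * l := le_mul_of_one_le_left (by linarith) hku
  generalize hf : k * u * l = f at *
  have hkK : K ≤ 0.7 * (2 : ℕ) + Real.log (2 + f) := by
    rw [← hKdef]
    exact log_le_add_mul_log_two 2 (by linarith) (by linarith) (by norm_num; linarith)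
  have hL : 1 / 2 ≤ Real.log (2 + f) := half_le_log (by linarith)
  have hllog : Real.log l ≤ Real.log (2 + f) := Real.log_le_log (by linarith) (by linarith)
  generalize Real.log (2 + f) = Λ at *
  push_cast at hkK
  -- `Y` dominates `n` and `m.size + T`, whose bit lengths are the cost of a boosting round. Its
  -- logarithm contains `l`, `K` and `Δ` only under a further logarithm.
  have hYlog := log_two_pow_mul_prod_le (a := d + 1) (b := l) (c := K) (e := Δ)
    (by linarith) (by linarith) (by linarith) (by linarith)
  rw [hudef] at hYlog
  obtain ⟨p1, p2, p3, p4, p5⟩ :=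
    le_mul_prod_of_half_le (by linarith : (1 : ℝ) / 2 ≤ d + 1) hl hK hD
  generalize hY : ((d : ℝ) + 1) * l * K * Δ = Y at *
  have hY1 : (1 : ℝ) ≤ 2 ^ 20 * Y := by linarith
  have hnY : (n : ℝ) ≤ 2 ^ 20 * Y := by linarith
  have hmY : ((m.size + T : ℕ) : ℝ) ≤ 2 ^ 20 * Y := by push_cast; linarith
  have hsn := size_le_log hnY hY1
  have hsmT := size_le_log hmY hY1
  generalize Real.log (2 ^ 20 * Y) = y at *
  clear hY1 hnY hmY hY p1 p2 p3 p4 p5 hn' hrlog hTlog hd1log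
  obtain ⟨p1, p2, p3, p4, p5⟩ := le_mul_prod_of_half_le hd1 hl hL hD
  obtain ⟨s1, s2, s3, s4, -⟩ := le_mul_prod_of_half_le hd1 hL hD (by norm_num : (1 / 2 : ℝ) ≤ 1)
  rw [mul_one] at s1 s2 s3 s4
  -- The preprocessing cost `b1` occurs once per round of the loop and may carry the factor `l`. The
  -- cost `b2` of a boosting round gets multiplied by `T ≤ 35 l` and must be free of `l`. One factor
  -- `Λ` comes from these lengths, the other from the number `rounds k ≤ 12 Λ`.
  have b1 : 2 * (m.size : ℝ) + 2 ≤ 2000 * (u * l * Λ * Δ) := by linarith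
  have b2 : (2 * ((m.size + T).size : ℝ) + 1) + (2 * (n.size : ℝ) + 1) ≤
      2400 * (u * Λ * Δ) := by linarith
  have hr9 : (rounds k : ℝ) ≤ 12 * Λ := by linarith
  have hT35 : (T : ℝ) ≤ 35 * l := by linarith
  calc (rounds k * (k * (2 * m.size + 1) +
        T * (k * (2 * (m.size + T).size + 1) + k * (2 * n.size + 1)) + k) : ℝ)
      = rounds k * (k * ((2 * m.size + 2) +
        T * ((2 * (m.size + T).size + 1) + (2 * n.size + 1)))) := by ring
    _ ≤ 12 * Λ * (k * (2000 * (u * l * Λ * Δ) + 35 * l * (2400 * (u * Λ * Δ)))) := by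
        gcongr
    _ = 1032000 * (f * Λ ^ 2 * Δ) := by rw [← hf]; ring
    _ ≤ 2 * 10 ^ 6 * (f * Λ ^ 2 * Δ) := by
        refine mul_le_mul_of_nonneg_right (by norm_num) ?_
        have : 0 < f := by linarith
        positivity
    _ = _ := by ring

end Asymptotics

/-! ### Upper and lower bounds for the sample complexity -/

section SampleComplexity

variable {X : Type u} [MeasurableSpace X] {H : Set (X → Bool)} {d : ℕ}

/-- Finitely many samples suffice for all consistent learners. -/
theorem exists_isPACSize (hHm : ∀ h ∈ H, Measurable h) (hH : HasVCDim H d) {ε δ : ℝ}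
    (hε : 0 < ε) (hε1 : ε < 1) (hδ : 0 < δ) : ∃ m, IsPACSize H ε δ m := by
  set Γ := 2 * (40 / ε) ^ d
  have hΓ : 0 < Γ := by positivity
  set m := ⌈20 / ε * Real.log (Γ / δ)⌉₊ with hm
  have hεm : Real.log (Γ / δ) ≤ ε * m / 20 := by
    have : 20 / ε * Real.log (Γ / δ) ≤ m := Nat.le_ceil _
    rw [div_mul_eq_mul_div, div_le_iff₀ hε] at this
    linarith
  refine ⟨m, fun A hA hstar hstar_mem D _ => ?_⟩
  have hlabel : ∀ x : Fin m → X, A (List.ofFn fun r => (x r, hstar (x r))) ∈ H := by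
    refine fun x => hA.mem _ ⟨hstar, hstar_mem, fun z hz => ?_⟩
    obtain ⟨r, rfl⟩ := (List.mem_ofFn' _ _).1 hz
    rfl
  have hstar_meas := hHm _ hstar_mem
  have hG : Measurable fun p : (Fin m → X) × X =>
      decide (A (List.ofFn fun r => (p.1 r, hstar (p.1 r))) p.2 ≠ hstar p.2) := by
    have h1 := (hA.measurable m).comp (f := fun p : (Fin m → X) × X =>
      ((fun r => (p.1 r, hstar (p.1 r))), p.2)) (by fun_prop)
    exact (Measurable.of_discrete (f := fun b : Bool × Bool => decide (b.1 ≠ b.2))).comp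
      (h1.prodMk (hstar_meas.comp measurable_snd))
  have hpat : ∀ w : Fin m → X × X, ∃ P : Finset (Fin m → Bool × Bool),
      (∀ z : Fin m → X, (fun l =>
        (decide (A (List.ofFn fun r => (z r, hstar (z r))) (w l).1 ≠ hstar (w l).1),
          decide (A (List.ofFn fun r => (z r, hstar (z r))) (w l).2 ≠ hstar (w l).2))) ∈ P) ∧
        (P.card : ℝ) ≤ (40 / ε) ^ d * Real.exp (ε * m / 20) := by
    intro w
    -- With `r = ε / 40` the double sample costs `exp (ε m / 20)`, half of the exponent `ε m / 10`.
    obtain ⟨P, hP, hc⟩ := exists_patterns hH (fun s : Fin m × Bool => if s.2 then (w s.1).2 else (w s.1).1)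
      (r := ε / 40) (by positivity) (by linarith)
    classical
    refine ⟨P.image fun q l => (decide (q (l, false) ≠ hstar (w l).1),
      decide (q (l, true) ≠ hstar (w l).2)), fun z => ?_, ?_⟩
    · exact Finset.mem_image.2 ⟨_, hP _ (hlabel z), by simp⟩
    · refine (le_trans (by exact_mod_cast Finset.card_image_le) hc).trans (le_of_eq ?_)
      rw [Fintype.card_prod, Fintype.card_fin, Fintype.card_bool, one_div_div]
      push_cast
      congr 2
      ring
  have hmain := relative_deviation D (G := fun x y =>
    decide (A (List.ofFn fun r => (x r, hstar (x r))) y ≠ hstar y)) hG hpat hε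
  refine le_trans (measure_mono fun x hx => ?_) (hmain.trans (ENNReal.ofReal_le_ofReal ?_))
  · refine ⟨by simpa [err] using hx, ?_⟩
    have : hits (fun y => decide (A (List.ofFn fun r => (x r, hstar (x r))) y ≠ hstar y)) x = 0 := by
      unfold hits
      rw [Finset.card_eq_zero, Finset.filter_eq_empty_iff]
      intro r _
      have := hA.consistent (List.ofFn fun r => (x r, hstar (x r))) ⟨hstar, hstar_mem, fun z hz => by
        obtain ⟨r, rfl⟩ := (List.mem_ofFn' _ _).1 hz
        rfl⟩ (x r, hstar (x r)) ((List.mem_ofFn' _ _).2 ⟨r, rfl⟩)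
      simpa using this
    rw [this]
    push_cast
    positivity
  · calc 2 * ((40 / ε) ^ d * Real.exp (ε * m / 20)) * Real.exp (-(ε * m / 10))
        = Γ * Real.exp (-(ε * m / 20)) := by
          rw [show -(ε * m / 20) = ε * m / 20 + -(ε * m / 10) by ring, Real.exp_add]
          ring
      _ ≤ Γ * Real.exp (-Real.log (Γ / δ)) := by gcongr
      _ = δ := by
          rw [Real.exp_neg, Real.exp_log (by positivity)]
          field_simp

/-- The learner that prefers the hypotheses in a list. -/
def preferring (A : List (X × Bool) → X → Bool) :
    List (X → Bool) → List (X × Bool) → X → Bool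
  | [], S => A S
  | g :: L, S => if ∀ z ∈ S, g z.1 = z.2 then g else preferring A L S

omit [MeasurableSpace X] in
theorem preferring_mem (A : List (X × Bool) → X → Bool) {L : List (X → Bool)}
    {S : List (X × Bool)} (h : ∃ g ∈ L, ∀ z ∈ S, g z.1 = z.2) : preferring A L S ∈ L := by
  induction L with
  | nil => simp at h
  | cons g L ih =>
    unfold preferring
    split_ifs with hg
    · simp
    · obtain ⟨g', hg', hc⟩ := h
      rcases List.mem_cons.1 hg' with rfl | h'
      · exact absurd hc hg
      · exact List.mem_cons_of_mem _ (ih ⟨g', h', hc⟩)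

theorem isConsistentLearner_preferring (hHm : ∀ h ∈ H, Measurable h)
    {A : List (X × Bool) → X → Bool} (hA : IsConsistentLearner H A) {L : List (X → Bool)}
    (hL : ∀ g ∈ L, g ∈ H) : IsConsistentLearner H (preferring A L) := by
  induction L with
  | nil => exact hA
  | cons g L ih =>
    have ih' := ih fun g' h => hL g' (List.mem_cons_of_mem _ h)
    have hg := hHm g (hL g List.mem_cons_self)
    refine ⟨fun S hS => ?_, fun S hS => ?_, fun n => ?_⟩
    · unfold preferring
      split_ifs
      exacts [hL g List.mem_cons_self, ih'.mem S hS]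
    · unfold preferring
      split_ifs with h
      exacts [h, ih'.consistent S hS]
    · have hs : MeasurableSet {p : (Fin n → X × Bool) × X |
          ∀ z ∈ List.ofFn p.1, g z.1 = z.2} := by
        have : {p : (Fin n → X × Bool) × X | ∀ z ∈ List.ofFn p.1, g z.1 = z.2} =
            ⋂ r, {p | g (p.1 r).1 = (p.1 r).2} := by
          ext p; simp [List.mem_ofFn', Set.mem_range]
        rw [this]
        exact MeasurableSet.iInter fun r => measurableSet_eq_fun (by fun_prop) (by fun_prop)
      have h := @Measurable.ite _ _ _ _ _ _ _ (Classical.decPred _) hs (hg.comp measurable_snd)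
        (ih'.measurable n)
      convert h using 2 with p
      simp only [preferring]
      split_ifs <;> rfl

/-- The standard lower bound for the sample complexity of consistent learners. -/
theorem IsPACSize.div_le (hHm : ∀ h ∈ H, Measurable h) (hH : HasVCDim H d)
    {A : List (X × Bool) → X → Bool} (hA : IsConsistentLearner H A) (hd : 2 ≤ d) {ε δ : ℝ}
    (hε : 0 < ε) (hε1 : ε < 1) (hδ : 0 ≤ δ) (hδ1 : δ < 1 / 2) {m : ℕ}
    (hm : IsPACSize H (ε / 4) δ m) : d / ε ≤ 4 * m := by
  classical
  obtain ⟨A₀, hcard, hsh⟩ := hH.1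
  obtain ⟨x₀, hx₀⟩ : A₀.Nonempty := Finset.card_pos.1 (by omega)
  set L := A₀.erase x₀ with hL
  have hLcard : L.card + 1 = d := by rw [hL, Finset.card_erase_add_one hx₀, hcard]
  choose hyp hyp_mem hyp_eq using fun B : Finset X => hsh fun x => decide (x ∈ B)
  -- The target labels the shattered set by `false`. The adversarial learner prefers hypotheses that
  -- are `true` on at least half of the light points `L`, and each of these is wrong there; `A`
  -- serves only as a fallback.
  set Ls : List (X → Bool) := (L.powerset.filter fun B => L.card ≤ 2 * B.card).toList.map hyp with hLs
  have hLsH : ∀ g ∈ Ls, g ∈ H := by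
    intro g hg
    obtain ⟨B, -, rfl⟩ := List.mem_map.1 hg
    exact hyp_mem B
  have hm' := hm _ (isConsistentLearner_preferring hHm hA hLsH) _ (hyp_mem ∅)
  -- The hard distribution has mass `1 - ε / 2` at `x₀` and `ε / 2` spread evenly over `L`. It is
  -- built on a discrete index type and pushed forward, as points of `X` need not be measurable.
  let _ : MeasurableSpace (Option L) := ⊤
  have : DiscreteMeasurableSpace (Option L) := ⟨fun _ => trivial⟩
  set s : ℝ := (L.card : ℝ) with hs
  have hs1 : 1 ≤ s := by
    have : 1 ≤ L.card := by omega
    rw [hs]; exact_mod_cast this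
  set lite : Measure (Option L) := ∑ x : L, ENNReal.ofReal (ε / (2 * s)) • Measure.dirac (some x)
    with hlite
  set ν : Measure (Option L) := ENNReal.ofReal (1 - ε / 2) • Measure.dirac none + lite with hν
  have hlight : lite Set.univ = ENNReal.ofReal (ε / 2) := by
    rw [hlite, Measure.finsetSum_apply]
    simp only [Measure.smul_apply, measure_univ, smul_eq_mul, mul_one, Finset.sum_const,
      Finset.card_univ, Fintype.card_coe, nsmul_eq_mul]
    rw [← ENNReal.ofReal_natCast, ← ENNReal.ofReal_mul (by positivity)]
    congr 1
    rw [← hs]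
    field_simp
  have hprob : IsProbabilityMeasure ν := by
    refine ⟨?_⟩
    rw [hν, Measure.add_apply, hlight, Measure.smul_apply, measure_univ, smul_eq_mul, mul_one,
      ← ENNReal.ofReal_add (by linarith) (by positivity)]
    simp
  have hnone : ν {y | y ≠ none} ≤ ENNReal.ofReal (ε / 2) := by
    rw [hν, Measure.add_apply, Measure.smul_apply, Measure.dirac_apply' _ MeasurableSet.of_discrete]
    simp only [ne_eq, Set.mem_ofPred_eq, not_true_eq_false, not_false_eq_true,
      Set.indicator_of_notMem, smul_eq_mul, mul_zero, zero_add]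
    exact (measure_mono (Set.subset_univ _)).trans hlight.le
  let φ : Option L → X := fun y => y.elim x₀ Subtype.val
  have hφ : Measurable φ := Measurable.of_discrete
  have hφA : ∀ y, φ y ∈ A₀ := by
    rintro (_ | ⟨x, hx⟩)
    exacts [hx₀, Finset.mem_of_mem_erase hx]
  have hφ0 : ∀ y, φ y ∈ L → y ≠ none := by
    rintro y hy rfl
    exact Finset.notMem_erase x₀ A₀ hy
  have hprobφ : IsProbabilityMeasure (ν.map φ) := Measure.isProbabilityMeasure_map hφ.aemeasurable
  have herr : ∀ B ⊆ L, L.card ≤ 2 * B.card → ε / 4 ≤ err (ν.map φ) (hyp ∅) (hyp B) := by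
    intro B hB hcB
    have hmeas : MeasurableSet {x | hyp B x ≠ hyp ∅ x} :=
      (measurableSet_eq_fun (hHm _ (hyp_mem B)) (hHm _ (hyp_mem ∅))).compl
    unfold err
    rw [measureReal_def, Measure.map_apply hφ hmeas,
      ← ENNReal.ofReal_le_iff_le_toReal (measure_ne_top _ _)]
    set c := ENNReal.ofReal (ε / (2 * s)) with hc
    have hcB' : s ≤ 2 * B.card := by rw [hs]; exact_mod_cast hcB
    calc ENNReal.ofReal (ε / 4) ≤ B.card * c := by
          rw [hc, ← ENNReal.ofReal_natCast, ← ENNReal.ofReal_mul (by positivity)]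
          refine ENNReal.ofReal_le_ofReal ?_
          rw [mul_div_assoc', le_div_iff₀ (by positivity)]
          nlinarith
      _ = ∑ x : L, if x.1 ∈ B then c else 0 := by
          rw [Finset.sum_coe_sort L fun x => if x ∈ B then c else 0, Finset.sum_ite_mem,
            Finset.inter_eq_right.2 hB, Finset.sum_const, nsmul_eq_mul]
      _ ≤ lite (φ ⁻¹' {x | hyp B x ≠ hyp ∅ x}) := by
          rw [hlite, Measure.finsetSum_apply]
          refine Finset.sum_le_sum fun x _ => ?_
          split_ifs with hx
          · have hin : some x ∈ φ ⁻¹' {x | hyp B x ≠ hyp ∅ x} := by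
              change hyp B x.1 ≠ hyp ∅ x.1
              have hxA : x.1 ∈ A₀ := hφA (some x)
              rw [hyp_eq _ _ hxA, hyp_eq _ _ hxA]
              simpa using hx
            rw [Measure.smul_apply, Measure.dirac_apply' _ MeasurableSet.of_discrete,
              Set.indicator_of_mem hin]
            simp
          · exact zero_le
      _ ≤ ν (φ ⁻¹' {x | hyp B x ≠ hyp ∅ x}) := by
          rw [hν, Measure.add_apply]
          exact le_add_self
  set μ := Measure.pi fun _ : Fin m => ν with hμ
  set cnt : (Fin m → Option L) → ENNReal := fun y => ∑ r, if y r ≠ none then 1 else 0 with hcnt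
  -- If fewer than half of the light points can have been seen, the hypothesis that is `true`
  -- exactly on the unseen ones is a preferred one and fits the sample. So some preferred hypothesis
  -- is returned, with error at least half of `ε / 2`.
  have hfail : ∀ y : Fin m → Option L, ¬ (L.card : ENNReal) ≤ 2 * cnt y →
      ε / 4 ≤ err (ν.map φ) (hyp ∅)
        (preferring A Ls (List.ofFn fun r => (φ (y r), hyp ∅ (φ (y r))))) := by
    intro y hy
    set B := L.filter fun x => ∀ r, φ (y r) ≠ x with hB
    have hcB : L.card ≤ 2 * B.card := by
      have h1 : L \ B ⊆ (Finset.univ.filter fun r => y r ≠ none).image fun r => φ (y r) := by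
        intro x hx
        simp only [hB, Finset.mem_sdiff, Finset.mem_filter, not_and, not_forall, not_not] at hx
        obtain ⟨r, hr⟩ := hx.2 hx.1
        refine Finset.mem_image.2 ⟨r, Finset.mem_filter.2 ⟨Finset.mem_univ _, hφ0 _ ?_⟩, hr⟩
        rw [hr]; exact hx.1
      have h2 := (Finset.card_le_card h1).trans Finset.card_image_le
      have h3 := Finset.card_sdiff_add_card_eq_card (Finset.filter_subset (fun x => ∀ r, φ (y r) ≠ x) L)
      have h4 : cnt y = ((Finset.univ.filter fun r => y r ≠ none).card : ENNReal) := by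
        rw [hcnt, Finset.card_filter]; push_cast; rfl
      rw [h4] at hy
      have h5 : ¬ L.card ≤ 2 * (Finset.univ.filter fun r => y r ≠ none).card := by
        exact_mod_cast hy
      rw [← hB] at h3
      omega
    have hmem := preferring_mem A (L := Ls)
      (S := List.ofFn fun r => (φ (y r), hyp ∅ (φ (y r)))) ⟨hyp B, ?_, ?_⟩
    · obtain ⟨B', hB', h⟩ := List.mem_map.1 hmem
      rw [← h]
      rw [Finset.mem_toList, Finset.mem_filter, Finset.mem_powerset] at hB'
      exact herr B' hB'.1 hB'.2
    · refine List.mem_map.2 ⟨B, ?_, rfl⟩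
      rw [Finset.mem_toList, Finset.mem_filter, Finset.mem_powerset]
      exact ⟨Finset.filter_subset _ _, hcB⟩
    · intro z hz
      obtain ⟨r, rfl⟩ := (List.mem_ofFn' _ _).1 hz
      simp only
      rw [hyp_eq _ _ (hφA _), hyp_eq _ _ (hφA _)]
      simp [hB]
  have hpi : Measure.pi (fun _ : Fin m => ν.map φ) = μ.map fun y r => φ (y r) :=
    (Measure.pi_map_pi fun _ => hφ.aemeasurable).symm
  have h1 : μ {y | ¬ (L.card : ENNReal) ≤ 2 * cnt y} ≤ ENNReal.ofReal δ := by
    refine le_trans ?_ (hm' (ν.map φ))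
    rw [hpi]
    exact (measure_mono fun y hy => hfail y hy).trans
      (Measure.le_map_apply (Measurable.of_discrete).aemeasurable _)
  have hcntm : Measurable cnt := Measurable.of_discrete
  have hint : ∫⁻ y, 2 * cnt y ∂μ ≤ m * ENNReal.ofReal ε := by
    rw [lintegral_const_mul _ hcntm, hcnt, lintegral_finsetSum _ fun r _ => Measurable.of_discrete]
    have : ∀ r, ∫⁻ y, (if y r ≠ none then (1 : ENNReal) else 0) ∂μ ≤ ENNReal.ofReal (ε / 2) := by
      intro r
      have e : (fun y : Fin m → Option L => if y r ≠ none then (1 : ENNReal) else 0) =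
          {y | y r ≠ none}.indicator fun _ => 1 := by
        ext y; simp [Set.indicator_apply]
      rw [e, lintegral_indicator_const MeasurableSet.of_discrete, one_mul]
      refine le_trans (le_of_eq ?_) hnone
      exact (measurePreserving_eval (fun _ : Fin m => ν) r).measure_preimage
        (MeasurableSet.of_discrete (s := {y : Option L | y ≠ none})).nullMeasurableSet
    refine (mul_le_mul_right (Finset.sum_le_sum fun r _ => this r) _).trans (le_of_eq ?_)
    rw [Finset.sum_const, Finset.card_univ, Fintype.card_fin, nsmul_eq_mul,
      show (2 : ENNReal) = ENNReal.ofReal 2 by simp, mul_left_comm,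
      ← ENNReal.ofReal_mul (by norm_num)]
    congr 2
    ring
  -- Markov's inequality: the expected number of light draws is at most `m ε / 2`.
  have h2 := (mul_meas_ge_le_lintegral (μ := μ) (f := fun y => 2 * cnt y) (hcntm.const_mul 2)
    (L.card : ENNReal)).trans hint
  have h3 : (L.card : ENNReal) ≤ L.card * ENNReal.ofReal δ + m * ENNReal.ofReal ε := by
    calc (L.card : ENNReal) = L.card * μ Set.univ := by rw [measure_univ, mul_one]
      _ ≤ L.card * (μ {y | ¬ (L.card : ENNReal) ≤ 2 * cnt y} +
          μ {y | (L.card : ENNReal) ≤ 2 * cnt y}) := by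
        gcongr
        refine (measure_mono fun y _ => ?_).trans (measure_union_le _ _)
        by_cases h : (L.card : ENNReal) ≤ 2 * cnt y
        exacts [Or.inr h, Or.inl h]
      _ ≤ _ := by
        rw [mul_add]
        exact add_le_add (mul_le_mul_right h1 _) h2
  have h4 : s ≤ s * δ + m * ε := by
    rw [← ENNReal.ofReal_natCast, ← ENNReal.ofReal_natCast, ← ENNReal.ofReal_mul (by positivity),
      ← ENNReal.ofReal_mul (by positivity), ← ENNReal.ofReal_add (by positivity) (by positivity),
      ENNReal.ofReal_le_ofReal_iff (by positivity)] at h3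
    exact h3
  have h5 : s + 1 = d := by rw [hs]; exact_mod_cast hLcard
  rw [div_le_iff₀ hε]
  -- From `s (1 - δ) ≤ m ε` with `δ < 1/2`, and `d = s + 1 ≤ 2 s`.
  nlinarith

/-- The infimum is attained because the set of sufficient sizes is nonempty; for an empty set `sInf`
would be `0` and the bound would fail. -/
theorem div_le_sampleComplexity (hHm : ∀ h ∈ H, Measurable h) (hH : HasVCDim H d)
    {A : List (X × Bool) → X → Bool} (hA : IsConsistentLearner H A) (hd : 2 ≤ d) {ε δ : ℝ}
    (hε : 0 < ε) (hε1 : ε < 1) (hδ : 0 < δ) (hδ1 : δ < 1 / 2) :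
    d / ε ≤ 4 * (sampleComplexity H (ε / 4) δ : ℕ) :=
  IsPACSize.div_le hHm hH hA hd hε hε1 hδ.le hδ1
    (Nat.sInf_mem (exists_isPACSize hHm hH (by positivity) (by linarith) hδ))

end SampleComplexity

/-! ### A common power of the logarithm -/

section SoftO

/-- The sample bound has one logarithmic factor, the bit bound two. As the logarithm is at least
`1/2`, the exponent `a = 2` serves both. -/
theorem le_mul_sq_of_half_le {f L D c : ℝ} (hf : 0 ≤ f) (hL : 1 / 2 ≤ L) (hD : 0 ≤ D) (hc : 0 ≤ c) :
    c * f * L * D ≤ 2 * c * (f * L ^ 2) * D := by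
  have h1 : L ≤ 2 * L ^ 2 := by nlinarith
  calc c * f * L * D ≤ c * f * (2 * L ^ 2) * D := by gcongr
    _ = _ := by ring

end SoftO

end

end CollabPAC

/-! ### Assembly of the three claims -/

theorem theorem10 :
    ∃ (c : CollabPAC.Constants) (C : ℝ) (a : ℕ), 0 < C ∧
      ∀ (X : Type u) [MeasurableSpace X] (H : Set (X → Bool)) (d k : ℕ) (ε δ : ℝ)
        (A : List (X × Bool) → X → Bool) (hstar : X → Bool)
        (D : Fin k → Measure X) [∀ i, IsProbabilityMeasure (D i)],
        (∀ h ∈ H, Measurable h) → CollabPAC.HasVCDim H d → 1 ≤ d →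
        CollabPAC.IsConsistentLearner H A → hstar ∈ H → 2 ≤ k →
        0 < ε → ε < 1 → 0 < δ → δ < 1 →
        -- with probability at least `1 - δ` every player obtains an `ε`-accurate classifier
        CollabPAC.law D {ω | ¬ CollabPAC.Completed D hstar ε
          (CollabPAC.personalizedBoosting c d A hstar ε δ ω)} ≤ ENNReal.ofReal δ ∧
        -- samples and additional bits communicated, in every run
        (∀ ω : CollabPAC.Randomness X k,
          (CollabPAC.samplesSent
              (CollabPAC.personalizedBoosting c d A hstar ε δ ω).transcript : ℝ) ≤
            C * CollabPAC.softO a (Real.log k * d * Real.log (2 / ε)) * Real.log (2 / δ) ∧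
          (CollabPAC.bitsSent
              (CollabPAC.personalizedBoosting c d A hstar ε δ ω).transcript : ℝ) ≤
            C * CollabPAC.softO a (k * Real.log (d + 1) * Real.log (2 / ε)) *
              Real.log (2 / δ)) ∧
        -- exponential improvement over Personalized Learning
        (2 ≤ d → ∀ (cTest : ℝ) (ω ω' : CollabPAC.Randomness X k),
          d / ε ≤ C * (CollabPAC.samplesSent
            (CollabPAC.personalizedLearning cTest H A hstar ε δ ω').transcript : ℝ) ∧
          (CollabPAC.samplesSent
              (CollabPAC.personalizedBoosting c d A hstar ε δ ω).transcript : ℝ) ≤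
            C * CollabPAC.softO a (Real.log k * d * Real.log (2 + (CollabPAC.samplesSent
              (CollabPAC.personalizedLearning cTest H A hstar ε δ ω').transcript : ℝ))) *
              Real.log (2 / δ)) := by
  -- The largest constant arises in the comparison with Personalized Learning: `2 · 9 · 10^8`.
  refine ⟨⟨30, 2880, 1440, 100⟩, 2 * 10 ^ 9, 2, by norm_num, ?_⟩
  intro X _ H d k ε δ A hstar D _ hHm hH hd hA hstar_mem hk hε hε1 hδ hδ1
  have hK : 1 / 2 ≤ Real.log k := CollabPAC.half_le_log (by exact_mod_cast hk)
  have he : 2 ≤ 2 / ε := (le_div_iff₀ hε).2 (by linarith)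
  have hl : 1 / 2 ≤ Real.log (2 / ε) := CollabPAC.half_le_log he
  have hD : 1 / 2 ≤ Real.log (2 / δ) :=
    CollabPAC.half_le_log ((le_div_iff₀ hδ).2 (by linarith))
  have hsamples := fun ω => CollabPAC.samplesSent_personalizedBoosting_le (A := A)
    ⟨30, 2880, 1440, 100⟩ d hstar ε δ ω (k := k)
  have hbound := CollabPAC.sampleBound_le hk hd hε hε1 hδ hδ1
  refine ⟨CollabPAC.law_not_completed_personalizedBoosting_le hHm hA hH hd hstar_mem D hk hε hε1 hδ
    hδ1, fun ω => ⟨?_, ?_⟩, fun hd2 cTest ω ω' => ?_⟩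
  · refine (Nat.cast_le.2 (hsamples ω)).trans ?_
    push_cast
    refine hbound.trans ?_
    have hf : 0 ≤ Real.log k * d * Real.log (2 / ε) := by positivity
    refine (CollabPAC.le_mul_sq_of_half_le hf (CollabPAC.half_le_log (by linarith))
      (by linarith) (by norm_num)).trans ?_
    unfold CollabPAC.softO
    gcongr
    all_goals norm_num
  · refine (Nat.cast_le.2 (CollabPAC.bitsSent_personalizedBoosting_le (A := A)
      ⟨30, 2880, 1440, 100⟩ d hstar ε δ ω rfl rfl rfl)).trans ?_
    push_cast
    refine (CollabPAC.bitBound_le hk hd hε hε1 hδ hδ1 rfl rfl rfl).trans ?_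
    have hd1 : 0 ≤ Real.log ((d : ℝ) + 1) := Real.log_nonneg (by linarith [d.cast_nonneg (α := ℝ)])
    unfold CollabPAC.softO
    rw [mul_assoc (2 * 10 ^ 6 : ℝ)]
    gcongr
    all_goals norm_num
  · have hP := CollabPAC.sampleComplexity_le_samplesSent (A := A) hk cTest H hstar ε δ ω'
    have hlow := CollabPAC.div_le_sampleComplexity hHm hH hA hd2 hε hε1
      (CollabPAC.stepConfidence_pos hk hδ) (CollabPAC.stepConfidence_lt hk hδ1)
    have hP' : d / ε ≤ 4 * (CollabPAC.samplesSent
        (CollabPAC.personalizedLearning cTest H A hstar ε δ ω').transcript : ℝ) :=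
      hlow.trans (mul_le_mul_of_nonneg_left (by exact_mod_cast hP) (by norm_num))
    have hP0 : (0 : ℝ) ≤ (CollabPAC.samplesSent
        (CollabPAC.personalizedLearning cTest H A hstar ε δ ω').transcript : ℝ) :=
      Nat.cast_nonneg _
    generalize (CollabPAC.samplesSent
      (CollabPAC.personalizedLearning cTest H A hstar ε δ ω').transcript : ℝ) = P at hP' hP0 ⊢
    refine ⟨hP'.trans (by linarith), ?_⟩
    refine (Nat.cast_le.2 (hsamples ω)).trans ?_
    push_cast
    refine hbound.trans ?_
    have hp : 1 / 2 ≤ Real.log (2 + P) := CollabPAC.half_le_log (by linarith)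
    have h2 : Real.log 2 ≤ Real.log (2 + P) := Real.log_le_log (by norm_num) (by linarith)
    -- Because `d ≥ 2`, the lower bound gives `2 / ε ≤ d / ε ≤ 4 P`.
    have hlp : Real.log (2 / ε) ≤ 3 * Real.log (2 + P) := by
      have h1 : 2 / ε ≤ 2 ^ 2 * (2 + P) := by
        have : 2 / ε ≤ d / ε := by
          gcongr
          exact_mod_cast hd2
        linarith
      have := Real.log_le_log (by positivity) h1
      rw [Real.log_mul (by norm_num) (by linarith), Real.log_pow] at this
      push_cast at this
      linarith
    have hff : Real.log k * d * Real.log (2 / ε) ≤ 3 * (Real.log k * d * Real.log (2 + P)) := by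
      calc Real.log k * d * Real.log (2 / ε) ≤ Real.log k * d * (3 * Real.log (2 + P)) := by gcongr
        _ = _ := by ring
    have hf0 : 0 ≤ Real.log k * d * Real.log (2 / ε) := by positivity
    have hf1 : 0 ≤ Real.log k * d * Real.log (2 + P) := by positivity
    unfold CollabPAC.softO
    generalize Real.log k * d * Real.log (2 / ε) = f at hff hf0 ⊢
    generalize Real.log k * d * Real.log (2 + P) = g at hff hf1 ⊢
    -- `f ≤ 3 g` gives `2 + f ≤ 4 (2 + g)`, and `log 4 ≤ 2 log (2 + g)`.
    have hL : Real.log (2 + f) ≤ 3 * Real.log (2 + g) := by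
      have h1 : Real.log (2 + f) ≤ Real.log (2 ^ 2 * (2 + g)) :=
        Real.log_le_log (by linarith) (by linarith)
      rw [Real.log_mul (by norm_num) (by linarith), Real.log_pow] at h1
      have h3 : Real.log 2 ≤ Real.log (2 + g) := Real.log_le_log (by norm_num) (by linarith)
      push_cast at h1
      linarith
    calc 10 ^ 8 * f * Real.log (2 + f) * Real.log (2 / δ)
        ≤ 10 ^ 8 * (3 * g) * (3 * Real.log (2 + g)) * Real.log (2 / δ) := by
          gcongr
          exact (by linarith [CollabPAC.half_le_log (by linarith : 2 ≤ 2 + f)])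
      _ = 9 * 10 ^ 8 * g * Real.log (2 + g) * Real.log (2 / δ) := by ring
      _ ≤ 2 * (9 * 10 ^ 8) * (g * Real.log (2 + g) ^ 2) * Real.log (2 / δ) :=
          CollabPAC.le_mul_sq_of_half_le hf1 (CollabPAC.half_le_log (by linarith)) (by linarith)
            (by norm_num)
      _ ≤ _ := by
          gcongr
          norm_num
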